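/- Let $M$ be a smooth (finite dimensional, Hausdorff, $\sigma$-compact) manifold, $(A,\rho_A,[\cdot,\cdot])$ a Lie algebroid over $M$ (a real vector bundle $A$, a bundle map $\rho_A:A\to TM$ and an $\mathbb{R}$-Lie bracket on $\Gamma(A)$ with $[a,fb]=f[a,b]+(\rho_A\circ a)(f)\,b$), and $E$ a real vector bundle over $M$. An $\mathbb{R}$-linear connection of $A$ on $E$ is an $\mathbb{R}$-linear map $a\mapsto\nabla_a$ from $\Gamma(A)$ to the $\mathbb{R}$-linear operators on $\Gamma(E)$ with $\nabla_a(fs)=f\nabla_a s+(\rho_A\circ a)(f)\,s$ for $f\in C^\infty(M)$ (no $C^\infty(M)$-linearity in $a$ is required). Its curvature is $R^\nabla_{a,b}=[\nabla_a,\nabla_b]-\nabla_{[a,b]}\in\Gamma(\operatorname{End}E)$, and $\nabla$ is flat if $R^\nabla=0$. Let $H^{\bullet}_{\rho_A,\mathbb{R}}(A)$ be the cohomology of the $\mathbb{R}$-multilinear alternating forms $\mathcal{A}lt^\bullet_{\mathbb{R}}(\Gamma(A);C^\infty(M))$ with the differential $$(d_{A,\mathbb{R}}\eta)(a_0,\dots,a_n)=\sum_i(-1)^i(\rho_A\circ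 a_i)\big(\eta(\dots,\widehat{a_i},\dots)\big)+\sum_{i<j}(-1)^{i+j}\eta([a_i,a_j],\dots,\widehat{a_i},\dots,\widehat{a_j},\dots).$$ For $p\ge1$ put $$\operatorname{ch}_p(\nabla)(a_1,\dots,a_{2p})=\frac1{2^p}\sum_{\tau\in S_{2p}}\operatorname{sgn}\tau\,\operatorname{Tr}\big(R^\nabla_{a_{\tau(1)},a_{\tau(2)}}\circ\cdots\circ R^\nabla_{a_{\tau(2p-1)},a_{\tau(2p)}}\big).$$ For two $\mathbb{R}$-linear connections $\nabla^0,\nabla^1$ of $A$ on $E$ let $\widetilde\nabla^i$ be their liftings to the pullback of $E$ to $\mathbb{R}\times M$, given on the sections $c\,\partial_t+a$ ($c\in\mathbb{R}$, $a\in\Gamma(A)$) of the Lie algebroid $T\mathbb{R}\times A$ by $(\widetilde\nabla^i_{c\partial_t+a}\sigma)(t,x)=c\,\partial_t\sigma(t,x)+(\nabla^i_a\,\sigma(t,\cdot))(x)$, let $\nabla^{\mathrm{aff}}=(1-t)\widetilde\nabla^0+t\widetilde\nabla^1$, and define $\operatorname{cs}_p(\nabla^0,\nabla^1)\in\mathcal{A}lt^{2p-1}_{\mathbb{R}}(\Gamma(A);C^\infty(M))$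 by $$\operatorname{cs}_p(\nabla^0,\nabla^1)(a_1,\dots,a_{2p-1})=\int_0^1\operatorname{ch}_p(\nabla^{\mathrm{aff}})(\partial_t,a_1,\dots,a_{2p-1})_{|(t,\cdot)}\,dt.$$ For a metric $h$ on $E$, an $h$-dual of $\nabla$ is an $\mathbb{R}$-linear connection $\nabla^h$ with $$(\rho_A\circ a)(h(s,t))=h(\nabla_as,t)+h(s,\nabla^h_at)\qquad(a\in\Gamma(A),\ s,t\in\Gamma(E)),$$ and $h$ is invariant if this holds with $\nabla^h=\nabla$. **Theorem.** Let $\nabla$ be a flat $\mathbb{R}$-linear connection of $A$ on $E$ and let $p\ge1$. Then: 1. for every metric $h$ on $E$ there is exactly one $h$-dual connection $\nabla^h$, and the form $\operatorname{cs}_p(\nabla,\nabla^h)$ is closed; 2. the class $[\operatorname{cs}_p(\nabla,\nabla^h)]\in H^{2p-1}_{\rho_A,\mathbb{R}}(A)$ does not depend on the metric $h$: for any two metrics $h_1,h_2$ on $E$, $[\operatorname{cs}_p(\nabla,\nabla^{h_1})]=[\operatorname{cs}_p(\nabla,\nabla^{h_2})]$; 3. hence there is exactly one class $u_{2p-1}(A,E)\in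 H^{2p-1}_{\rho_A,\mathbb{R}}(A)$ with $u_{2p-1}(A,E)=[\operatorname{cs}_p(\nabla,\nabla^h)]$ for every metric $h$; 4. if $E$ admits a metric that is invariant with respect to $\nabla$, then this class is zero. -/

import Mathlib

open scoped Manifold ContDiff Topology Bundle
open Bundle

set_option linter.unusedSectionVars false

noncomputable section

namespace RLin

section Modules

variable {EN : Type*} [NormedAddCommGroup EN] [NormedSpace ℝ EN]
  {HN : Type*} [TopologicalSpace HN] {J : ModelWithCorners ℝ EN HN}
  {N : Type*} [TopologicalSpace N] [ChartedSpace HN N]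
  {F : Type*} [NormedAddCommGroup F] [NormedSpace ℝ F]
  {W : N → Type*} [TopologicalSpace (TotalSpace F W)]
  [∀ x, AddCommGroup (W x)] [∀ x, Module ℝ (W x)] [∀ x, TopologicalSpace (W x)]
  [FiberBundle F W] [VectorBundle ℝ F W]

/-- A smooth real function, bundled. -/
def mkFn (f : N → ℝ) (hf : ContMDiff J 𝓘(ℝ) ∞ f) : C^∞⟮J, N; ℝ⟯ := ⟨f, hf⟩

@[simp] theorem mkFn_apply (f : N → ℝ) (hf : ContMDiff J 𝓘(ℝ) ∞ f) (x : N) :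
    mkFn f hf x = f x := rfl

theorem section_sum_apply {ι : Type*} (t : Finset ι) (s : ι → Cₛ^∞⟮J; F, W⟯) (x : N) :
    (∑ i ∈ t, s i) x = ∑ i ∈ t, s i x := by
  have h := map_sum (ContMDiffSection.coeAddHom J F ∞ W) s t
  simp only [ContMDiffSection.coeAddHom_apply] at h
  rw [h, Finset.sum_apply]

/-- `C^∞(N)` acts on smooth sections by pointwise multiplication. -/
instance : SMul C^∞⟮J, N; ℝ⟯ Cₛ^∞⟮J; F, W⟯ where
  smul f s := ⟨fun x => f x • s x, f.contMDiff.smul_section s.contMDiff⟩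

@[simp] theorem fn_smul_apply (f : C^∞⟮J, N; ℝ⟯) (s : Cₛ^∞⟮J; F, W⟯) (x : N) :
    (f • s) x = f x • s x := rfl

instance : Module C^∞⟮J, N; ℝ⟯ Cₛ^∞⟮J; F, W⟯ where
  one_smul s := by ext x; exact one_smul ℝ (s x)
  mul_smul f g s := by ext x; exact mul_smul (f x) (g x) (s x)
  smul_zero f := by ext x; exact smul_zero (f x)
  smul_add f s t := by ext x; exact smul_add (f x) (s x) (t x)
  add_smul f g s := by ext x; exact add_smul (f x) (g x) (s x)
  zero_smul s := by ext x; exact zero_smul ℝ (s x)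

instance : IsScalarTower ℝ C^∞⟮J, N; ℝ⟯ Cₛ^∞⟮J; F, W⟯ where
  smul_assoc c f s := by ext x; exact smul_assoc c (f x) (s x)

instance : SMulCommClass ℝ C^∞⟮J, N; ℝ⟯ Cₛ^∞⟮J; F, W⟯ where
  smul_comm c f s := by ext x; exact smul_comm c (f x) (s x)


variable [FiniteDimensional ℝ EN] [T2Space N] [IsManifold J ∞ N]
  [FiniteDimensional ℝ F] [ContMDiffVectorBundle ∞ F W J]

/-- Near each point, sections are generated by finitely many global sections, with coefficients
that depend smoothly on the section. -/
theorem exists_cutoff_frame (x₀ : N) :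
    ∃ (χ : C^∞⟮J, N; ℝ⟯) (e : Module.Basis.ofVectorSpaceIndex ℝ F → Cₛ^∞⟮J; F, W⟯)
      (c : Module.Basis.ofVectorSpaceIndex ℝ F → ∀ x, W x →ₗ[ℝ] ℝ),
      χ =ᶠ[𝓝 x₀] 1 ∧
      (∀ i, ContMDiff (J.prod 𝓘(ℝ, F)) 𝓘(ℝ) ∞ (fun z : TotalSpace F W => c i z.proj z.2)) ∧
      ∀ x (v : W x), (χ x * χ x) • v = ∑ i, c i x v • e i x := by
  classical
  set tr := trivializationAt F W x₀ with htr
  set b := Module.Basis.ofVectorSpace ℝ F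
  obtain ⟨f, -, hf⟩ := (SmoothBumpFunction.nhds_basis_tsupport (I := J) x₀).mem_iff.1
    (tr.open_baseSet.mem_nhds (FiberBundle.mem_baseSet_trivializationAt' x₀))
  have hzero : ∀ x, x ∉ tr.baseSet → f x = 0 := fun x hx =>
    image_eq_zero_of_notMem_tsupport fun h => hx (hf h)
  refine ⟨mkFn f f.contMDiff, fun i => ⟨fun x => f x • tr.localFrame b i x, ?_⟩,
    fun i x => f x • tr.localFrameCoeff J b i x, f.eventuallyEq_one, fun i => ?_, fun x v => ?_⟩
  · exact ContMDiffOn.smul_section_of_tsupport f.contMDiff.contMDiffOn tr.open_baseSet hf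
      (tr.contMDiffOn_localFrame_baseSet ∞ _ i)
  · have hproj : ContMDiff (J.prod 𝓘(ℝ, F)) J ∞ (TotalSpace.proj : TotalSpace F W → N) :=
      contMDiff_proj W
    intro z
    by_cases hz : z.proj ∈ tr.baseSet
    · let l : F →L[ℝ] ℝ := LinearMap.toContinuousLinearMap (b.coord i)
      have h1 : ContMDiffAt (J.prod 𝓘(ℝ, F)) 𝓘(ℝ, F) ∞ (fun z : TotalSpace F W => (tr z).2) z := by
        have := (tr.contMDiffOn (IB := J) (n := ∞)).contMDiffAt
          (tr.open_source.mem_nhds (tr.mem_source.2 hz))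
        exact this.snd
      have h2 : ContMDiffAt (J.prod 𝓘(ℝ, F)) 𝓘(ℝ) ∞
          (fun z : TotalSpace F W => f z.proj • l (tr z).2) z :=
        (f.contMDiff.contMDiffAt.comp z hproj.contMDiffAt).smul
          (l.contMDiff.contMDiffAt.comp z h1)
      refine h2.congr_of_eventuallyEq ?_
      filter_upwards [hproj.continuous.continuousAt.preimage_mem_nhds
        (tr.open_baseSet.mem_nhds hz)] with w hw
      have hw' : w.proj ∈ tr.baseSet := hw
      have := tr.localFrameCoeff_eq_coeff (I := J) (b := b) (i := i)
        (s := fun y => if h : w.proj = y then h ▸ w.2 else 0) hw'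
      simp only [dite_true] at this
      simp [this, l]
    · have : ∀ᶠ y in 𝓝 z.proj, f y = 0 := by
        have h := (isClosed_tsupport f).isOpen_compl.mem_nhds (fun h => hz (hf h) : z.proj ∈ (tsupport f)ᶜ)
        filter_upwards [h] with y hy using image_eq_zero_of_notMem_tsupport hy
      refine (contMDiffAt_const (c := (0:ℝ))).congr_of_eventuallyEq ?_
      filter_upwards [hproj.continuous.continuousAt.preimage_mem_nhds this] with w hw
      have hw' : f w.proj = 0 := hw
      simp [hw']
  · by_cases hx : x ∈ tr.baseSet
    · have := tr.eq_sum_localFrameCoeff_smul (I := J) (b := b)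
        (s := fun y => if h : x = y then h ▸ v else 0) hx
      simp only [dite_true] at this
      conv_lhs => rw [this]
      simp only [Finset.smul_sum]
      refine Finset.sum_congr rfl fun i _ => ?_
      simp [smul_smul]
      ring_nf
    · simp [hzero x hx]

/-- A `C^∞(N)`-linear operator on sections acts fibrewise. -/
theorem exists_fiberMap (T : Module.End C^∞⟮J, N; ℝ⟯ Cₛ^∞⟮J; F, W⟯) (x : N) :
    ∃ L : W x →ₗ[ℝ] W x, ∀ s : Cₛ^∞⟮J; F, W⟯, (T s) x = L (s x) := by
  obtain ⟨χ, e, c, hχ, hc, hsum⟩ := exists_cutoff_frame (J := J) (F := F) (W := W) x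
  have hx : χ x = 1 := hχ.self_of_nhds
  refine ⟨∑ i, (c i x).smulRight (T (e i) x), fun s => ?_⟩
  let g : Module.Basis.ofVectorSpaceIndex ℝ F → C^∞⟮J, N; ℝ⟯ :=
    fun i => mkFn (fun y => c i y (s y)) ((hc i).comp s.contMDiff)
  have h1 : (χ * χ) • s = ∑ i, g i • e i := by
    ext y
    rw [section_sum_apply]
    exact hsum y (s y)
  have h2 := congrArg (fun u : Cₛ^∞⟮J; F, W⟯ => u x) (congrArg T h1)
  simp only [map_smul, map_sum] at h2
  rw [section_sum_apply] at h2
  simpa [hx, g] using h2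

/-- Every vector of the total space is the value of a smooth section. -/
theorem exists_section_eq (x : N) (v : W x) : ∃ s : Cₛ^∞⟮J; F, W⟯, s x = v := by
  obtain ⟨χ, e, c, hχ, hc, hsum⟩ := exists_cutoff_frame (J := J) (F := F) (W := W) x
  have hx : χ x = 1 := hχ.self_of_nhds
  refine ⟨∑ i, c i x v • e i, ?_⟩
  rw [section_sum_apply]
  simpa [hx] using (hsum x v).symm

/-- The endomorphism of the fibre `W x` induced by a `C^∞(N)`-linear operator on sections. -/
def fiberMap (T : Module.End C^∞⟮J, N; ℝ⟯ Cₛ^∞⟮J; F, W⟯) (x : N) : W x →ₗ[ℝ] W x :=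
  (exists_fiberMap T x).choose

theorem fiberMap_apply (T : Module.End C^∞⟮J, N; ℝ⟯ Cₛ^∞⟮J; F, W⟯) (x : N)
    (s : Cₛ^∞⟮J; F, W⟯) : fiberMap T x (s x) = (T s) x :=
  ((exists_fiberMap T x).choose_spec s).symm

theorem contMDiff_trace (T : Module.End C^∞⟮J, N; ℝ⟯ Cₛ^∞⟮J; F, W⟯) :
    ContMDiff J 𝓘(ℝ) ∞ (fun x => LinearMap.trace ℝ (W x) (fiberMap T x)) := by
  intro x₀
  obtain ⟨χ, e, c, hχ, hc, hsum⟩ := exists_cutoff_frame (J := J) (F := F) (W := W) x₀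
  have h1 : ContMDiffAt J 𝓘(ℝ) ∞ (fun x => ∑ i, c i x (T (e i) x)) x₀ :=
    contMDiffAt_finsetSum fun i _ => ((hc i).comp (T (e i)).contMDiff).contMDiffAt
  refine h1.congr_of_eventuallyEq ?_
  filter_upwards [hχ] with x hx
  have : FiniteDimensional ℝ (W x) := VectorBundle.finiteDimensional ℝ F W x
  have h2 : fiberMap T x = ∑ i, (c i x).smulRight (T (e i) x) := by
    ext v
    have h3 := congrArg (fiberMap T x) (hsum x v)
    simp only [map_sum, map_smul, fiberMap_apply] at h3
    simpa [hx] using h3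
  rw [h2, map_sum]
  refine Finset.sum_congr rfl fun i _ => ?_
  simp [LinearMap.trace_smulRight]

/-- The fibrewise trace `Γ(End W) → C^∞(N)`, where sections of `End W` are regarded as
`C^∞(N)`-linear operators on sections of `W`. -/
def Tr : Module.End C^∞⟮J, N; ℝ⟯ Cₛ^∞⟮J; F, W⟯ →ₗ[ℝ] C^∞⟮J, N; ℝ⟯ where
  toFun T := mkFn (fun x => LinearMap.trace ℝ (W x) (fiberMap T x)) (contMDiff_trace T)
  map_add' S T := by
    ext x
    rw [ContMDiffMap.coe_add, Pi.add_apply]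
    have : fiberMap (S + T) x = fiberMap S x + fiberMap T x := by
      ext v
      obtain ⟨s, rfl⟩ := exists_section_eq (J := J) (F := F) x v
      simp [fiberMap_apply]
    simp [this]
  map_smul' r T := by
    ext x
    rw [ContMDiffMap.coe_smul, Pi.smul_apply]
    have : fiberMap (r • T) x = r • fiberMap T x := by
      ext v
      obtain ⟨s, rfl⟩ := exists_section_eq (J := J) (F := F) x v
      simp [fiberMap_apply]
    simp [this]

end Modules

section Forms

variable {EN : Type*} [NormedAddCommGroup EN] [NormedSpace ℝ EN]
  {HN : Type*} [TopologicalSpace HN] {J : ModelWithCorners ℝ EN HN}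
  {N : Type*} [TopologicalSpace N] [ChartedSpace HN N]
  {V : Type*} [LieRing V] [LieAlgebra ℝ V]
  (ρ : V →ₗ⁅ℝ⁆ Derivation ℝ C^∞⟮J, N; ℝ⟯ C^∞⟮J, N; ℝ⟯)

/-- The part `∑ (-1)^i ρ(aᵢ)(η(a₀, …, âᵢ, …, aₙ))` of the differential. -/
def dAnchor (n : ℕ) : (V [⋀^Fin n]→ₗ[ℝ] C^∞⟮J, N; ℝ⟯) →ₗ[ℝ]
    V [⋀^Fin (n + 1)]→ₗ[ℝ] C^∞⟮J, N; ℝ⟯ :=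
  AlternatingMap.alternatizeUncurryFinLM ∘ₗ
    { toFun := fun η =>
        { toFun := fun a => (ρ a : C^∞⟮J, N; ℝ⟯ →ₗ[ℝ] C^∞⟮J, N; ℝ⟯).compAlternatingMap η
          map_add' := fun a b => by ext; simp
          map_smul' := fun r a => by ext; simp }
      map_add' := fun η θ => by ext; simp
      map_smul' := fun r η => by ext; simp }

/-- The part `∑_{i<j} (-1)^(i+j) η([aᵢ, aⱼ], a₀, …, âᵢ, …, âⱼ, …, aₙ₊₁)` of the differential,
see `dBracket_apply`. -/
def dBracket (n : ℕ) : (V [⋀^Fin (n + 1)]→ₗ[ℝ] C^∞⟮J, N; ℝ⟯) →ₗ[ℝ]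
    V [⋀^Fin (n + 2)]→ₗ[ℝ] C^∞⟮J, N; ℝ⟯ :=
  (-(1 / 2 : ℝ)) • AlternatingMap.alternatizeUncurryFinLM ∘ₗ
    { toFun := fun η => AlternatingMap.alternatizeUncurryFinLM ∘ₗ
        (LieModule.toEnd ℝ V V : V →ₗ[ℝ] V →ₗ[ℝ] V).compr₂ η.curryLeft
      map_add' := fun η θ => by ext; simp [AlternatingMap.alternatizeUncurryFin_apply,
        Finset.sum_add_distrib]
      map_smul' := fun r η => by ext; simp [AlternatingMap.alternatizeUncurryFin_apply,
        Finset.smul_sum] }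

/-- The differential `d_{A,ℝ}` on `ℝ`-multilinear alternating forms with values in `C^∞(N)`. -/
def d : (n : ℕ) → (V [⋀^Fin n]→ₗ[ℝ] C^∞⟮J, N; ℝ⟯) →ₗ[ℝ] V [⋀^Fin (n + 1)]→ₗ[ℝ] C^∞⟮J, N; ℝ⟯
  | 0 => dAnchor ρ 0
  | n + 1 => dAnchor ρ (n + 1) + dBracket n

theorem d_zero_apply (η : V [⋀^Fin 0]→ₗ[ℝ] C^∞⟮J, N; ℝ⟯) (a : Fin 1 → V) :
    d ρ 0 η a = ρ (a 0) (η ![]) := by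
  simp [d, dAnchor, AlternatingMap.alternatizeUncurryFin_apply]
  congr 2
  exact Subsingleton.elim _ _

/-- The classical formula. A pair `i ≤ j` in `Fin (n + 1)` encodes the pair of positions
`i < j + 1` of the arguments, both counted from `0`. -/
theorem d_succ_apply (n : ℕ) (η : V [⋀^Fin (n + 1)]→ₗ[ℝ] C^∞⟮J, N; ℝ⟯) (a : Fin (n + 2) → V) :
    d ρ (n + 1) η a =
      ∑ i : Fin (n + 2), (-1 : ℝ) ^ (i : ℕ) • ρ (a i) (η (i.removeNth a)) +
      ∑ i : Fin (n + 1), ∑ j ≥ i, (-1 : ℝ) ^ ((i : ℕ) + ((j : ℕ) + 1)) •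
        η (Matrix.vecCons ⁅a i.castSucc, a j.succ⁆ (j.removeNth (i.castSucc.removeNth a))) := by
  have h1 : dAnchor ρ (n + 1) η a =
      ∑ i : Fin (n + 2), (-1 : ℝ) ^ (i : ℕ) • ρ (a i) (η (i.removeNth a)) := by
    simp only [dAnchor, LinearMap.comp_apply, AlternatingMap.alternatizeUncurryFinLM_apply,
      AlternatingMap.alternatizeUncurryFin_apply]
    refine Finset.sum_congr rfl fun i _ => ?_
    rcases Nat.even_or_odd (i : ℕ) with h | h <;> simp [h.neg_one_pow]
  have h2 : dBracket n η a = ∑ i : Fin (n + 1), ∑ j ≥ i, (-1 : ℝ) ^ ((i : ℕ) + ((j : ℕ) + 1)) •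
        η (Matrix.vecCons ⁅a i.castSucc, a j.succ⁆ (j.removeNth (i.castSucc.removeNth a))) := by
    have h3 := AlternatingMap.alternatizeUncurryFin_alternatizeUncurryFinLM_comp_apply
      ((LieModule.toEnd ℝ V V : V →ₗ[ℝ] V →ₗ[ℝ] V).compr₂ η.curryLeft) a
    have h4 : dBracket n η a = (-(1 / 2 : ℝ)) • AlternatingMap.alternatizeUncurryFin
      (AlternatingMap.alternatizeUncurryFinLM ∘ₗ
        (LieModule.toEnd ℝ V V : V →ₗ[ℝ] V →ₗ[ℝ] V).compr₂ η.curryLeft) a := rfl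
    rw [h4, h3, Finset.smul_sum]
    refine Finset.sum_congr rfl fun i _ => ?_
    rw [Finset.smul_sum]
    refine Finset.sum_congr rfl fun j _ => ?_
    have h5 : ∀ x y : V, ∀ v : Fin n → V,
        (((LieModule.toEnd ℝ V V : V →ₗ[ℝ] V →ₗ[ℝ] V).compr₂ η.curryLeft) x y) v =
          η (Matrix.vecCons ⁅x, y⁆ v) := fun x y v => rfl
    have h6 : ∀ x y : V, ∀ v : Fin n → V,
        η (Matrix.vecCons ⁅y, x⁆ v) = - η (Matrix.vecCons ⁅x, y⁆ v) := fun x y v => by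
      have h : η.curryLeft ⁅y, x⁆ v = -(η.curryLeft ⁅x, y⁆ v) := by
        rw [← lie_skew x y, map_neg, AlternatingMap.neg_apply, neg_neg]
      exact h
    rw [h5, h5, h6 (a i.castSucc), ← add_assoc, pow_succ]
    set z := η (Matrix.vecCons ⁅a i.castSucc, a j.succ⁆ (j.removeNth (i.castSucc.removeNth a)))
    have h7 : z - -z = (2 : ℝ) • z := by rw [sub_neg_eq_add, two_smul]
    rw [h7]
    rcases Nat.even_or_odd ((i : ℕ) + j) with h | h <;>
      simp only [h.neg_one_pow, one_smul, neg_smul, smul_neg, smul_smul] <;> norm_num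
  rw [← h1, ← h2]
  rfl

instance (n : ℕ) (S : Submodule ℝ (V [⋀^Fin n]→ₗ[ℝ] C^∞⟮J, N; ℝ⟯)) : AddCommGroup S :=
  S.addCommGroup

/-- The exact forms of degree `n`. -/
def coboundaries : (n : ℕ) → Submodule ℝ (V [⋀^Fin n]→ₗ[ℝ] C^∞⟮J, N; ℝ⟯)
  | 0 => ⊥
  | n + 1 => LinearMap.range (d ρ n)

/-- The cohomology in degree `n` (closed forms modulo exact forms) of the complex of `ℝ`-multilinear alternating forms. -/
abbrev Cohomology (n : ℕ) : Type _ :=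
  LinearMap.ker (d ρ n) ⧸ (coboundaries ρ n).comap (LinearMap.ker (d ρ n)).subtype

/-- The cohomology class of a closed form. -/
abbrev cohomologyClass {n : ℕ} (η : V [⋀^Fin n]→ₗ[ℝ] C^∞⟮J, N; ℝ⟯) (hη : d ρ n η = 0) :
    Cohomology ρ n :=
  Submodule.Quotient.mk ⟨η, hη⟩

end Forms

section Connections

variable {EN : Type*} [NormedAddCommGroup EN] [NormedSpace ℝ EN]
  {HN : Type*} [TopologicalSpace HN] {J : ModelWithCorners ℝ EN HN}
  {N : Type*} [TopologicalSpace N] [ChartedSpace HN N]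
  {V : Type*} [LieRing V] [LieAlgebra ℝ V]
  (ρ : V →ₗ⁅ℝ⁆ Derivation ℝ C^∞⟮J, N; ℝ⟯ C^∞⟮J, N; ℝ⟯)
  (F : Type*) [NormedAddCommGroup F] [NormedSpace ℝ F]
  (W : N → Type*) [TopologicalSpace (TotalSpace F W)]
  [∀ x, AddCommGroup (W x)] [∀ x, Module ℝ (W x)] [∀ x, TopologicalSpace (W x)]
  [FiberBundle F W] [VectorBundle ℝ F W]

/-- An `ℝ`-linear connection on the vector bundle `W` over `N`: an `ℝ`-linear map `a ↦ ∇_a` to the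
covariant differential operators on `W`, the symbol of `∇_a` being `ρ a`. Here `V` is a real Lie
algebra (of sections of a Lie algebroid over `N`) acting on `C^∞(N)` through the anchor `ρ`. No
`C^∞(N)`-linearity in `a` is required. -/
structure RConnection where
  toLin : V →ₗ[ℝ] Cₛ^∞⟮J; F, W⟯ →ₗ[ℝ] Cₛ^∞⟮J; F, W⟯
  leibniz (a : V) (f : C^∞⟮J, N; ℝ⟯) (s : Cₛ^∞⟮J; F, W⟯) :
    toLin a (f • s) = f • toLin a s + ρ a f • s

namespace RConnection

variable {ρ F W}

instance : CoeFun (RConnection ρ F W) (fun _ => V → Cₛ^∞⟮J; F, W⟯ →ₗ[ℝ] Cₛ^∞⟮J; F, W⟯) where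
  coe D := D.toLin

variable (D D₀ D₁ : RConnection ρ F W)

/-- The curvature `R(a, b) = [∇_a, ∇_b] - ∇_[a, b]`, a `C^∞(N)`-linear operator on `Γ(W)`, that is,
a section of `End W`. -/
def curvature : V →ₗ[ℝ] V →ₗ[ℝ] Module.End C^∞⟮J, N; ℝ⟯ Cₛ^∞⟮J; F, W⟯ :=
  LinearMap.mk₂ ℝ
    (fun a b =>
      { toFun := fun s => D a (D b s) - D b (D a s) - D ⁅a, b⁆ s
        map_add' := fun s t => by simp only [map_add]; abel
        map_smul' := fun f s => by
          simp only [D.leibniz, map_add, LieHom.map_lie, Derivation.commutator_apply, smul_sub,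
            sub_smul, RingHom.id_apply]
          abel })
    (fun a a' b => by ext1 s; simp; abel)
    (fun r a b => by ext1 s; simp [smul_sub])
    (fun a b b' => by ext1 s; simp; abel)
    (fun r a b => by ext1 s; simp [smul_sub])

/-- The connection is flat if its curvature vanishes. -/
def IsFlat : Prop := D.curvature = 0

theorem ofFn_update {p : ℕ} [DecidableEq (Fin (2 * p))] (a : Fin (2 * p) → V) (k : Fin (2 * p))
    (x : V) :
    (List.ofFn fun i : Fin p => D.curvature (Function.update a k x ⟨2 * i, by omega⟩)
      (Function.update a k x ⟨2 * i + 1, by omega⟩)) =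
    List.ofFn (Function.update
      (fun i : Fin p => D.curvature (a ⟨2 * i, by omega⟩) (a ⟨2 * i + 1, by omega⟩))
      ⟨k / 2, by omega⟩
      (if (k : ℕ) % 2 = 0 then D.curvature x (a ⟨2 * (k / 2) + 1, by omega⟩)
        else D.curvature (a ⟨2 * (k / 2), by omega⟩) x)) := by
  congr 1
  ext1 i
  rcases eq_or_ne i ⟨k / 2, by omega⟩ with rfl | hi
  · rw [Function.update_self]
    split_ifs with hk
    · have h1 : (⟨2 * (k / 2 : ℕ), by omega⟩ : Fin (2 * p)) = k := by ext; simp; omega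
      have h2 : (⟨2 * (k / 2 : ℕ) + 1, by omega⟩ : Fin (2 * p)) ≠ k := by
        intro h; have := congrArg Fin.val h; simp at this; omega
      simp only [h1, Function.update_self, Function.update_of_ne h2]
    · have h1 : (⟨2 * (k / 2 : ℕ), by omega⟩ : Fin (2 * p)) ≠ k := by
        intro h; have := congrArg Fin.val h; simp at this; omega
      have h2 : (⟨2 * (k / 2 : ℕ) + 1, by omega⟩ : Fin (2 * p)) = k := by ext; simp; omega
      simp only [h2, Function.update_self, Function.update_of_ne h1]
  · have hi' : (i : ℕ) ≠ k / 2 := fun h => hi (Fin.ext h)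
    have h1 : (⟨2 * (i : ℕ), by omega⟩ : Fin (2 * p)) ≠ k := by
      intro h; have := congrArg Fin.val h; simp at this; omega
    have h2 : (⟨2 * (i : ℕ) + 1, by omega⟩ : Fin (2 * p)) ≠ k := by
      intro h; have := congrArg Fin.val h; simp at this; omega
    rw [Function.update_of_ne hi, Function.update_of_ne h1, Function.update_of_ne h2]

/-- `R(a₀, a₁) ∘ R(a₂, a₃) ∘ ⋯ ∘ R(a₂ₚ₋₂, a₂ₚ₋₁)`. -/
def curvatureProd (p : ℕ) :
    MultilinearMap ℝ (fun _ : Fin (2 * p) => V) (Module.End C^∞⟮J, N; ℝ⟯ Cₛ^∞⟮J; F, W⟯) where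
  toFun a := (List.ofFn fun i : Fin p =>
    D.curvature (a ⟨2 * i, by omega⟩) (a ⟨2 * i + 1, by omega⟩)).prod
  map_update_add' a k x y := by
    rw [ofFn_update D a k (x + y), ofFn_update D a k x, ofFn_update D a k y]
    have h := (MultilinearMap.mkPiAlgebraFin ℝ p
      (Module.End C^∞⟮J, N; ℝ⟯ Cₛ^∞⟮J; F, W⟯)).map_update_add
        (fun i : Fin p => D.curvature (a ⟨2 * i, by omega⟩) (a ⟨2 * i + 1, by omega⟩))
        ⟨k / 2, by omega⟩
    simp only [MultilinearMap.mkPiAlgebraFin_apply] at h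
    rw [← h]
    split_ifs <;> simp
  map_update_smul' a k r x := by
    rw [ofFn_update D a k (r • x), ofFn_update D a k x]
    have h := (MultilinearMap.mkPiAlgebraFin ℝ p
      (Module.End C^∞⟮J, N; ℝ⟯ Cₛ^∞⟮J; F, W⟯)).map_update_smul
        (fun i : Fin p => D.curvature (a ⟨2 * i, by omega⟩) (a ⟨2 * i + 1, by omega⟩))
        ⟨k / 2, by omega⟩
    simp only [MultilinearMap.mkPiAlgebraFin_apply] at h
    rw [← h]
    split_ifs <;> simp

/-- The form `R^p`, with values in `Γ(End W)`, see `curvaturePow_apply`. -/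
def curvaturePow (p : ℕ) : V [⋀^Fin (2 * p)]→ₗ[ℝ] Module.End C^∞⟮J, N; ℝ⟯ Cₛ^∞⟮J; F, W⟯ :=
  (1 / 2 ^ p : ℝ) • MultilinearMap.alternatization (D.curvatureProd p)

theorem curvaturePow_apply (p : ℕ) (a : Fin (2 * p) → V) :
    D.curvaturePow p a = (1 / 2 ^ p : ℝ) • ∑ τ : Equiv.Perm (Fin (2 * p)),
      Equiv.Perm.sign τ • (List.ofFn fun i : Fin p =>
        D.curvature (a (τ ⟨2 * i, by omega⟩)) (a (τ ⟨2 * i + 1, by omega⟩))).prod := by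
  simp [curvaturePow, MultilinearMap.alternatization_apply, curvatureProd]

/-- The affine combination `(1 - f) ∇⁰ + f ∇¹`, where `f` is a smooth function. -/
def affineComb (f : C^∞⟮J, N; ℝ⟯) : RConnection ρ F W where
  toLin := LinearMap.mk₂ ℝ (fun a s => (1 - f) • D₀ a s + f • D₁ a s)
    (fun a a' s => by simp only [map_add, LinearMap.add_apply, smul_add]; abel)
    (fun r a s => by simp only [map_smul, LinearMap.smul_apply, smul_add, smul_comm r])
    (fun a s s' => by simp only [map_add, smul_add]; abel)
    (fun r a s => by simp only [map_smul, smul_add, smul_comm r])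
  leibniz a g s := by
    have h : ρ a g • s = (1 - f) • ρ a g • s + f • ρ a g • s := by
      rw [← add_smul, sub_add_cancel, one_smul]
    simp only [LinearMap.mk₂_apply, leibniz, smul_add, smul_comm g]
    conv_rhs => rw [h]
    abel

variable [FiniteDimensional ℝ EN] [T2Space N] [IsManifold J ∞ N]
  [FiniteDimensional ℝ F] [ContMDiffVectorBundle ∞ F W J]

/-- The Chern character form `ch_p(∇) = Tr(R^p)`. -/
def ch (p : ℕ) : V [⋀^Fin (2 * p)]→ₗ[ℝ] C^∞⟮J, N; ℝ⟯ :=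
  Tr.compAlternatingMap (D.curvaturePow p)

end RConnection

end Connections

section VectorFields

variable {EN : Type*} [NormedAddCommGroup EN] [NormedSpace ℝ EN]
  {HN : Type*} [TopologicalSpace HN] {J : ModelWithCorners ℝ EN HN}
  {N : Type*} [TopologicalSpace N] [ChartedSpace HN N] [IsManifold J ∞ N]

/-- The differential of a smooth function is smooth on the tangent bundle. -/
theorem contMDiff_mfderiv_apply (f : C^∞⟮J, N; ℝ⟯) :
    ContMDiff J.tangent 𝓘(ℝ) ∞
      (fun z : TangentBundle J N => (mfderiv J 𝓘(ℝ) f z.proj z.2 : ℝ)) :=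
  (contMDiff_snd_tangentBundle_modelSpace ℝ 𝓘(ℝ) (n := ∞)).comp
    (f.contMDiff.contMDiff_tangentMap (m := ∞) le_rfl)

/-- The derivation `f ↦ X(f)` given by a smooth vector field `X`. -/
def vectorFieldDerivation (X : ∀ x : N, TangentSpace J x)
    (hX : ContMDiff J J.tangent ∞ (fun x => (⟨x, X x⟩ : TangentBundle J N))) :
    Derivation ℝ C^∞⟮J, N; ℝ⟯ C^∞⟮J, N; ℝ⟯ :=
  Derivation.mk'
    { toFun := fun f => mkFn (fun x => (mfderiv J 𝓘(ℝ) f x (X x) : ℝ))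
        ((contMDiff_mfderiv_apply f).comp hX)
      map_add' := fun f g => by
        ext x
        have hf := (f.contMDiff.mdifferentiable (by simp) x).hasMFDerivAt
        have hg := (g.contMDiff.mdifferentiable (by simp) x).hasMFDerivAt
        have h := (hf.add hg).mfderiv
        exact congrArg (fun l : TangentSpace J x →L[ℝ] ℝ => l (X x)) h
      map_smul' := fun r f => by
        ext x
        have hf := (f.contMDiff.mdifferentiable (by simp) x).hasMFDerivAt
        have h := (hf.const_smul r).mfderiv
        exact congrArg (fun l : TangentSpace J x →L[ℝ] ℝ => l (X x)) h }
    (fun f g => by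
      ext x
      have hf := (f.contMDiff.mdifferentiable (by simp) x).hasMFDerivAt
      have hg := (g.contMDiff.mdifferentiable (by simp) x).hasMFDerivAt
      have h := (hf.mul hg).mfderiv
      exact congrArg (fun l : TangentSpace J x →L[ℝ] ℝ => l (X x)) h)

@[simp] theorem vectorFieldDerivation_apply (X : ∀ x : N, TangentSpace J x)
    (hX : ContMDiff J J.tangent ∞ (fun x => (⟨x, X x⟩ : TangentBundle J N)))
    (f : C^∞⟮J, N; ℝ⟯) (x : N) :
    vectorFieldDerivation X hX f x = (mfderiv J 𝓘(ℝ) f x (X x) : ℝ) := rfl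

end VectorFields

section Algebroid

variable {EM : Type*} [NormedAddCommGroup EM] [NormedSpace ℝ EM]
  {M : Type*} [TopologicalSpace M] [ChartedSpace EM M] [IsManifold 𝓘(ℝ, EM) ∞ M]

/-- A Lie algebroid structure on the vector bundle `A` over `M`: a smooth bundle map
`A → TM` (the anchor) and a Lie bracket on `Γ(A)` satisfying the Leibniz rule. -/
structure LieAlgebroid (EM : Type*) [NormedAddCommGroup EM] [NormedSpace ℝ EM]
    {M : Type*} [TopologicalSpace M] [ChartedSpace EM M] [IsManifold 𝓘(ℝ, EM) ∞ M]
    (FA : Type*) [NormedAddCommGroup FA] [NormedSpace ℝ FA]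
    (A : M → Type*) [TopologicalSpace (TotalSpace FA A)]
    [∀ x, AddCommGroup (A x)] [∀ x, Module ℝ (A x)] [∀ x, TopologicalSpace (A x)]
    [FiberBundle FA A] [VectorBundle ℝ FA A] where
  anchor : ∀ x, A x →ₗ[ℝ] TangentSpace 𝓘(ℝ, EM) x
  contMDiff_anchor : ContMDiff (𝓘(ℝ, EM).prod 𝓘(ℝ, FA)) 𝓘(ℝ, EM).tangent ∞
    (fun z : TotalSpace FA A => (⟨z.proj, anchor z.proj z.2⟩ : TangentBundle 𝓘(ℝ, EM) M))
  bracket : Cₛ^∞⟮𝓘(ℝ, EM); FA, A⟯ →ₗ[ℝ] Cₛ^∞⟮𝓘(ℝ, EM); FA, A⟯ →ₗ[ℝ] Cₛ^∞⟮𝓘(ℝ, EM); FA, A⟯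
  bracket_self (a : Cₛ^∞⟮𝓘(ℝ, EM); FA, A⟯) : bracket a a = 0
  jacobi (a b c : Cₛ^∞⟮𝓘(ℝ, EM); FA, A⟯) :
    bracket a (bracket b c) = bracket (bracket a b) c + bracket b (bracket a c)
  leibniz (a b : Cₛ^∞⟮𝓘(ℝ, EM); FA, A⟯) (f : C^∞⟮𝓘(ℝ, EM), M; ℝ⟯) :
    bracket a (f • b) = f • bracket a b +
      vectorFieldDerivation (fun x => anchor x (a x)) (contMDiff_anchor.comp a.contMDiff) f • b

namespace LieAlgebroid

variable {FA : Type*} [NormedAddCommGroup FA] [NormedSpace ℝ FA]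
  {A : M → Type*} [TopologicalSpace (TotalSpace FA A)]
  [∀ x, AddCommGroup (A x)] [∀ x, Module ℝ (A x)] [∀ x, TopologicalSpace (A x)]
  [FiberBundle FA A] [VectorBundle ℝ FA A]

/-- The space `Γ(A)` of smooth sections, with the Lie bracket of the Lie algebroid. -/
def Sec (_𝒜 : LieAlgebroid EM FA A) : Type _ := Cₛ^∞⟮𝓘(ℝ, EM); FA, A⟯

variable (𝒜 : LieAlgebroid EM FA A)

instance : AddCommGroup 𝒜.Sec := inferInstanceAs (AddCommGroup Cₛ^∞⟮𝓘(ℝ, EM); FA, A⟯)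

instance : Module ℝ 𝒜.Sec := inferInstanceAs (Module ℝ Cₛ^∞⟮𝓘(ℝ, EM); FA, A⟯)

instance : LieRing 𝒜.Sec where
  bracket a b := 𝒜.bracket a b
  add_lie a b c := LinearMap.congr_fun (map_add 𝒜.bracket a b) c
  lie_add a b c := map_add (𝒜.bracket a) b c
  lie_self := 𝒜.bracket_self
  leibniz_lie := 𝒜.jacobi

instance : LieAlgebra ℝ 𝒜.Sec where
  lie_smul r a b := map_smul (𝒜.bracket a) r b

/-- The derivation `f ↦ (ρ_A ∘ a)(f)`. -/
def anchorDerivation (a : 𝒜.Sec) :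
    Derivation ℝ C^∞⟮𝓘(ℝ, EM), M; ℝ⟯ C^∞⟮𝓘(ℝ, EM), M; ℝ⟯ :=
  vectorFieldDerivation (fun x => 𝒜.anchor x ((show Cₛ^∞⟮𝓘(ℝ, EM); FA, A⟯ from a) x))
    (𝒜.contMDiff_anchor.comp (show Cₛ^∞⟮𝓘(ℝ, EM); FA, A⟯ from a).contMDiff)

theorem anchorDerivation_apply (a : Cₛ^∞⟮𝓘(ℝ, EM); FA, A⟯) (f : C^∞⟮𝓘(ℝ, EM), M; ℝ⟯) (x : M) :
    𝒜.anchorDerivation a f x = (mfderiv 𝓘(ℝ, EM) 𝓘(ℝ) f x (𝒜.anchor x (a x)) : ℝ) := rfl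

variable [FiniteDimensional ℝ EM] [T2Space M] [FiniteDimensional ℝ FA]
  [ContMDiffVectorBundle ∞ FA A 𝓘(ℝ, EM)]

theorem anchorDerivation_lie (a b : 𝒜.Sec) :
    𝒜.anchorDerivation ⁅a, b⁆ = ⁅𝒜.anchorDerivation a, 𝒜.anchorDerivation b⁆ := by
  have key : ∀ (f : C^∞⟮𝓘(ℝ, EM), M; ℝ⟯) (c : Cₛ^∞⟮𝓘(ℝ, EM); FA, A⟯),
      𝒜.anchorDerivation ⁅a, b⁆ f • c = ⁅𝒜.anchorDerivation a, 𝒜.anchorDerivation b⁆ f • c := by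
    intro f c
    have L : ∀ (u : 𝒜.Sec) (g : C^∞⟮𝓘(ℝ, EM), M; ℝ⟯) (v : Cₛ^∞⟮𝓘(ℝ, EM); FA, A⟯),
        𝒜.bracket u (g • v) = g • 𝒜.bracket u v + 𝒜.anchorDerivation u g • v := fun u g v =>
      𝒜.leibniz u v g
    have h := 𝒜.jacobi a b (f • c)
    simp only [L, map_add] at h
    rw [𝒜.jacobi a b c, smul_add] at h
    rw [Derivation.commutator_apply, sub_smul]
    have e : 𝒜.bracket a b = ⁅a, b⁆ := rfl
    rw [e, L ⁅a, b⁆ f c] at h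
    rw [eq_sub_iff_add_eq]
    have h' := sub_eq_zero.2 h
    rw [← sub_eq_zero, ← neg_eq_zero, ← h']
    abel
  ext f x
  by_cases hA : ∃ v : A x, v ≠ 0
  · obtain ⟨v, hv⟩ := hA
    obtain ⟨c, rfl⟩ := exists_section_eq (J := 𝓘(ℝ, EM)) (F := FA) x v
    have h := congrArg (fun s : Cₛ^∞⟮𝓘(ℝ, EM); FA, A⟯ => s x) (key f c)
    exact smul_left_injective ℝ hv h
  · push Not at hA
    have h1 : Subsingleton (A x) := ⟨fun v w => by rw [hA v, hA w]⟩
    have h2 : Subsingleton FA :=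
      ((trivializationAt FA A x).linearEquivAt ℝ x
        (FiberBundle.mem_baseSet_trivializationAt' x)).symm.injective.subsingleton
    have h3 : ∀ (y : M) (v : A y), v = 0 := fun y v =>
      ((trivializationAt FA A y).linearEquivAt ℝ y
        (FiberBundle.mem_baseSet_trivializationAt' y)).injective (Subsingleton.elim _ _)
    have h4 : ∀ u : 𝒜.Sec, u = 0 := fun u => ContMDiffSection.ext fun y => h3 y _
    have h5 : 𝒜.anchorDerivation 0 = 0 := by
      ext g y
      exact (congrArg (mfderiv 𝓘(ℝ, EM) 𝓘(ℝ) g y) (map_zero (𝒜.anchor y))).trans (map_zero _)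
    rw [h4 a, h4 b, lie_self, h5, lie_self]

/-- The anchor as a homomorphism of Lie algebras from `Γ(A)` to the derivations of `C^∞(M)`. -/
def anchorHom : 𝒜.Sec →ₗ⁅ℝ⁆ Derivation ℝ C^∞⟮𝓘(ℝ, EM), M; ℝ⟯ C^∞⟮𝓘(ℝ, EM), M; ℝ⟯ where
  toFun := 𝒜.anchorDerivation
  map_add' a b := by
    ext f x
    exact (congrArg (mfderiv 𝓘(ℝ, EM) 𝓘(ℝ) f x) (map_add (𝒜.anchor x) _ _)).trans (map_add _ _ _)
  map_smul' r a := by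
    ext f x
    exact (congrArg (mfderiv 𝓘(ℝ, EM) 𝓘(ℝ) f x) (map_smul (𝒜.anchor x) _ _)).trans
      (map_smul _ _ _)
  map_lie' := 𝒜.anchorDerivation_lie _ _

end LieAlgebroid

end Algebroid

section Line

variable {EM : Type*} [NormedAddCommGroup EM] [NormedSpace ℝ EM]
  {M : Type*} [TopologicalSpace M] [ChartedSpace EM M]

/-- The model with corners of `ℝ × M`. -/
abbrev LI (EM : Type*) [NormedAddCommGroup EM] [NormedSpace ℝ EM] :=
  𝓘(ℝ, ℝ).prod 𝓘(ℝ, EM)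

/-- The restriction of a smooth function on `ℝ × M` to `{t} × M`. -/
def sliceFn (f : C^∞⟮LI EM, ℝ × M; ℝ⟯) (t : ℝ) : C^∞⟮𝓘(ℝ, EM), M; ℝ⟯ :=
  mkFn (fun x => f (t, x)) (f.contMDiff.comp (contMDiff_const.prodMk contMDiff_id))

@[simp] theorem sliceFn_apply (f : C^∞⟮LI EM, ℝ × M; ℝ⟯) (t : ℝ) (x : M) :
    sliceFn f t x = f (t, x) := rfl

theorem mixed_partials {E : Type*} [NormedAddCommGroup E] [NormedSpace ℝ E] (g : ℝ × E → ℝ)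
    (t : ℝ) (y v : E) (hg : ContDiffAt ℝ ∞ g (t, y)) :
    deriv (fun s => fderiv ℝ (fun z => g (s, z)) y v) t =
      fderiv ℝ (fun z => deriv (fun s => g (s, z)) t) y v := by
  have h1 : ∀ᶠ p in 𝓝 (t, y), DifferentiableAt ℝ g p := by
    filter_upwards [(hg.of_le (m := 1) (by exact_mod_cast le_top)).eventually (by simp)] with p hp
    exact hp.differentiableAt (by simp)
  have h2 : DifferentiableAt ℝ (fderiv ℝ g) (t, y) :=
    (hg.fderiv_right (m := 1) (by norm_cast)).differentiableAt (by simp)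
  have hs := (hg.isSymmSndFDerivAt (by simp; norm_cast)) (1, 0) (0, v)
  have e1 : (fun s => fderiv ℝ (fun z => g (s, z)) y v) =ᶠ[𝓝 t]
      fun s => fderiv ℝ g (s, y) (0, v) := by
    have hc : Filter.Tendsto (fun s : ℝ => (s, y)) (𝓝 t) (𝓝 (t, y)) :=
      (Continuous.prodMk_left y).tendsto t
    filter_upwards [hc.eventually h1] with s hs
    have := hs.hasFDerivAt.comp y (hasFDerivAt_prodMk_right s y)
    have h3 := this.fderiv
    exact congrArg (fun l : E →L[ℝ] ℝ => l v) h3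
  have e2 : (fun z => deriv (fun s => g (s, z)) t) =ᶠ[𝓝 y] fun z => fderiv ℝ g (t, z) (1, 0) := by
    have hc : Filter.Tendsto (fun z : E => (t, z)) (𝓝 y) (𝓝 (t, y)) :=
      (Continuous.prodMk_right t).tendsto y
    filter_upwards [hc.eventually h1] with z hz
    have h4 := (hz.hasFDerivAt.comp t (hasFDerivAt_prodMk_left t z)).hasDerivAt.deriv
    simpa [Function.comp_def] using h4
  rw [e1.deriv_eq, e2.fderiv_eq]
  have h5 : HasDerivAt (fun s => fderiv ℝ g (s, y) (0, v))
      (fderiv ℝ (fderiv ℝ g) (t, y) (1, 0) (0, v)) t := by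
    have := (h2.hasFDerivAt.comp t (hasFDerivAt_prodMk_left t y)).hasDerivAt
    have h6 := this.clm_apply (hasDerivAt_const t ((0, v) : ℝ × E))
    simpa [Function.comp_def] using h6
  have h7 : fderiv ℝ (fun z => fderiv ℝ g (t, z) (1, 0)) y v =
      fderiv ℝ (fderiv ℝ g) (t, y) (0, v) (1, 0) := by
    have := h2.hasFDerivAt.comp y (hasFDerivAt_prodMk_right t y)
    have h6 := this.clm_apply (hasFDerivAt_const ((1, 0) : ℝ × E) y)
    have h8 := congrArg (fun l : E →L[ℝ] ℝ => l v) h6.fderiv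
    simpa [Function.comp_def] using h8
  rw [h5.deriv, h7, hs]

/-- The derivative of the function `f` in the direction of the tangent vector `v`. -/
def dirDeriv {H : Type*} [TopologicalSpace H] (I : ModelWithCorners ℝ EM H)
    {N : Type*} [TopologicalSpace N] [ChartedSpace H N] (f : N → ℝ) (x : N)
    (v : TangentSpace I x) : ℝ :=
  (mfderiv I 𝓘(ℝ) f x v : ℝ)

theorem dirDeriv_eq_fderiv (f : M → ℝ) (x : M) (hf : MDifferentiableAt 𝓘(ℝ, EM) 𝓘(ℝ) f x)
    (v : TangentSpace 𝓘(ℝ, EM) x) :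
    dirDeriv 𝓘(ℝ, EM) f x v =
      fderiv ℝ (fun z => f ((chartAt EM x).symm z)) (chartAt EM x x) v := by
  simp only [dirDeriv, mfderiv, hf, writtenInExtChartAt, Function.comp_def, mfld_simps]
  rw [fderivWithin_univ]
  rfl

theorem dirDeriv_line (f : C^∞⟮LI EM, ℝ × M; ℝ⟯) (t : ℝ) (x : M) (c : ℝ)
    (v : TangentSpace 𝓘(ℝ, EM) x) :
    dirDeriv (LI EM) f (t, x) (c, v) =
      c * deriv (fun s => f (s, x)) t + dirDeriv 𝓘(ℝ, EM) (sliceFn f t) x v := by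
  have hf := f.contMDiff.mdifferentiable (by simp) (t, x)
  have h := mfderiv_prod_eq_add_apply (I := 𝓘(ℝ, ℝ)) (I' := 𝓘(ℝ, EM)) (v := (c, v)) hf
  refine (h : dirDeriv (LI EM) f (t, x) (c, v) = dirDeriv 𝓘(ℝ, ℝ) (fun z => f (z, x)) t c +
    dirDeriv 𝓘(ℝ, EM) (sliceFn f t) x v).trans ?_
  congr 1
  have h1 : dirDeriv 𝓘(ℝ, ℝ) (fun z => f (z, x)) t c = fderiv ℝ (fun z => f (z, x)) t c := by
    simp only [dirDeriv, mfderiv_eq_fderiv]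
    rfl
  exact h1.trans (by rw [fderiv_eq_smul_deriv, smul_eq_mul])

variable [IsManifold 𝓘(ℝ, EM) ∞ M]

theorem deriv_dirDeriv (f : C^∞⟮LI EM, ℝ × M; ℝ⟯) (t : ℝ) (x : M)
    (df : C^∞⟮𝓘(ℝ, EM), M; ℝ⟯) (hdf : ∀ y, df y = deriv (fun s => f (s, y)) t)
    (v : TangentSpace 𝓘(ℝ, EM) x) :
    deriv (fun s => dirDeriv 𝓘(ℝ, EM) (sliceFn f s) x v) t = dirDeriv 𝓘(ℝ, EM) df x v := by
  rw [dirDeriv_eq_fderiv _ _ (df.contMDiff.mdifferentiable (by simp) x)]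
  simp only [hdf]
  have h := mixed_partials (fun p : ℝ × EM => f (p.1, (chartAt EM x).symm p.2)) t
    (chartAt EM x x) v ?_
  · refine Eq.trans ?_ h
    congr 1
    ext s
    exact dirDeriv_eq_fderiv _ _ ((sliceFn f s).contMDiff.mdifferentiable (by simp) x) v
  · have h1 : ContMDiffAt 𝓘(ℝ, EM) 𝓘(ℝ, EM) ∞ (chartAt EM x).symm (chartAt EM x x) :=
      (contMDiffOn_chart_symm (n := ∞) (I := 𝓘(ℝ, EM)) (x := x)).contMDiffAt
        ((chartAt EM x).open_target.mem_nhds (by simp))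
    have h2 : ContMDiffAt (LI EM) (LI EM) ∞
        (fun p : ℝ × EM => (p.1, (chartAt EM x).symm p.2)) (t, chartAt EM x x) :=
      contMDiffAt_fst.prodMk (h1.comp (t, chartAt EM x x) contMDiffAt_snd)
    have h3 := f.contMDiff.contMDiffAt.comp (t, chartAt EM x x) h2
    rw [← contMDiffAt_iff_contDiffAt, modelWithCornersSelf_prod, ← chartedSpaceSelf_prod]
    exact h3

variable {FA : Type*} [NormedAddCommGroup FA] [NormedSpace ℝ FA]
  {A : M → Type*} [TopologicalSpace (TotalSpace FA A)]
  [∀ x, AddCommGroup (A x)] [∀ x, Module ℝ (A x)] [∀ x, TopologicalSpace (A x)]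
  [FiberBundle FA A] [VectorBundle ℝ FA A] (𝒜 : LieAlgebroid EM FA A)

namespace LieAlgebroid

/-- The Lie algebra of the sections `c ∂/∂t + a` of the product Lie algebroid `Tℝ × A`, where `c`
is a real number and `a ∈ Γ(A)`. Since `∂/∂t` commutes with `Γ(A)`, the bracket of `c ∂/∂t + a` and
`c' ∂/∂t + b` is `[a, b]`. -/
instance : LieRing (ℝ × 𝒜.Sec) where
  bracket z w := (0, ⁅z.2, w.2⁆)
  add_lie z z' w := by ext1 <;> simp [add_lie]
  lie_add z w w' := by ext1 <;> simp [lie_add]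
  lie_self z := by ext1 <;> simp
  leibniz_lie z w u := by ext1 <;> simp

theorem line_lie (z w : ℝ × 𝒜.Sec) : ⁅z, w⁆ = (0, ⁅z.2, w.2⁆) := rfl

instance : LieAlgebra ℝ (ℝ × 𝒜.Sec) where
  lie_smul r z w := by ext1 <;> simp [line_lie]

/-- The derivation of `C^∞(ℝ × M)` given by the section `c ∂/∂t + a` of the Lie algebroid
`Tℝ × A`, that is, by the vector field `(c, ρ_A ∘ a)` on `ℝ × M`. -/
def lineDerivation (z : ℝ × 𝒜.Sec) :
    Derivation ℝ C^∞⟮LI EM, ℝ × M; ℝ⟯ C^∞⟮LI EM, ℝ × M; ℝ⟯ :=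
  vectorFieldDerivation
    (fun p => (z.1, 𝒜.anchor p.2 ((show Cₛ^∞⟮𝓘(ℝ, EM); FA, A⟯ from z.2) p.2)))
    ((contMDiff_equivTangentBundleProd_symm (I := 𝓘(ℝ, ℝ)) (M := ℝ) (I' := 𝓘(ℝ, EM)) (M' := M)).comp
      ((ContMDiff.prodMk
        (f := fun p : ℝ × M => (⟨p.1, z.1⟩ : TangentBundle 𝓘(ℝ, ℝ) ℝ))
        (g := fun p : ℝ × M => (⟨p.2, 𝒜.anchor p.2 ((show Cₛ^∞⟮𝓘(ℝ, EM); FA, A⟯ from z.2) p.2)⟩ :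
          TangentBundle 𝓘(ℝ, EM) M))
        (by
          have h : ContMDiff 𝓘(ℝ, ℝ) 𝓘(ℝ, ℝ).tangent ∞
            (fun t : ℝ => (⟨t, z.1⟩ : TangentBundle 𝓘(ℝ, ℝ) ℝ)) := by
              rw [contMDiff_vectorSpace_iff_contDiff (V := fun t : ℝ => z.1)]
              exact contDiff_const
          exact h.comp contMDiff_fst)
        ((𝒜.contMDiff_anchor.comp (show Cₛ^∞⟮𝓘(ℝ, EM); FA, A⟯ from z.2).contMDiff).comp
          contMDiff_snd))))

theorem lineDerivation_apply (c : ℝ) (a : 𝒜.Sec) (f : C^∞⟮LI EM, ℝ × M; ℝ⟯) (t : ℝ) (x : M) :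
    𝒜.lineDerivation (c, a) f (t, x) =
      c * deriv (fun s => f (s, x)) t + 𝒜.anchorDerivation a (sliceFn f t) x :=
  dirDeriv_line f t x c _

variable [FiniteDimensional ℝ EM] [T2Space M] [FiniteDimensional ℝ FA]
  [ContMDiffVectorBundle ∞ FA A 𝓘(ℝ, EM)]

theorem lineDerivation_lie (z w : ℝ × 𝒜.Sec) :
    𝒜.lineDerivation ⁅z, w⁆ = ⁅𝒜.lineDerivation z, 𝒜.lineDerivation w⁆ := by
  obtain ⟨c, a⟩ := z
  obtain ⟨c', b⟩ := w
  ext f ⟨t, x⟩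
  have hdt : ∀ p : ℝ × M, 𝒜.lineDerivation (1, 0) f p = deriv (fun s => f (s, p.2)) p.1 := by
    rintro ⟨t, x⟩
    have h : 𝒜.anchorDerivation 0 = 0 := map_zero 𝒜.anchorHom
    rw [lineDerivation_apply, h]
    simp
  set df := 𝒜.lineDerivation (1, 0) f
  clear_value df
  have hsl : ∀ (c : ℝ) (a : 𝒜.Sec) (s : ℝ), sliceFn (𝒜.lineDerivation (c, a) f) s =
      c • sliceFn df s + 𝒜.anchorDerivation a (sliceFn f s) := by
    intro c a s
    ext y
    have h1 := hdt (s, y)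
    simp only [ContMDiffMap.coe_add, ContMDiffMap.coe_smul, Pi.add_apply, Pi.smul_apply,
      sliceFn_apply, lineDerivation_apply, h1, smul_eq_mul]
  have hdiff : ∀ g : C^∞⟮LI EM, ℝ × M; ℝ⟯, DifferentiableAt ℝ (fun s => g (s, x)) t := by
    intro g
    have h : ContMDiff 𝓘(ℝ, ℝ) 𝓘(ℝ) ∞ (fun s => g (s, x)) :=
      g.contMDiff.comp (contMDiff_id.prodMk contMDiff_const)
    exact h.contDiff.differentiable (by simp) t
  have hmix : ∀ (c : ℝ) (a : 𝒜.Sec), deriv (fun s => 𝒜.lineDerivation (c, a) f (s, x)) t =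
      c * deriv (fun s => df (s, x)) t + 𝒜.anchorDerivation a (sliceFn df t) x := by
    intro c a
    have h1 : deriv (fun s => 𝒜.anchorDerivation a (sliceFn f s) x) t =
        𝒜.anchorDerivation a (sliceFn df t) x :=
      deriv_dirDeriv f t x (sliceFn df t) (fun y => hdt (t, y)) _
    have h2 : (fun s => 𝒜.anchorDerivation a (sliceFn f s) x) =
        fun s => 𝒜.lineDerivation (0, a) f (s, x) := by
      ext s
      simp [lineDerivation_apply]
    have h3 : (fun s => 𝒜.lineDerivation (c, a) f (s, x)) =
        fun s => c * df (s, x) + 𝒜.anchorDerivation a (sliceFn f s) x := by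
      ext s
      rw [lineDerivation_apply, hdt (s, x)]
    rw [h3, deriv_fun_add ((hdiff df).const_mul c) (by rw [h2]; exact hdiff _), h1,
      deriv_const_mul _ (hdiff df)]
  rw [Derivation.commutator_apply, line_lie, ContMDiffMap.coe_sub, Pi.sub_apply,
    lineDerivation_apply, lineDerivation_apply, lineDerivation_apply, hmix c' b, hmix c a,
    hsl c' b t, hsl c a t,
    anchorDerivation_lie, Derivation.commutator_apply]
  simp only [map_add, Derivation.map_smul, ContMDiffMap.coe_add, ContMDiffMap.coe_smul, ContMDiffMap.coe_sub,
    Pi.add_apply, Pi.smul_apply, Pi.sub_apply, smul_eq_mul]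
  ring

/-- The anchor of `Tℝ × A` on the sections `c ∂/∂t + a`. -/
def lineAnchorHom : (ℝ × 𝒜.Sec) →ₗ⁅ℝ⁆ Derivation ℝ C^∞⟮LI EM, ℝ × M; ℝ⟯ C^∞⟮LI EM, ℝ × M; ℝ⟯ where
  toFun := 𝒜.lineDerivation
  map_add' z w := by
    obtain ⟨c, a⟩ := z
    obtain ⟨c', b⟩ := w
    ext f ⟨t, x⟩
    have h : 𝒜.anchorDerivation (a + b) = 𝒜.anchorDerivation a + 𝒜.anchorDerivation b :=
      map_add 𝒜.anchorHom a b
    rw [Derivation.add_apply, ContMDiffMap.coe_add, Pi.add_apply, Prod.mk_add_mk,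
      lineDerivation_apply, lineDerivation_apply, lineDerivation_apply, h, Derivation.add_apply,
      ContMDiffMap.coe_add, Pi.add_apply]
    ring
  map_smul' r z := by
    obtain ⟨c, a⟩ := z
    ext f ⟨t, x⟩
    have h : 𝒜.anchorDerivation (r • a) = r • 𝒜.anchorDerivation a := map_smul 𝒜.anchorHom r a
    rw [RingHom.id_apply, Derivation.smul_apply, ContMDiffMap.coe_smul, Pi.smul_apply,
      Prod.smul_mk, lineDerivation_apply, lineDerivation_apply, h, Derivation.smul_apply,
      ContMDiffMap.coe_smul, Pi.smul_apply, smul_eq_mul, smul_eq_mul, smul_eq_mul]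
    ring
  map_lie' := 𝒜.lineDerivation_lie _ _

end LieAlgebroid
end Line

section Lift

variable {EM : Type*} [NormedAddCommGroup EM] [NormedSpace ℝ EM]
  {M : Type*} [TopologicalSpace M] [ChartedSpace EM M]
  {F : Type*} [NormedAddCommGroup F] [NormedSpace ℝ F]
  {E : M → Type*} [TopologicalSpace (TotalSpace F E)]
  [∀ x, AddCommGroup (E x)] [∀ x, Module ℝ (E x)] [∀ x, TopologicalSpace (E x)]
  [FiberBundle F E] [VectorBundle ℝ F E]

/-- The projection `ℝ × M → M`. -/
abbrev pr (EM : Type*) [NormedAddCommGroup EM] [NormedSpace ℝ EM]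
    (M : Type*) [TopologicalSpace M] [ChartedSpace EM M] :
    C^∞⟮LI EM, ℝ × M; 𝓘(ℝ, EM), M⟯ := ContMDiffMap.snd

/-- The pullback of the vector bundle `E` to `ℝ × M`. -/
abbrev PB (EM : Type*) [NormedAddCommGroup EM] [NormedSpace ℝ EM]
    {M : Type*} [TopologicalSpace M] [ChartedSpace EM M] (E : M → Type*) : ℝ × M → Type _ :=
  (pr EM M) *ᵖ E

instance (p : ℝ × M) : AddCommGroup (PB EM E p) := inferInstanceAs (AddCommGroup (E p.2))

theorem contMDiff_pb_iff (s : ∀ p : ℝ × M, E p.2) :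
    ContMDiff (LI EM) ((LI EM).prod 𝓘(ℝ, F)) ∞
      (fun p => (⟨p, s p⟩ : TotalSpace F (PB EM E))) ↔
    ContMDiff (LI EM) (𝓘(ℝ, EM).prod 𝓘(ℝ, F)) ∞
      (fun p => (⟨p.2, s p⟩ : TotalSpace F E)) := by
  constructor
  · intro h p
    have h1 := (contMDiffAt_section (F := F) (E := PB EM E) (s := s) p).1 (h p)
    exact contMDiffAt_totalSpace.2 ⟨contMDiffAt_snd, h1⟩
  · intro h p
    have h1 := (contMDiffAt_totalSpace.1 (h p)).2
    exact (contMDiffAt_section (F := F) (E := PB EM E) (s := s) p).2 h1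

/-- The value of a section of the pullback of `E` at `p`, as an element of the fibre of `E`. -/
def val (σ : Cₛ^∞⟮LI EM; F, PB EM E⟯) (p : ℝ × M) : E p.2 := σ p

theorem contMDiff_val (σ : Cₛ^∞⟮LI EM; F, PB EM E⟯) :
    ContMDiff (LI EM) (𝓘(ℝ, EM).prod 𝓘(ℝ, F)) ∞
      (fun p => (⟨p.2, val σ p⟩ : TotalSpace F E)) :=
  (contMDiff_pb_iff _).1 σ.contMDiff

/-- A section of the pullback of `E` given by its values. -/
def mkPB (s : ∀ p : ℝ × M, E p.2) (hs : ContMDiff (LI EM) (𝓘(ℝ, EM).prod 𝓘(ℝ, F)) ∞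
    (fun p => (⟨p.2, s p⟩ : TotalSpace F E))) : Cₛ^∞⟮LI EM; F, PB EM E⟯ :=
  ⟨fun p => s p, (contMDiff_pb_iff s).2 hs⟩

theorem val_ext {σ τ : Cₛ^∞⟮LI EM; F, PB EM E⟯} (h : ∀ t x, val σ (t, x) = val τ (t, x)) :
    σ = τ :=
  ContMDiffSection.ext fun p => h p.1 p.2

theorem val_mkPB (s : ∀ p : ℝ × M, E p.2) (hs : ContMDiff (LI EM) (𝓘(ℝ, EM).prod 𝓘(ℝ, F)) ∞
    (fun p => (⟨p.2, s p⟩ : TotalSpace F E))) (p : ℝ × M) : val (mkPB s hs) p = s p := rfl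

theorem val_add (σ τ : Cₛ^∞⟮LI EM; F, PB EM E⟯) (p : ℝ × M) :
    val (σ + τ) p = val σ p + val τ p := rfl

theorem val_smul (r : ℝ) (σ : Cₛ^∞⟮LI EM; F, PB EM E⟯) (p : ℝ × M) :
    val (r • σ) p = r • val σ p := rfl

theorem val_fn_smul (f : C^∞⟮LI EM, ℝ × M; ℝ⟯) (σ : Cₛ^∞⟮LI EM; F, PB EM E⟯) (p : ℝ × M) :
    val (f • σ) p = f p • val σ p := rfl

theorem val_sum {ι : Type*} (u : Finset ι) (σ : ι → Cₛ^∞⟮LI EM; F, PB EM E⟯) (p : ℝ × M) :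
    val (∑ i ∈ u, σ i) p = ∑ i ∈ u, val (σ i) p :=
  section_sum_apply u σ p

/-- The restriction of a section of the pullback of `E` to `{t} × M`, as a section of `E`. -/
def slice (σ : Cₛ^∞⟮LI EM; F, PB EM E⟯) (t : ℝ) : Cₛ^∞⟮𝓘(ℝ, EM); F, E⟯ :=
  ⟨fun x => val σ (t, x), (contMDiff_val σ).comp (contMDiff_const.prodMk contMDiff_id)⟩

theorem slice_apply (σ : Cₛ^∞⟮LI EM; F, PB EM E⟯) (t : ℝ) (x : M) :
    slice σ t x = val σ (t, x) := rfl

theorem slice_add (σ τ : Cₛ^∞⟮LI EM; F, PB EM E⟯) (t : ℝ) :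
    slice (σ + τ) t = slice σ t + slice τ t := rfl

theorem slice_smul (r : ℝ) (σ : Cₛ^∞⟮LI EM; F, PB EM E⟯) (t : ℝ) :
    slice (r • σ) t = r • slice σ t := rfl

theorem slice_fn_smul (f : C^∞⟮LI EM, ℝ × M; ℝ⟯) (σ : Cₛ^∞⟮LI EM; F, PB EM E⟯) (t : ℝ) :
    slice (f • σ) t = sliceFn f t • slice σ t := rfl

/-- The pullback of a section. -/
def pullSec (s : Cₛ^∞⟮𝓘(ℝ, EM); F, E⟯) : Cₛ^∞⟮LI EM; F, PB EM E⟯ :=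
  mkPB (fun p => s p.2) (s.contMDiff.comp contMDiff_snd)

theorem val_pullSec (s : Cₛ^∞⟮𝓘(ℝ, EM); F, E⟯) (p : ℝ × M) : val (pullSec s) p = s p.2 := rfl

variable (F E) in
/-- An identification of the fibre `E x` with the model fibre. -/
def fibreEquiv (x : M) : E x ≃L[ℝ] F :=
  (trivializationAt F E x).continuousLinearEquivAt ℝ x (FiberBundle.mem_baseSet_trivializationAt' x)

/-- The derivative in the direction of `ℝ` of a section of the pullback of `E` to `ℝ × M`: since
`σ (s, x)` lies in the fixed vector space `E x` for all `s`, this is the ordinary derivative of a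
curve in a finite dimensional vector space, which is computed in the model fibre. -/
def timeDeriv (σ : Cₛ^∞⟮LI EM; F, PB EM E⟯) (p : ℝ × M) : E p.2 :=
  (fibreEquiv F E p.2).symm (deriv (fun s : ℝ => fibreEquiv F E p.2 (val σ (s, p.2))) p.1)

theorem differentiable_fibre (σ : Cₛ^∞⟮LI EM; F, PB EM E⟯) (x : M) :
    Differentiable ℝ (fun s : ℝ => fibreEquiv F E x (val σ (s, x))) := by
  intro t
  have h1 := (contMDiff_val σ).comp
    (contMDiff_id.prodMk contMDiff_const : ContMDiff 𝓘(ℝ, ℝ) (LI EM) ∞ fun s : ℝ => (s, x))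
  have h2 := (contMDiffAt_totalSpace.1 (h1 t)).2
  exact (contMDiffAt_iff_contDiffAt.1 h2).differentiableAt (by simp)

theorem timeDeriv_add (σ τ : Cₛ^∞⟮LI EM; F, PB EM E⟯) (p : ℝ × M) :
    timeDeriv (σ + τ) p = timeDeriv σ p + timeDeriv τ p := by
  simp only [timeDeriv, val_add, map_add]
  rw [deriv_fun_add (differentiable_fibre σ p.2 _) (differentiable_fibre τ p.2 _), map_add]

theorem timeDeriv_smul (r : ℝ) (σ : Cₛ^∞⟮LI EM; F, PB EM E⟯) (p : ℝ × M) :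
    timeDeriv (r • σ) p = r • timeDeriv σ p := by
  simp only [timeDeriv, val_smul, map_smul]
  rw [deriv_fun_const_smul _ (differentiable_fibre σ p.2 _), map_smul]

theorem timeDeriv_fn_smul (f : C^∞⟮LI EM, ℝ × M; ℝ⟯) (σ : Cₛ^∞⟮LI EM; F, PB EM E⟯) (p : ℝ × M) :
    timeDeriv (f • σ) p = f p • timeDeriv σ p + deriv (fun s => f (s, p.2)) p.1 • val σ p := by
  have hf : DifferentiableAt ℝ (fun s => f (s, p.2)) p.1 := by
    have h : ContMDiff 𝓘(ℝ, ℝ) 𝓘(ℝ) ∞ (fun s => f (s, p.2)) :=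
      f.contMDiff.comp (contMDiff_id.prodMk contMDiff_const)
    exact h.contDiff.differentiable (by simp) _
  simp only [timeDeriv, val_fn_smul, map_smul]
  rw [deriv_fun_smul hf (differentiable_fibre σ p.2 _), map_add, map_smul, map_smul,
    ContinuousLinearEquiv.symm_apply_apply]

variable [FiniteDimensional ℝ F]

theorem map_timeDeriv (σ : Cₛ^∞⟮LI EM; F, PB EM E⟯) (p : ℝ × M) (l : E p.2 →ₗ[ℝ] ℝ) :
    deriv (fun s : ℝ => l (val σ (s, p.2))) p.1 = l (timeDeriv σ p) := by
  let L : F →L[ℝ] ℝ := LinearMap.toContinuousLinearMap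
    (l ∘ₗ ((fibreEquiv F E p.2).symm : F ≃L[ℝ] E p.2).toLinearEquiv.toLinearMap)
  have h := L.hasFDerivAt.comp_hasDerivAt p.1 (differentiable_fibre σ p.2 p.1).hasDerivAt
  have h2 : (L ∘ fun s : ℝ => fibreEquiv F E p.2 (val σ (s, p.2))) =
      fun s : ℝ => l (val σ (s, p.2)) := by
    ext s
    exact congrArg l ((fibreEquiv F E p.2).symm_apply_apply _)
  rw [h2] at h
  exact h.deriv

variable [IsManifold 𝓘(ℝ, EM) ∞ M] [FiniteDimensional ℝ EM] [T2Space M]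
  [ContMDiffVectorBundle ∞ F E 𝓘(ℝ, EM)]
  {FA : Type*} [NormedAddCommGroup FA] [NormedSpace ℝ FA] [FiniteDimensional ℝ FA]
  {A : M → Type*} [TopologicalSpace (TotalSpace FA A)]
  [∀ x, AddCommGroup (A x)] [∀ x, Module ℝ (A x)] [∀ x, TopologicalSpace (A x)]
  [FiberBundle FA A] [VectorBundle ℝ FA A] [ContMDiffVectorBundle ∞ FA A 𝓘(ℝ, EM)]
  {𝒜 : LieAlgebroid EM FA A}

namespace RConnection

theorem contMDiff_lift (D : RConnection 𝒜.anchorHom F E) (c : ℝ) (a : 𝒜.Sec)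
    (σ : Cₛ^∞⟮LI EM; F, PB EM E⟯) :
    ContMDiff (LI EM) (𝓘(ℝ, EM).prod 𝓘(ℝ, F)) ∞
      (fun p => (⟨p.2, c • timeDeriv σ p + D a (slice σ p.1) p.2⟩ : TotalSpace F E)) := by
  rintro ⟨t₀, x₀⟩
  obtain ⟨χ, e, k, hχ, hk, hsum⟩ := exists_cutoff_frame (J := 𝓘(ℝ, EM)) (F := F) (W := E) x₀
  let g : Module.Basis.ofVectorSpaceIndex ℝ F → C^∞⟮LI EM, ℝ × M; ℝ⟯ :=
    fun i => mkFn (fun p => k i p.2 (val σ p)) ((hk i).comp (contMDiff_val σ))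
  let τ : Cₛ^∞⟮LI EM; F, PB EM E⟯ := ∑ i, (𝒜.lineDerivation (c, a) (g i) • pullSec (e i) +
    g i • pullSec (D a (e i)))
  refine (contMDiff_val τ (t₀, x₀)).congr_of_eventuallyEq ?_
  have h1 : ∀ᶠ p : ℝ × M in 𝓝 (t₀, x₀), χ =ᶠ[𝓝 p.2] 1 :=
    (continuous_snd.tendsto (t₀, x₀)).eventually hχ.eventuallyEq_nhds
  filter_upwards [h1] with p hp
  obtain ⟨t, x⟩ := p
  have hx : χ x = 1 := hp.self_of_nhds
  refine congrArg (fun v : E x => (⟨x, v⟩ : TotalSpace F E)) ?_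
  have h2 : timeDeriv σ (t, x) = ∑ i, deriv (fun s => g i (s, x)) t • e i x := by
    have := hsum x (timeDeriv σ (t, x))
    rw [hx, one_mul, one_smul] at this
    refine this.trans (Finset.sum_congr rfl fun i _ => ?_)
    rw [← map_timeDeriv σ (t, x) (k i x)]
    rfl
  have h3 : (χ * χ) • slice σ t = ∑ i, sliceFn (g i) t • e i := by
    ext y
    rw [section_sum_apply]
    exact hsum y (val σ (t, y))
  have h4 := congrArg (fun s : Cₛ^∞⟮𝓘(ℝ, EM); F, E⟯ => s x) (congrArg (D a) h3)
  have h5 : 𝒜.anchorHom a (χ * χ) x = 0 := by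
    have h6 : ⇑(χ * χ) =ᶠ[𝓝 x] fun _ => (1 : ℝ) := by
      filter_upwards [hp] with y hy
      have : χ y = 1 := hy
      simp [this]
    have h7 := h6.mfderiv_eq (I := 𝓘(ℝ, EM)) (I' := 𝓘(ℝ))
    rw [mfderiv_const] at h7
    exact congrArg (fun l : TangentSpace 𝓘(ℝ, EM) x →L[ℝ] ℝ => l (𝒜.anchor x
      ((show Cₛ^∞⟮𝓘(ℝ, EM); FA, A⟯ from a) x))) h7
  simp only [D.leibniz, map_sum] at h4
  rw [section_sum_apply] at h4
  simp only [ContMDiffSection.coe_add, Pi.add_apply, fn_smul_apply, h5, zero_smul, add_zero,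
    ContMDiffMap.coe_mul, Pi.mul_apply, hx, one_mul, one_smul, sliceFn_apply] at h4
  change c • timeDeriv σ (t, x) + D a (slice σ t) x = val τ (t, x)
  rw [h2, h4, val_sum, Finset.smul_sum, ← Finset.sum_add_distrib]
  refine Finset.sum_congr rfl fun i _ => ?_
  rw [val_add, val_fn_smul, val_fn_smul, val_pullSec, val_pullSec,
    LieAlgebroid.lineDerivation_apply, add_smul, smul_smul, add_assoc]
  congr 1
  rw [add_comm]
  rfl

/-- The lifting of an `ℝ`-linear connection `∇` of `A` on `E` to an `ℝ`-linear connection of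
`Tℝ × A` on the pullback of `E`, on the sections `c ∂/∂t + a`:
its value on a section `σ` at `(t, x)` is `c (∂σ/∂t)(t, x) + (∇_a σ(t, ·))(x)`. -/
def lift (D : RConnection 𝒜.anchorHom F E) : RConnection 𝒜.lineAnchorHom F (PB EM E) where
  toLin := LinearMap.mk₂ ℝ
    (fun z σ => mkPB (fun p => z.1 • timeDeriv σ p + D z.2 (slice σ p.1) p.2)
      (contMDiff_lift D z.1 z.2 σ))
    (fun z w σ => val_ext fun t x => by
      simp only [val_mkPB, val_add, Prod.fst_add, Prod.snd_add, add_smul, map_add,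
        LinearMap.add_apply, ContMDiffSection.coe_add, Pi.add_apply]
      abel)
    (fun r z σ => val_ext fun t x => by
      simp only [val_mkPB, val_smul, Prod.smul_fst, Prod.smul_snd, smul_assoc, map_smul,
        LinearMap.smul_apply, ContMDiffSection.coe_smul, Pi.smul_apply, smul_add])
    (fun z σ τ => val_ext fun t x => by
      simp only [val_mkPB, val_add, timeDeriv_add, slice_add, smul_add, map_add,
        ContMDiffSection.coe_add, Pi.add_apply]
      abel)
    (fun r z σ => val_ext fun t x => by
      simp only [val_mkPB, val_smul, timeDeriv_smul, slice_smul, map_smul,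
        ContMDiffSection.coe_smul, Pi.smul_apply, smul_add, smul_comm r])
  leibniz z f σ := val_ext fun t x => by
    obtain ⟨c, a⟩ := z
    have h : 𝒜.lineAnchorHom (c, a) f (t, x) =
      c * deriv (fun s => f (s, x)) t + 𝒜.anchorHom a (sliceFn f t) x :=
      𝒜.lineDerivation_apply c a f t x
    simp only [LinearMap.mk₂_apply, val_mkPB, val_add, val_fn_smul, timeDeriv_fn_smul,
      slice_fn_smul, D.leibniz, ContMDiffSection.coe_add, Pi.add_apply, fn_smul_apply, smul_add, h,
      sliceFn_apply, slice_apply, add_smul, smul_smul, mul_comm c]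
    abel

theorem lift_apply (D : RConnection 𝒜.anchorHom F E) (c : ℝ) (a : 𝒜.Sec)
    (σ : Cₛ^∞⟮LI EM; F, PB EM E⟯) (t : ℝ) (x : M) :
    val (D.lift (c, a) σ) (t, x) = c • timeDeriv σ (t, x) + D a (slice σ t) x := rfl

end RConnection
end Lift

section Integral

variable {EM : Type*} [NormedAddCommGroup EM] [NormedSpace ℝ EM]
  {M : Type*} [TopologicalSpace M] [ChartedSpace EM M]

open MeasureTheory in
theorem contDiffOn_integral {U : Set EM} (hU : IsOpen U) (g : ℝ × EM → ℝ)
    (hg : ContDiffOn ℝ ∞ g (Set.univ ×ˢ U)) :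
    ContDiffOn ℝ ∞ (fun y => ∫ t in (0 : ℝ)..1, g (t, y)) U := by
  let β : ContDiffBump (0 : ℝ) := ⟨2, 3, by norm_num, by norm_num⟩
  have h := contDiffOn_convolution_right_with_param_comp (𝕜 := ℝ) (μ := volume) (n := ⊤)
    (ContinuousLinearMap.mul ℝ ℝ) (s := U) (v := fun _ : EM => (0 : ℝ)) contDiffOn_const
    (f := Set.indicator (Set.Ioc (0 : ℝ) 1) 1) (g := fun y u => β u * g (-u, y))
    (k := Metric.closedBall 0 3) hU (isCompact_closedBall 0 3) ?_ ?_ ?_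
  · refine h.congr fun y hy => ?_
    rw [intervalIntegral.integral_of_le zero_le_one, ← integral_indicator measurableSet_Ioc]
    refine integral_congr_ae (Filter.Eventually.of_forall fun t => ?_)
    by_cases ht : t ∈ Set.Ioc (0 : ℝ) 1
    · have : β (0 - t) = 1 := β.one_of_mem_closedBall (by
        simp only [Metric.mem_closedBall, dist_zero_right, zero_sub, norm_neg, Real.norm_eq_abs]
        rw [abs_of_pos ht.1]; exact ht.2.trans (by norm_num [β]))
      rw [zero_sub] at this
      simp [ht, this]
    · simp [ht]
  · intro y u _ hu
    have : β u = 0 := by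
      by_contra hne
      have : u ∈ Function.support β := hne
      rw [β.support_eq] at this
      exact hu (Metric.ball_subset_closedBall this)
    simp [this]
  · have : IntegrableOn (1 : ℝ → ℝ) (Set.Ioc (0:ℝ) 1) volume :=
      integrableOn_const (by simp) (by simp)
    exact (this.integrable_indicator measurableSet_Ioc).locallyIntegrable
  · have h1 : ContDiffOn ℝ ∞ (fun q : EM × ℝ => (-q.2, q.1)) (U ×ˢ Set.univ) :=
      (contDiff_snd.neg.prodMk contDiff_fst).contDiffOn
    have h2 := hg.comp h1 (fun q hq => ⟨trivial, hq.1⟩)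
    exact ((β.contDiff.comp contDiff_snd).contDiffOn).mul h2

variable [IsManifold 𝓘(ℝ, EM) ∞ M]

theorem contMDiff_integral (f : C^∞⟮LI EM, ℝ × M; ℝ⟯) :
    ContMDiff 𝓘(ℝ, EM) 𝓘(ℝ) ∞ (fun x => ∫ t in (0 : ℝ)..1, f (t, x)) := by
  intro x
  have h1 : ContMDiffOn 𝓘(ℝ, EM) 𝓘(ℝ, EM) ∞ (chartAt EM x).symm (chartAt EM x).target :=
    contMDiffOn_chart_symm
  have h2 : ContMDiffOn (LI EM) (LI EM) ∞
      (fun p : ℝ × EM => (p.1, (chartAt EM x).symm p.2)) (Set.univ ×ˢ (chartAt EM x).target) :=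
    contMDiffOn_fst.prodMk (h1.comp contMDiffOn_snd (fun p hp => hp.2))
  have h3 := f.contMDiff.comp_contMDiffOn h2
  have h4 : ContDiffOn ℝ ∞ (fun p : ℝ × EM => f (p.1, (chartAt EM x).symm p.2))
      (Set.univ ×ˢ (chartAt EM x).target) := by
    rw [← contMDiffOn_iff_contDiffOn, modelWithCornersSelf_prod, ← chartedSpaceSelf_prod]
    exact h3
  have h5 := (contDiffOn_integral (chartAt EM x).open_target _ h4).contMDiffOn
  have h6 : ContMDiffOn 𝓘(ℝ, EM) 𝓘(ℝ, EM) ∞ (chartAt EM x) (chartAt EM x).source :=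
    contMDiffOn_chart
  have h7 := (h5.comp h6 (fun y hy => (chartAt EM x).map_source hy)).congr
    (f₁ := fun x => ∫ t in (0 : ℝ)..1, f (t, x)) (fun y hy => by
      simp [(chartAt EM x).left_inv hy])
  exact h7.contMDiffAt ((chartAt EM x).open_source.mem_nhds (mem_chart_source EM x))

/-- Integration over `[0, 1] × {x}`. -/
def intLM : C^∞⟮LI EM, ℝ × M; ℝ⟯ →ₗ[ℝ] C^∞⟮𝓘(ℝ, EM), M; ℝ⟯ where
  toFun f := mkFn (fun x => ∫ t in (0 : ℝ)..1, f (t, x)) (contMDiff_integral f)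
  map_add' f g := by
    ext x
    have hc : ∀ f : C^∞⟮LI EM, ℝ × M; ℝ⟯,
        IntervalIntegrable (fun t => f (t, x)) MeasureTheory.volume 0 1 := fun f =>
      (f.contMDiff.continuous.comp (Continuous.prodMk_left x)).intervalIntegrable 0 1
    exact intervalIntegral.integral_add (hc f) (hc g)
  map_smul' r f := by
    ext x
    exact intervalIntegral.integral_smul r _

end Integral

section ChernSimons

variable {EM : Type*} [NormedAddCommGroup EM] [NormedSpace ℝ EM] [FiniteDimensional ℝ EM]
  {M : Type*} [TopologicalSpace M] [ChartedSpace EM M] [IsManifold 𝓘(ℝ, EM) ∞ M] [T2Space M]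
  {FA : Type*} [NormedAddCommGroup FA] [NormedSpace ℝ FA] [FiniteDimensional ℝ FA]
  {A : M → Type*} [TopologicalSpace (TotalSpace FA A)]
  [∀ x, AddCommGroup (A x)] [∀ x, Module ℝ (A x)] [∀ x, TopologicalSpace (A x)]
  [FiberBundle FA A] [VectorBundle ℝ FA A] [ContMDiffVectorBundle ∞ FA A 𝓘(ℝ, EM)]
  {𝒜 : LieAlgebroid EM FA A}

/-- Integration over the interval `[0, 1]` of alternating forms on `Tℝ × A`:
`(∫ η)(a₁, …, aₙ)(x) = ∫₀¹ η(∂/∂t, a₁, …, aₙ)(t, x) dt`. -/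
def fibreIntegral {n : ℕ} (η : (ℝ × 𝒜.Sec) [⋀^Fin (n + 1)]→ₗ[ℝ] C^∞⟮LI EM, ℝ × M; ℝ⟯) :
    𝒜.Sec [⋀^Fin n]→ₗ[ℝ] C^∞⟮𝓘(ℝ, EM), M; ℝ⟯ :=
  (intLM.compAlternatingMap (η.curryLeft (1, 0))).compLinearMap (LinearMap.inr ℝ ℝ 𝒜.Sec)

theorem fibreIntegral_apply {n : ℕ}
    (η : (ℝ × 𝒜.Sec) [⋀^Fin (n + 1)]→ₗ[ℝ] C^∞⟮LI EM, ℝ × M; ℝ⟯) (a : Fin n → 𝒜.Sec) (x : M) :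
    fibreIntegral η a x =
      ∫ t in (0 : ℝ)..1, η (Matrix.vecCons (1, 0) (fun i => (0, a i))) (t, x) := rfl

variable {F : Type*} [NormedAddCommGroup F] [NormedSpace ℝ F] [FiniteDimensional ℝ F]
  {E : M → Type*} [TopologicalSpace (TotalSpace F E)]
  [∀ x, AddCommGroup (E x)] [∀ x, Module ℝ (E x)] [∀ x, TopologicalSpace (E x)]
  [FiberBundle F E] [VectorBundle ℝ F E] [ContMDiffVectorBundle ∞ F E 𝓘(ℝ, EM)]

variable (EM M) in
/-- The coordinate function `(t, x) ↦ t` on `ℝ × M`. -/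
def timeFn : C^∞⟮LI EM, ℝ × M; ℝ⟯ := mkFn Prod.fst contMDiff_fst

namespace RConnection

/-- The affine combination `(1 - t) ∇⁰ + t ∇¹` of the liftings to `ℝ × M`. -/
def aff (D₀ D₁ : RConnection 𝒜.anchorHom F E) : RConnection 𝒜.lineAnchorHom F (PB EM E) :=
  affineComb D₀.lift D₁.lift (timeFn EM M)

/-- The Chern–Simons form `cs_p(∇⁰, ∇¹)`, of degree `2p - 1`, for `p ≥ 1`
(and `0` for `p = 0`, where it is not defined). -/
def chernSimons (D₀ D₁ : RConnection 𝒜.anchorHom F E) :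
    (p : ℕ) → 𝒜.Sec [⋀^Fin (2 * p - 1)]→ₗ[ℝ] C^∞⟮𝓘(ℝ, EM), M; ℝ⟯
  | 0 => 0
  | q + 1 => fibreIntegral (n := 2 * q + 1) ((aff D₀ D₁).ch (q + 1))

theorem chernSimons_succ_apply (D₀ D₁ : RConnection 𝒜.anchorHom F E) (q : ℕ)
    (a : Fin (2 * q + 1) → 𝒜.Sec) (x : M) :
    chernSimons D₀ D₁ (q + 1) a x = ∫ t in (0 : ℝ)..1, (aff D₀ D₁).ch (q + 1)
      (Matrix.vecCons (1, 0) (fun i => (0, a i)) : Fin (2 * q + 2) → ℝ × 𝒜.Sec) (t, x) := rfl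

end RConnection

section Metric

variable [∀ x, IsTopologicalAddGroup (E x)] [∀ x, ContinuousConstSMul ℝ (E x)]

/-- The smooth function `h(s, t)`. -/
def pairing (h : ContMDiffRiemannianMetric 𝓘(ℝ, EM) ∞ F E) (s t : Cₛ^∞⟮𝓘(ℝ, EM); F, E⟯) :
    C^∞⟮𝓘(ℝ, EM), M; ℝ⟯ :=
  mkFn (fun x => h.inner x (s x) (t x)) (by
    intro x
    have h1 : ContMDiffAt 𝓘(ℝ, EM) (𝓘(ℝ, EM).prod 𝓘(ℝ)) ∞ (fun m =>
        TotalSpace.mk' ℝ (E := Bundle.Trivial M ℝ) m (h.inner m (s m) (t m))) x :=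
      ContMDiffAt.clm_bundle_apply₂ (F₁ := F) (F₂ := F) h.contMDiff.contMDiffAt
        s.contMDiff.contMDiffAt t.contMDiff.contMDiffAt
    simp only [contMDiffAt_totalSpace] at h1
    exact h1.2)

namespace RConnection

/-- The connection `D'` is the `h`-dual of the connection `D`, for a metric `h` on `E`:
`(ρ_A ∘ a)(h(s, t)) = h(D_a s, t) + h(s, D'_a t)` for all `a ∈ Γ(A)` and `s, t ∈ Γ(E)`. -/
def IsDual (D : RConnection 𝒜.anchorHom F E) (h : ContMDiffRiemannianMetric 𝓘(ℝ, EM) ∞ F E)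
    (D' : RConnection 𝒜.anchorHom F E) : Prop :=
  ∀ (a : 𝒜.Sec) (s t : Cₛ^∞⟮𝓘(ℝ, EM); F, E⟯),
    𝒜.anchorHom a (pairing h s t) = pairing h (D a s) t + pairing h s (D' a t)

/-- The metric `h` is invariant with respect to `D`:
`(ρ_A ∘ a)(h(s, t)) = h(D_a s, t) + h(s, D_a t)` for all `a ∈ Γ(A)` and `s, t ∈ Γ(E)`. -/
def IsInvariant (D : RConnection 𝒜.anchorHom F E)
    (h : ContMDiffRiemannianMetric 𝓘(ℝ, EM) ∞ F E) : Prop :=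
  ∀ (a : 𝒜.Sec) (s t : Cₛ^∞⟮𝓘(ℝ, EM); F, E⟯),
    𝒜.anchorHom a (pairing h s t) = pairing h (D a s) t + pairing h s (D a t)

end RConnection

end Metric

end ChernSimons

end RLin

end

/-! Let ∇⁰, ∇¹ be flat and let θ = ∇¹ - ∇⁰, a 1-form on Γ(A) with values in Γ(End E). On ℝ × M the
affine connection has curvature dt ∧ θ + (t² - t) θ ∧ θ. Since dt ∧ dt = 0 and dt commutes with θ ∧
θ, the power q + 1 of this 2-form is (t² - t)^(q+1) θ^(2q+2) + (q + 1)(t² - t)^q dt ∧ θ^(2q+1).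
Contracting with ∂_t, taking traces and integrating, cs_{q+1}(∇⁰, ∇¹) is a real constant depending
only on q times Tr θ^(2q+1) (`twoWedgePow_succ_eq`, `ch_aff_apply`, `chernSimons_eq_smul`).
Everything reduces to the forms `diffTrace`.

Closedness: flatness gives d^{∇⁰}θ = -θ ∧ θ and d^{∇¹}θ = θ ∧ θ, so θ is closed for the mean of the
two connections (`mean_endDeriv_diff`). Since d ∘ Tr = Tr ∘ d^∇ for every connection (`anchor_Tr`),
the forms Tr θ^n are closed (`d_diffTrace`). This applies to ∇ and ∇^h because the dual of a flat
connection is flat.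

Independence of the metric: put the metric (1 - t)² h₁ + t² h₂ on the pullback of E to ℝ × M and
take the dual of the lifted connection. It is flat, so its `diffTrace` is closed on Tℝ × A, and its
restrictions to t = 0 and t = 1 are the forms for h₁ and h₂. Stokes' formula `d_fibreIntegral`,
which combines Cartan's formula for the central element ∂_t with the fundamental theorem of
calculus, shows that they differ by an exact form.

The dual connection comes from a Riesz representation for C^∞-linear functionals on sections,
obtained from Cramer's rule for Gram matrices of local frames. The class is unique because metrics
exist, by a partition of unity. An invariant metric makes ∇ its own dual, so that θ = 0.

Linearity over C^∞(M) in a ∈ Γ(A) plays no role: traces only need θ_a to be C^∞(M)-linear on Γ(E).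
-/

noncomputable section

namespace RLin

/-! ### Contraction and iterated alternation of forms. -/

section AlternatingForms

open AlternatingMap (alternatizeUncurryFin alternatizeUncurryFinLM alternatizeUncurryFin_apply
  alternatizeUncurryFin_add alternatizeUncurryFin_smul alternatizeUncurryFinLM_apply
  alternatizeUncurryFin_alternatizeUncurryFinLM_comp_of_symmetric curryLeftLinearMap
  constOfIsEmpty)

variable {V V' : Type*} [AddCommGroup V] [Module ℝ V] [AddCommGroup V'] [Module ℝ V']
  {N N' : Type*} [AddCommGroup N] [Module ℝ N] [AddCommGroup N'] [Module ℝ N'] {n : ℕ}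

/-- Contraction of alternating forms with the vector `a`. -/
def contract (a : V) : V [⋀^Fin (n + 1)]→ₗ[ℝ] N →ₗ[ℝ] V [⋀^Fin n]→ₗ[ℝ] N :=
  curryLeftLinearMap.flip a

@[simp] theorem contract_apply (a : V) (η : V [⋀^Fin (n + 1)]→ₗ[ℝ] N) (v : Fin n → V) :
    contract a η v = η (Matrix.vecCons a v) := rfl

theorem contract_alternatizeUncurryFin_zero (f : V →ₗ[ℝ] V [⋀^Fin 0]→ₗ[ℝ] N) (a : V) :
    contract a (alternatizeUncurryFin f) = f a := by
  ext v
  simp [alternatizeUncurryFin_apply]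

/-- In the alternating sum the first term feeds a to f itself; in all the others a stays in the
first slot of the form, and the index shift changes the sign. This is the source of the
antiderivation rules for contraction. -/
theorem contract_alternatizeUncurryFin (f : V →ₗ[ℝ] V [⋀^Fin (n + 1)]→ₗ[ℝ] N) (a : V) :
    contract a (alternatizeUncurryFin f) = f a - alternatizeUncurryFin (contract a ∘ₗ f) := by
  ext v
  rw [contract_apply, alternatizeUncurryFin_apply, Fin.sum_univ_succ, AlternatingMap.sub_apply,
    alternatizeUncurryFin_apply, sub_eq_add_neg, ← Finset.sum_neg_distrib]
  congr 1
  · simp [Matrix.vecCons]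
  · refine Finset.sum_congr rfl fun i _ => ?_
    have h : (i.succ.removeNth (Matrix.vecCons a v) : Fin (n + 1) → V) =
        Matrix.vecCons a (i.removeNth v) := by
      ext j
      refine Fin.cases ?_ (fun j => ?_) j
      · simp [Fin.removeNth_apply]
      · simp [Fin.removeNth_apply]
    rw [h]
    simp [pow_succ]

theorem alternatizeUncurryFin_zero :
    alternatizeUncurryFin (0 : V →ₗ[ℝ] V [⋀^Fin n]→ₗ[ℝ] N) = 0 :=
  map_zero alternatizeUncurryFinLM

/-- Double alternation kills families symmetric in the two arguments, and here f - g is symmetric.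
Hence a 2-form may be replaced by any bilinear representative with the same skew part. -/
theorem alternatizeUncurryFin_congr_skew {f g : V →ₗ[ℝ] V →ₗ[ℝ] V [⋀^Fin n]→ₗ[ℝ] N}
    (h : ∀ x y, f x y - f y x = g x y - g y x) :
    alternatizeUncurryFin (alternatizeUncurryFinLM ∘ₗ f) =
      alternatizeUncurryFin (alternatizeUncurryFinLM ∘ₗ g) := by
  have h1 := alternatizeUncurryFin_alternatizeUncurryFinLM_comp_of_symmetric (f := f - g)
    (fun x y => by
      have := h x y
      simp only [LinearMap.sub_apply]
      rw [sub_eq_sub_iff_add_eq_add] at this ⊢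
      rw [this, add_comm])
  rw [← sub_eq_zero, ← h1, LinearMap.comp_sub, sub_eq_add_neg, sub_eq_add_neg,
    alternatizeUncurryFin_add]
  congr 1
  exact (map_neg alternatizeUncurryFinLM _).symm

theorem alternatizeUncurryFin_flip (f : V →ₗ[ℝ] V →ₗ[ℝ] V [⋀^Fin n]→ₗ[ℝ] N) :
    alternatizeUncurryFin (alternatizeUncurryFinLM ∘ₗ f.flip) =
      -alternatizeUncurryFin (alternatizeUncurryFinLM ∘ₗ f) := by
  have h := alternatizeUncurryFin_congr_skew (f := f.flip) (g := -f) (fun x y => by simp; abel)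
  rw [h, LinearMap.comp_neg]
  exact map_neg alternatizeUncurryFinLM _

theorem compAlternatingMap_alternatizeUncurryFin (φ : N →ₗ[ℝ] N')
    (f : V →ₗ[ℝ] V [⋀^Fin n]→ₗ[ℝ] N) (g : V →ₗ[ℝ] V [⋀^Fin n]→ₗ[ℝ] N')
    (h : ∀ x, g x = φ.compAlternatingMap (f x)) :
    φ.compAlternatingMap (alternatizeUncurryFin f) = alternatizeUncurryFin g := by
  ext v
  simp [alternatizeUncurryFin_apply, h]

theorem compLinearMap_alternatizeUncurryFin (L : V' →ₗ[ℝ] V)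
    (f : V →ₗ[ℝ] V [⋀^Fin n]→ₗ[ℝ] N) (g : V' →ₗ[ℝ] V' [⋀^Fin n]→ₗ[ℝ] N)
    (h : ∀ x, g x = (f (L x)).compLinearMap L) :
    (alternatizeUncurryFin f).compLinearMap L = alternatizeUncurryFin g := by
  ext v
  simp only [alternatizeUncurryFin_apply, h, AlternatingMap.compLinearMap_apply]
  rfl

/-! ### Exterior products with algebra valued 1-forms. -/

section Wedge

variable {S S' : Type*} [Ring S] [Algebra ℝ S] [Ring S'] [Algebra ℝ S']
  [Module S N] [IsScalarTower ℝ S N] [SMulCommClass ℝ S N]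

instance : IsScalarTower ℝ S (V [⋀^Fin n]→ₗ[ℝ] N) :=
  ⟨fun r s η => AlternatingMap.ext fun v => smul_assoc r s (η v)⟩

/-- The exterior product of an algebra valued `1`-form with a form. -/
def oneWedge (θ : V →ₗ[ℝ] S) : V [⋀^Fin n]→ₗ[ℝ] N →ₗ[ℝ] V [⋀^Fin (n + 1)]→ₗ[ℝ] N where
  toFun η := alternatizeUncurryFin (θ.smulRight η)
  map_add' η ζ := by
    rw [← alternatizeUncurryFin_add]
    congr 1
    ext; simp
  map_smul' r η := by
    rw [RingHom.id_apply, ← alternatizeUncurryFin_smul]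
    congr 1
    ext a v
    exact (smul_comm r (θ a) (η v)).symm

theorem oneWedge_def (θ : V →ₗ[ℝ] S) (η : V [⋀^Fin n]→ₗ[ℝ] N) :
    oneWedge θ η = alternatizeUncurryFin (θ.smulRight η) := rfl

theorem contract_oneWedge_zero (θ : V →ₗ[ℝ] S) (η : V [⋀^Fin 0]→ₗ[ℝ] N) (a : V) :
    contract a (oneWedge θ η) = θ a • η :=
  contract_alternatizeUncurryFin_zero _ a

theorem contract_oneWedge (θ : V →ₗ[ℝ] S) (η : V [⋀^Fin (n + 1)]→ₗ[ℝ] N) (a : V) :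
    contract a (oneWedge θ η) = θ a • η - oneWedge θ (contract a η) := by
  rw [oneWedge_def, contract_alternatizeUncurryFin]
  rfl

/-- Both sides alternate the family θ x • g y over x and y, in opposite orders, and exchanging the
two alternations costs a sign. All sign rules for moving a 1-form past another operation follow from
this. -/
theorem alternatizeUncurryFin_oneWedge (θ : V →ₗ[ℝ] S) (g : V →ₗ[ℝ] V [⋀^Fin n]→ₗ[ℝ] N) :
    alternatizeUncurryFin (oneWedge θ ∘ₗ g) = -oneWedge θ (alternatizeUncurryFin g) := by
  let f : V →ₗ[ℝ] V →ₗ[ℝ] V [⋀^Fin n]→ₗ[ℝ] N :=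
    LinearMap.mk₂ ℝ (fun x y => θ x • g y) (fun x x' y => by rw [map_add, add_smul])
      (fun r x y => by rw [map_smul, smul_assoc]) (fun x y y' => by rw [map_add, smul_add])
      (fun r x y => by rw [map_smul, smul_comm])
  have h := alternatizeUncurryFin_flip f
  have h1 : alternatizeUncurryFinLM ∘ₗ f.flip = oneWedge θ ∘ₗ g := by
    refine LinearMap.ext fun y => ?_
    refine congrArg alternatizeUncurryFin (LinearMap.ext fun x => ?_)
    rfl
  have h2 : alternatizeUncurryFinLM ∘ₗ f = θ.smulRight (alternatizeUncurryFin g) := by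
    refine LinearMap.ext fun x => ?_
    rw [LinearMap.smulRight_apply, ← alternatizeUncurryFin_smul]
    refine congrArg alternatizeUncurryFin (LinearMap.ext fun y => ?_)
    rfl
  rw [h1, h2] at h
  exact h

/-- The powers `θ ∧ ⋯ ∧ θ` of an algebra valued `1`-form. -/
def wedgePow (θ : V →ₗ[ℝ] S) : (n : ℕ) → V [⋀^Fin n]→ₗ[ℝ] S
  | 0 => constOfIsEmpty ℝ V (Fin 0) 1
  | n + 1 => oneWedge θ (wedgePow θ n)

/-- With φ the evaluation at a point, this moves computations from sections of End E to one matrix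
algebra. -/
theorem compAlternatingMap_wedgePow (φ : S →ₐ[ℝ] S') (θ : V →ₗ[ℝ] S) (n : ℕ) :
    φ.toLinearMap.compAlternatingMap (wedgePow θ n) = wedgePow (φ.toLinearMap ∘ₗ θ) n := by
  induction n with
  | zero => ext v; simp [wedgePow]
  | succ n ih =>
    refine compAlternatingMap_alternatizeUncurryFin _ _ _ fun x => ?_
    rw [LinearMap.smulRight_apply, LinearMap.smulRight_apply, ← ih]
    ext v; simp

theorem wedgePow_compLinearMap (L : V' →ₗ[ℝ] V) (θ : V →ₗ[ℝ] S) (n : ℕ) :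
    (wedgePow θ n).compLinearMap L = wedgePow (θ ∘ₗ L) n := by
  induction n with
  | zero => ext v; simp [wedgePow]
  | succ n ih =>
    refine compLinearMap_alternatizeUncurryFin _ _ _ fun x => ?_
    rw [LinearMap.smulRight_apply, LinearMap.smulRight_apply, ← ih]
    rfl

theorem wedgePow_zero_succ (n : ℕ) : wedgePow (0 : V →ₗ[ℝ] S) (n + 1) = 0 := by
  have : (0 : V →ₗ[ℝ] S).smulRight (wedgePow (0 : V →ₗ[ℝ] S) n) = 0 := by
    ext; simp
  rw [wedgePow, oneWedge_def, this, alternatizeUncurryFin_zero]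

theorem contract_wedgePow (θ : V →ₗ[ℝ] S) {a : V} (ha : θ a = 0) (n : ℕ) :
    contract a (wedgePow θ (n + 1)) = 0 := by
  induction n with
  | zero => rw [wedgePow, contract_oneWedge_zero, ha, zero_smul]
  | succ n ih => rw [wedgePow, contract_oneWedge, ha, zero_smul, ih, map_zero, sub_zero]

end Wedge

/-! ### The Chevalley–Eilenberg differential with general coefficients. -/

section Differential

variable {V : Type*} [LieRing V] [LieAlgebra ℝ V]

/-- The form `a ↦ δ_a ∘ η`. -/
def derivForm (δ : V →ₗ[ℝ] N →ₗ[ℝ] N) (η : V [⋀^Fin n]→ₗ[ℝ] N) :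
    V →ₗ[ℝ] V [⋀^Fin n]→ₗ[ℝ] N where
  toFun a := (δ a).compAlternatingMap η
  map_add' a b := by ext; simp
  map_smul' r a := by ext; simp

/-- The family of contractions `(a, b) ↦ ι_[a, b] η`. -/
def lieContract (η : V [⋀^Fin (n + 1)]→ₗ[ℝ] N) : V →ₗ[ℝ] V →ₗ[ℝ] V [⋀^Fin n]→ₗ[ℝ] N :=
  (LieModule.toEnd ℝ V V : V →ₗ[ℝ] V →ₗ[ℝ] V).compr₂ η.curryLeft

@[simp] theorem lieContract_apply (η : V [⋀^Fin (n + 1)]→ₗ[ℝ] N) (a b : V) :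
    lieContract η a b = contract ⁅a, b⁆ η := rfl

/-- The Chevalley–Eilenberg differential of forms with values in a space `N` on which `V` acts by
the operators `δ`. -/
def covDiff (δ : V →ₗ[ℝ] N →ₗ[ℝ] N) : (n : ℕ) → V [⋀^Fin n]→ₗ[ℝ] N → V [⋀^Fin (n + 1)]→ₗ[ℝ] N
  | 0, η => alternatizeUncurryFin (derivForm δ η)
  -- The double alternation meets each pair i < j twice, with equal contributions because the
  -- bracket is skew; hence the factor 1/2.
  | _ + 1, η => alternatizeUncurryFin (derivForm δ η) + (-(1 / 2 : ℝ)) •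
      alternatizeUncurryFin (alternatizeUncurryFinLM ∘ₗ lieContract η)

theorem compAlternatingMap_covDiff (φ : N →ₗ[ℝ] N') {δ : V →ₗ[ℝ] N →ₗ[ℝ] N}
    {δ' : V →ₗ[ℝ] N' →ₗ[ℝ] N'} (h : ∀ a x, φ (δ a x) = δ' a (φ x)) (n : ℕ)
    (η : V [⋀^Fin n]→ₗ[ℝ] N) :
    φ.compAlternatingMap (covDiff δ n η) = covDiff δ' n (φ.compAlternatingMap η) := by
  have h1 : ∀ (n : ℕ) (η : V [⋀^Fin n]→ₗ[ℝ] N),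
      φ.compAlternatingMap (alternatizeUncurryFin (derivForm δ η)) =
        alternatizeUncurryFin (derivForm δ' (φ.compAlternatingMap η)) := fun n η =>
    compAlternatingMap_alternatizeUncurryFin _ _ _ fun x => by
      ext v; exact (h x _).symm
  cases n with
  | zero => exact h1 0 η
  | succ n =>
    have h2 : φ.compAlternatingMap
        (alternatizeUncurryFin (alternatizeUncurryFinLM ∘ₗ lieContract η)) =
        alternatizeUncurryFin (alternatizeUncurryFinLM ∘ₗ
          lieContract (φ.compAlternatingMap η)) := by
      refine compAlternatingMap_alternatizeUncurryFin _ _ _ fun x => ?_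
      exact (compAlternatingMap_alternatizeUncurryFin _ _ _ fun y => rfl).symm
    rw [covDiff, covDiff, ← h1, ← h2]
    ext v; simp

/-- Cartan's formula ι_z d + d ι_z = L_z: for central z the Lie derivative has no bracket terms and
acts on values only. It is used for z = ∂_t. -/
theorem contract_covDiff {δ : V →ₗ[ℝ] N →ₗ[ℝ] N} {z : V} (hz : ∀ a : V, ⁅z, a⁆ = 0)
    (n : ℕ) (η : V [⋀^Fin (n + 1)]→ₗ[ℝ] N) :
    contract z (covDiff δ (n + 1) η) =
      (δ z).compAlternatingMap η - covDiff δ n (contract z η) := by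
  have hz' : ∀ a : V, ⁅a, z⁆ = 0 := fun a => by rw [← lie_skew, hz, neg_zero]
  have h1 : contract z (alternatizeUncurryFin (derivForm δ η)) =
      (δ z).compAlternatingMap η - alternatizeUncurryFin (derivForm δ (contract z η)) :=
    contract_alternatizeUncurryFin _ z
  rw [covDiff, map_add, h1, map_smul, contract_alternatizeUncurryFin]
  have h2 : (alternatizeUncurryFinLM ∘ₗ lieContract η) z = 0 := by
    have : lieContract η z = 0 := by
      ext y v
      rw [lieContract_apply, hz, contract_apply]
      exact η.map_coord_zero 0 rfl
    rw [LinearMap.comp_apply, this, map_zero]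
  rw [h2, zero_sub]
  cases n with
  | zero =>
    have h3 : contract z ∘ₗ alternatizeUncurryFinLM ∘ₗ lieContract η = 0 := by
      ext x v
      simp only [LinearMap.comp_apply, alternatizeUncurryFinLM_apply]
      rw [contract_alternatizeUncurryFin_zero, lieContract_apply, hz', contract_apply]
      exact η.map_coord_zero 0 rfl
    rw [h3, alternatizeUncurryFin_zero, neg_zero, smul_zero, add_zero, covDiff]
  | succ n =>
    have h3 : contract z ∘ₗ alternatizeUncurryFinLM ∘ₗ lieContract η =
        alternatizeUncurryFinLM ∘ₗ lieContract (contract z η) := by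
      refine LinearMap.ext fun x => ?_
      simp only [LinearMap.comp_apply, alternatizeUncurryFinLM_apply]
      rw [contract_alternatizeUncurryFin, lieContract_apply, hz']
      have h4 : contract (0 : V) η = 0 := by
        ext w
        exact η.map_coord_zero 0 rfl
      -- Contractions with z and with [x, y] anticommute.
      have h5 : contract z ∘ₗ lieContract η x = -lieContract (contract z η) x := by
        refine LinearMap.ext fun y => AlternatingMap.ext fun v => ?_
        have h6 := η.map_swap (Matrix.vecCons z (Matrix.vecCons ⁅x, y⁆ v)) (i := 0) (j := 1)
          (by simp)
        simp only [LinearMap.neg_apply, AlternatingMap.neg_apply, LinearMap.comp_apply,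
          lieContract_apply, contract_apply]
        rw [← h6]
        congr 1
        ext i
        refine Fin.cases ?_ (fun i => Fin.cases ?_ (fun i => ?_) i) i
        · simp
        · simp
        · simp [Equiv.swap_apply_of_ne_of_ne, Fin.ext_iff]
      rw [h4, h5, zero_sub]
      exact (congrArg Neg.neg (map_neg alternatizeUncurryFinLM _)).trans (neg_neg _)
    rw [h3, covDiff]
    module

variable {S : Type*} [Ring S] [Algebra ℝ S]

/-- The rule d(θ ∧ η) = dθ ∧ η - θ ∧ dη, where `hθ` says dθ = 0. Only the derivation property of
each δ_a enters; δ need not represent the Lie algebra, and the mean connection to which this is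
applied need not be flat. -/
theorem covDiff_oneWedge {δ : V →ₗ[ℝ] S →ₗ[ℝ] S} (hδ : ∀ a s t, δ a (s * t) = δ a s * t + s * δ a t)
    {θ : V →ₗ[ℝ] S} (hθ : ∀ a b, δ a (θ b) - δ b (θ a) = θ ⁅a, b⁆) (n : ℕ)
    (η : V [⋀^Fin n]→ₗ[ℝ] S) :
    covDiff δ (n + 1) (oneWedge θ η) = -oneWedge θ (covDiff δ n η) := by
  let F : V →ₗ[ℝ] V →ₗ[ℝ] V [⋀^Fin n]→ₗ[ℝ] S :=
    LinearMap.mk₂ ℝ (fun x y => δ x (θ y) • η)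
      (fun x x' y => by rw [map_add, LinearMap.add_apply, add_smul])
      (fun r x y => by rw [map_smul, LinearMap.smul_apply, smul_assoc])
      (fun x y y' => by rw [map_add, map_add, add_smul])
      (fun r x y => by rw [map_smul, map_smul, smul_assoc])
  let G : V →ₗ[ℝ] V →ₗ[ℝ] V [⋀^Fin n]→ₗ[ℝ] S :=
    LinearMap.mk₂ ℝ (fun x y => θ ⁅x, y⁆ • η) (fun x x' y => by rw [add_lie, map_add, add_smul])
      (fun r x y => by rw [smul_lie, map_smul, smul_assoc])
      (fun x y y' => by rw [lie_add, map_add, add_smul])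
      (fun r x y => by rw [lie_smul, map_smul, smul_assoc])
  have h1 : alternatizeUncurryFin (derivForm δ (oneWedge θ η)) =
      alternatizeUncurryFin (alternatizeUncurryFinLM ∘ₗ F) -
        oneWedge θ (alternatizeUncurryFin (derivForm δ η)) := by
    rw [sub_eq_add_neg, ← alternatizeUncurryFin_oneWedge, ← alternatizeUncurryFin_add]
    congr 1
    ext1 x
    have : (δ x).compAlternatingMap (oneWedge θ η) =
        alternatizeUncurryFin (F x) + alternatizeUncurryFin (θ.smulRight (derivForm δ η x)) := by
      rw [← alternatizeUncurryFin_add]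
      refine compAlternatingMap_alternatizeUncurryFin _ _ _ fun y => ?_
      ext v
      simp [F, hδ, derivForm]
    exact this
  -- By `hθ`, F and G/2 have the same skew part θ[x, y] • η. The resulting G/2 cancels against the
  -- term -G/2 from the bracket part of the differential.
  have h2 : alternatizeUncurryFin (alternatizeUncurryFinLM ∘ₗ F) =
      (1 / 2 : ℝ) • alternatizeUncurryFin (alternatizeUncurryFinLM ∘ₗ G) := by
    rw [← alternatizeUncurryFin_smul, ← LinearMap.comp_smul]
    refine alternatizeUncurryFin_congr_skew fun x y => ?_
    have : θ ⁅y, x⁆ = -θ ⁅x, y⁆ := by rw [← lie_skew, map_neg]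
    ext v
    change δ x (θ y) * η v - δ y (θ x) * η v =
      (1 / 2 : ℝ) • (θ ⁅x, y⁆ * η v) - (1 / 2 : ℝ) • (θ ⁅y, x⁆ * η v)
    rw [← sub_mul, hθ, this, neg_mul, smul_neg, sub_neg_eq_add, ← two_smul ℝ, smul_smul]
    norm_num
  have h3 : alternatizeUncurryFin (derivForm δ (oneWedge θ η)) =
      (1 / 2 : ℝ) • alternatizeUncurryFin (alternatizeUncurryFinLM ∘ₗ G) -
        oneWedge θ (alternatizeUncurryFin (derivForm δ η)) := by rw [h1, h2]
  cases n with
  | zero =>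
    have h4 : lieContract (oneWedge θ η) = G := by
      ext x y v
      rw [lieContract_apply, contract_oneWedge_zero]
      rfl
    rw [covDiff, covDiff, h3, h4]
    module
  | succ n =>
    have h4 : alternatizeUncurryFin (alternatizeUncurryFinLM ∘ₗ lieContract (oneWedge θ η)) =
        alternatizeUncurryFin (alternatizeUncurryFinLM ∘ₗ G) -
          oneWedge θ (alternatizeUncurryFin (alternatizeUncurryFinLM ∘ₗ lieContract η)) := by
      rw [sub_eq_add_neg, ← alternatizeUncurryFin_oneWedge, ← alternatizeUncurryFin_add]
      congr 1
      ext1 x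
      have h5 : G x = lieContract (oneWedge θ η) x + oneWedge θ ∘ₗ lieContract η x := by
        refine LinearMap.ext fun y => ?_
        have := contract_oneWedge θ η ⁅x, y⁆
        exact (eq_sub_iff_add_eq.1 this).symm
      have h6 := alternatizeUncurryFin_oneWedge θ (lieContract η x)
      have h7 : alternatizeUncurryFin (G x) = alternatizeUncurryFin (lieContract (oneWedge θ η) x) -
          oneWedge θ (alternatizeUncurryFin (lieContract η x)) := by
        rw [h5, alternatizeUncurryFin_add, h6]
        exact (sub_eq_add_neg _ _).symm
      exact (sub_eq_iff_eq_add.1 h7.symm)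
    rw [covDiff, covDiff, h3, h4, map_add, map_smul]
    module

theorem covDiff_wedgePow {δ : V →ₗ[ℝ] S →ₗ[ℝ] S} (hδ : ∀ a s t, δ a (s * t) = δ a s * t + s * δ a t)
    {θ : V →ₗ[ℝ] S} (hθ : ∀ a b, δ a (θ b) - δ b (θ a) = θ ⁅a, b⁆) (n : ℕ) :
    covDiff δ n (wedgePow θ n) = 0 := by
  induction n with
  | zero =>
    have h1 : ∀ a, δ a 1 = 0 := fun a => by simpa using hδ a 1 1
    have : derivForm δ (wedgePow θ 0) = 0 := by
      ext a v
      exact h1 a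
    rw [covDiff, this, alternatizeUncurryFin_zero]
  | succ n ih => rw [wedgePow, covDiff_oneWedge hδ hθ, ih, map_zero, neg_zero]

end Differential

/-! ### Powers of the 2-form τ ∧ θ + f θ ∧ θ. -/

section TwoForms

variable {S S' : Type*} [Ring S] [Algebra ℝ S] [Ring S'] [Algebra ℝ S']

/-- Left multiplication of a form by the values of a bilinear map. -/
def bilinSMul (r : V →ₗ[ℝ] V →ₗ[ℝ] S) (η : V [⋀^Fin n]→ₗ[ℝ] S) :
    V →ₗ[ℝ] V →ₗ[ℝ] V [⋀^Fin n]→ₗ[ℝ] S :=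
  LinearMap.mk₂ ℝ (fun x y => r x y • η)
    (fun x x' y => by rw [map_add, LinearMap.add_apply, add_smul])
    (fun c x y => by rw [map_smul, LinearMap.smul_apply, smul_assoc])
    (fun x y y' => by rw [map_add, add_smul])
    (fun c x y => by rw [map_smul, smul_assoc])

@[simp] theorem bilinSMul_apply (r : V →ₗ[ℝ] V →ₗ[ℝ] S) (η : V [⋀^Fin n]→ₗ[ℝ] S) (x y : V) :
    bilinSMul r η x y = r x y • η := rfl

/-- The exterior product of the `2`-form `(r(x, y) - r(y, x)) / 2` with a form. -/
def twoWedge (r : V →ₗ[ℝ] V →ₗ[ℝ] S) (η : V [⋀^Fin n]→ₗ[ℝ] S) : V [⋀^Fin (n + 2)]→ₗ[ℝ] S :=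
  (1 / 2 : ℝ) • alternatizeUncurryFin (alternatizeUncurryFinLM ∘ₗ bilinSMul r η)

/-- The powers of an algebra valued `2`-form. -/
def twoWedgePow (r : V →ₗ[ℝ] V →ₗ[ℝ] S) : (p : ℕ) → V [⋀^Fin (2 * p)]→ₗ[ℝ] S
  | 0 => constOfIsEmpty ℝ V (Fin 0) 1
  | p + 1 => twoWedge r (twoWedgePow r p)

theorem compAlternatingMap_twoWedgePow (φ : S →ₐ[ℝ] S') (r : V →ₗ[ℝ] V →ₗ[ℝ] S) (p : ℕ) :
    φ.toLinearMap.compAlternatingMap (twoWedgePow r p) =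
      twoWedgePow (r.compr₂ φ.toLinearMap) p := by
  induction p with
  | zero => ext v; simp [twoWedgePow]
  | succ p ih =>
    rw [twoWedgePow, twoWedgePow, twoWedge, twoWedge, ← ih]
    have : ∀ {k : ℕ} (c : ℝ) (η : V [⋀^Fin k]→ₗ[ℝ] S), φ.toLinearMap.compAlternatingMap (c • η) =
        c • φ.toLinearMap.compAlternatingMap η := fun c η => by ext v; simp
    refine (this _ _).trans (congrArg _ ?_)
    refine compAlternatingMap_alternatizeUncurryFin _ _ _ fun x => ?_
    refine (compAlternatingMap_alternatizeUncurryFin _ _ _ fun y => ?_).symm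
    ext v; simp

/-- The hypothesis reads r = τ ∧ θ + f θ ∧ θ. Since r is skew, it can be replaced by the
representative τ x • θ y + f • θ x θ y, whose double alternation is visibly an iterated wedge
product. The coefficient f is a number because this is used at a fixed point (t, x), with f = t² -
t. -/
theorem twoWedge_eq {r : V →ₗ[ℝ] V →ₗ[ℝ] S} {τ : V →ₗ[ℝ] ℝ} {θ : V →ₗ[ℝ] S} {f : ℝ}
    (hr : ∀ x y, r x y = τ x • θ y - τ y • θ x + f • (θ x * θ y - θ y * θ x))
    (η : V [⋀^Fin n]→ₗ[ℝ] S) :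
    twoWedge r η = oneWedge τ (oneWedge θ η) + f • oneWedge θ (oneWedge θ η) := by
  let G : V →ₗ[ℝ] V →ₗ[ℝ] V [⋀^Fin n]→ₗ[ℝ] S :=
    bilinSMul (LinearMap.mk₂ ℝ (fun x y => τ x • θ y + f • (θ x * θ y))
      (fun x x' y => by simp only [map_add, add_mul, add_smul, smul_add]; abel)
      (fun c x y => by simp only [map_smul, smul_add, smul_assoc, smul_mul_assoc, smul_comm c])
      (fun x y y' => by simp only [map_add, mul_add, smul_add]; abel)
      (fun c x y => by simp only [map_smul, smul_add, mul_smul_comm, smul_comm c])) η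
  have h1 : oneWedge τ (oneWedge θ η) + f • oneWedge θ (oneWedge θ η) =
      alternatizeUncurryFin (alternatizeUncurryFinLM ∘ₗ G) := by
    simp only [oneWedge_def]
    rw [← alternatizeUncurryFin_smul, ← alternatizeUncurryFin_add]
    congr 1
    refine LinearMap.ext fun x => ?_
    rw [LinearMap.add_apply, LinearMap.smul_apply, LinearMap.smulRight_apply,
      LinearMap.smulRight_apply, ← alternatizeUncurryFin_smul, ← alternatizeUncurryFin_smul,
      ← alternatizeUncurryFin_smul, ← alternatizeUncurryFin_add]
    refine congrArg alternatizeUncurryFin (LinearMap.ext fun y => ?_)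
    ext v
    simp [G, add_mul, mul_assoc]
  rw [h1, twoWedge, ← alternatizeUncurryFin_smul, ← LinearMap.comp_smul]
  refine alternatizeUncurryFin_congr_skew fun x y => ?_
  ext v
  change (1 / 2 : ℝ) • (r x y * η v) - (1 / 2 : ℝ) • (r y x * η v) =
    (τ x • θ y + f • (θ x * θ y)) * η v - (τ y • θ x + f • (θ y * θ x)) * η v
  rw [← smul_sub, ← sub_mul, ← sub_mul, ← smul_mul_assoc, hr, hr]
  congr 1
  module

/-- Values of τ are central scalars, so exchanging the two factors shows that the product equals its
own negative. -/
theorem oneWedge_oneWedge_self (τ : V →ₗ[ℝ] ℝ) (η : V [⋀^Fin n]→ₗ[ℝ] S) :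
    oneWedge τ (oneWedge τ η) = 0 := by
  have h : oneWedge τ (oneWedge τ η) = -oneWedge τ (oneWedge τ η) := by
    conv_rhs => rw [oneWedge_def τ η, ← alternatizeUncurryFin_oneWedge]
    conv_lhs => rw [oneWedge_def]
    congr 1
    ext1 y
    exact (map_smul (oneWedge τ) (τ y) η).symm
  have h2 : (2 : ℝ) • oneWedge τ (oneWedge τ η) = 0 := by
    rw [two_smul]
    exact eq_neg_iff_add_eq_zero.1 h
  exact (smul_eq_zero_iff_right two_ne_zero).1 h2

theorem oneWedge_comm (τ : V →ₗ[ℝ] ℝ) (θ : V →ₗ[ℝ] S) (η : V [⋀^Fin n]→ₗ[ℝ] S) :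
    oneWedge θ (oneWedge τ η) = -oneWedge τ (oneWedge θ η) := by
  conv_rhs => rw [oneWedge_def θ η, ← alternatizeUncurryFin_oneWedge]
  conv_lhs => rw [oneWedge_def]
  congr 1
  ext1 y
  simp only [LinearMap.smulRight_apply, LinearMap.comp_apply, oneWedge_def]
  rw [← alternatizeUncurryFin_smul]
  congr 1
  ext x v
  simp

/-- The binomial formula: τ ∧ τ = 0 leaves at most one factor τ, and τ passes θ ∧ θ without a sign,
so the p + 1 places where τ may occur contribute equally. -/
theorem twoWedgePow_succ_eq {r : V →ₗ[ℝ] V →ₗ[ℝ] S} {τ : V →ₗ[ℝ] ℝ} {θ : V →ₗ[ℝ] S} {f : ℝ}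
    (hr : ∀ x y, r x y = τ x • θ y - τ y • θ x + f • (θ x * θ y - θ y * θ x)) (p : ℕ) :
    twoWedgePow r (p + 1) = f ^ (p + 1) • wedgePow θ (2 * p + 2) +
      ((p + 1) * f ^ p) • oneWedge τ (wedgePow θ (2 * p + 1)) := by
  induction p with
  | zero =>
    refine (twoWedge_eq hr _).trans ?_
    simp only [CharP.cast_eq_zero, zero_add, pow_one, pow_zero, mul_one, one_smul]
    exact add_comm _ _
  | succ p ih =>
    rw [twoWedgePow, ih]
    refine (twoWedge_eq hr _).trans ?_
    have e1 : wedgePow θ (2 * (p + 1) + 2) = oneWedge θ (oneWedge θ (wedgePow θ (2 * p + 2))) := rfl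
    have e2 : wedgePow θ (2 * (p + 1) + 1) = oneWedge θ (wedgePow θ (2 * p + 2)) := rfl
    have e3 : wedgePow θ (2 * p + 2) = oneWedge θ (wedgePow θ (2 * p + 1)) := rfl
    rw [e1, e2]
    simp only [map_add, map_smul]
    rw [oneWedge_comm, map_neg, map_neg, oneWedge_oneWedge_self, oneWedge_comm, neg_neg, ← e3]
    push_cast
    simp only [smul_add, smul_smul, pow_succ, neg_zero, smul_zero, add_zero]
    module

/-- Here z is ∂_t and τ is dt; the difference of two lifted connections vanishes on ∂_t, so only the
summand containing τ survives. -/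
theorem contract_twoWedgePow {r : V →ₗ[ℝ] V →ₗ[ℝ] S} {τ : V →ₗ[ℝ] ℝ} {θ : V →ₗ[ℝ] S} {f : ℝ}
    (hr : ∀ x y, r x y = τ x • θ y - τ y • θ x + f • (θ x * θ y - θ y * θ x)) {z : V}
    (hτ : τ z = 1) (hθ : θ z = 0) (p : ℕ) :
    contract (n := 2 * p + 1) z (twoWedgePow r (p + 1)) =
      ((p + 1) * f ^ p) • wedgePow θ (2 * p + 1) := by
  rw [twoWedgePow_succ_eq hr, map_add, map_smul, map_smul, contract_wedgePow θ hθ,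
    contract_oneWedge, contract_wedgePow θ hθ, hτ, map_zero]
  simp

end TwoForms

/-! ### Full alternation as iterated alternation in the first argument. -/

section Alternatization

/-- The alternatization of multilinear maps, as a linear map. -/
def alternatizationLM :
    MultilinearMap ℝ (fun _ : Fin n => V) N →ₗ[ℝ] V [⋀^Fin n]→ₗ[ℝ] N where
  toFun := MultilinearMap.alternatization
  map_add' := map_add _
  map_smul' r m := by
    ext v
    simp [MultilinearMap.alternatization_apply, Finset.smul_sum, smul_comm r]

/-- A permutation is given by the image i of 0 and a permutation e of the remaining n places:
`decomposeFin.symm (0, e)` fixes 0, and the inverse of `i.cycleRange` sends 0 to i and keeps the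
order of the rest. The pair is recovered by evaluating at 0, and the cardinalities agree. -/
theorem sum_perm_succ {X : Type*} [AddCommMonoid X] (g : Equiv.Perm (Fin (n + 1)) → X) :
    ∑ τ, g τ = ∑ i : Fin (n + 1), ∑ e : Equiv.Perm (Fin n),
      g (i.cycleRange.symm * Equiv.Perm.decomposeFin.symm (0, e)) := by
  refine Eq.trans ?_ (Fintype.sum_prod_type' (fun (i : Fin (n + 1)) (e : Equiv.Perm (Fin n)) =>
    g (i.cycleRange.symm * Equiv.Perm.decomposeFin.symm (0, e))))
  symm
  refine Function.Bijective.sum_comp (e := fun q : Fin (n + 1) × Equiv.Perm (Fin n) =>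
    q.1.cycleRange.symm * Equiv.Perm.decomposeFin.symm (0, q.2)) ?_ g
  rw [Fintype.bijective_iff_injective_and_card]
  refine ⟨?_, by simp [Fintype.card_perm, Nat.factorial_succ]⟩
  rintro ⟨i, e⟩ ⟨j, e'⟩ h
  have h0 : i = j := by
    have := congrArg (fun σ : Equiv.Perm (Fin (n + 1)) => σ 0) h
    simpa using this
  subst h0
  have := mul_left_cancel h
  have := Equiv.Perm.decomposeFin.symm.injective this
  simp_all

/-- The sum over permutations is split by the argument placed first, the cycle bringing it there
having sign (-1)^i. Two applications relate the sum over S_{2p} in the Chern form to wedge products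
of 2-forms. -/
theorem alternatization_succ (m : MultilinearMap ℝ (fun _ : Fin (n + 1) => V) N) :
    MultilinearMap.alternatization m =
      alternatizeUncurryFin (alternatizationLM ∘ₗ m.curryLeft) := by
  ext v
  rw [MultilinearMap.alternatization_apply, sum_perm_succ, alternatizeUncurryFin_apply]
  refine Finset.sum_congr rfl fun i _ => ?_
  have h : (alternatizationLM ∘ₗ m.curryLeft) (v i) (i.removeNth v) =
      MultilinearMap.alternatization (m.curryLeft (v i)) (i.removeNth v) := rfl
  rw [h, MultilinearMap.alternatization_apply, Finset.smul_sum]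
  refine Finset.sum_congr rfl fun e _ => ?_
  rw [MultilinearMap.domDomCongr_apply, MultilinearMap.domDomCongr_apply,
    MultilinearMap.curryLeft_apply]
  have h1 : (fun k => v ((i.cycleRange.symm * Equiv.Perm.decomposeFin.symm (0, e)) k)) =
      Fin.cons (v i) (fun k => i.removeNth v (e k)) := by
    ext k
    refine Fin.cases ?_ (fun k => ?_) k
    · simp
    · simp [Fin.removeNth_apply]
  have h2 : Equiv.Perm.sign (i.cycleRange.symm * Equiv.Perm.decomposeFin.symm (0, e)) =
      (-1) ^ (i : ℕ) * Equiv.Perm.sign e := by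
    simp [Fin.sign_cycleRange]
  rw [h1, h2]
  simp [Units.smul_def, mul_smul]

end Alternatization

end AlternatingForms

/-! ### Fibrewise action, local frames and dual pairings. -/

section Frames

variable {EN : Type*} [NormedAddCommGroup EN] [NormedSpace ℝ EN]
  {HN : Type*} [TopologicalSpace HN] {J : ModelWithCorners ℝ EN HN}
  {N : Type*} [TopologicalSpace N] [ChartedSpace HN N]
  {F : Type*} [NormedAddCommGroup F] [NormedSpace ℝ F]
  {W : N → Type*} [TopologicalSpace (TotalSpace F W)]
  [∀ x, AddCommGroup (W x)] [∀ x, Module ℝ (W x)] [∀ x, TopologicalSpace (W x)]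
  [FiberBundle F W] [VectorBundle ℝ F W]
  [FiniteDimensional ℝ EN] [T2Space N] [IsManifold J ∞ N]
  [FiniteDimensional ℝ F] [ContMDiffVectorBundle ∞ F W J]

theorem fiberMap_eq (T : Module.End C^∞⟮J, N; ℝ⟯ Cₛ^∞⟮J; F, W⟯) {x : N} {L : W x →ₗ[ℝ] W x}
    (h : ∀ s : Cₛ^∞⟮J; F, W⟯, T s x = L (s x)) : fiberMap T x = L := by
  ext v
  obtain ⟨s, rfl⟩ := exists_section_eq (J := J) (F := F) x v
  rw [fiberMap_apply, h]

/-- The action on the fibre at `x`, as a homomorphism of algebras. -/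
def fiberHom (x : N) : Module.End C^∞⟮J, N; ℝ⟯ Cₛ^∞⟮J; F, W⟯ →ₐ[ℝ] Module.End ℝ (W x) :=
  AlgHom.ofLinearMap
    { toFun := fun T => fiberMap T x
      map_add' := fun S T => fiberMap_eq _ fun s => by
        simp [fiberMap_apply]
      map_smul' := fun r T => fiberMap_eq _ fun s => by
        simp [fiberMap_apply] }
    (fiberMap_eq _ fun s => rfl)
    (fun S T => fiberMap_eq _ fun s => by
      simp [fiberMap_apply])

theorem fiberHom_apply (T : Module.End C^∞⟮J, N; ℝ⟯ Cₛ^∞⟮J; F, W⟯) (x : N)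
    (s : Cₛ^∞⟮J; F, W⟯) : fiberHom x T (s x) = T s x := fiberMap_apply T x s

theorem fiberHom_eq (T : Module.End C^∞⟮J, N; ℝ⟯ Cₛ^∞⟮J; F, W⟯) {x : N} {L : W x →ₗ[ℝ] W x}
    (h : ∀ s : Cₛ^∞⟮J; F, W⟯, T s x = L (s x)) : fiberHom x T = L := fiberMap_eq T h

theorem fn_sum_apply {ι : Type*} (t : Finset ι) (f : ι → C^∞⟮J, N; ℝ⟯) (x : N) :
    (∑ i ∈ t, f i) x = ∑ i ∈ t, f i x := by
  have h := map_sum (ContMDiffMap.coeFnLinearMap (I := J) (N := N) (n := ∞) (V := ℝ)) f t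
  have h2 := congrFun h x
  simpa using h2

/-- A `C^∞(N)`-linear functional on sections acts fibrewise. -/
theorem functional_congr (f : Cₛ^∞⟮J; F, W⟯ →ₗ[C^∞⟮J, N; ℝ⟯] C^∞⟮J, N; ℝ⟯) {x : N}
    {s t : Cₛ^∞⟮J; F, W⟯} (h : s x = t x) : f s x = f t x := by
  obtain ⟨χ, e, c, hχ, hc, hsum⟩ := exists_cutoff_frame (J := J) (F := F) (W := W) x
  have hx : χ x = 1 := hχ.self_of_nhds
  have h0 : ∀ s : Cₛ^∞⟮J; F, W⟯, f s x = ∑ i, c i x (s x) * f (e i) x := fun s => by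
    have h1 : (χ * χ) • s = ∑ i, mkFn (fun y => c i y (s y)) ((hc i).comp s.contMDiff) • e i := by
      ext y
      rw [section_sum_apply]
      exact hsum y (s y)
    have h2 := congrArg (fun u : C^∞⟮J, N; ℝ⟯ => u x) (congrArg f h1)
    simp only [map_smul, map_sum] at h2
    rw [fn_sum_apply] at h2
    simpa [hx] using h2
  rw [h0, h0, h]

/-- Near each point, sections are generated by a finite frame of global sections, and traces are
computed with the dual frame. -/
theorem exists_dual_frame (x₀ : N) :
    ∃ (P : C^∞⟮J, N; ℝ⟯) (e : Module.Basis.ofVectorSpaceIndex ℝ F → Cₛ^∞⟮J; F, W⟯)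
      (φ : Module.Basis.ofVectorSpaceIndex ℝ F → Cₛ^∞⟮J; F, W⟯ →ₗ[C^∞⟮J, N; ℝ⟯] C^∞⟮J, N; ℝ⟯),
      P =ᶠ[𝓝 x₀] 1 ∧ (∀ s, P • s = ∑ i, φ i s • e i) ∧ ∀ T, P * Tr T = ∑ i, φ i (T (e i)) := by
  obtain ⟨χ, e, c, hχ, hc, hsum⟩ := exists_cutoff_frame (J := J) (F := F) (W := W) x₀
  refine ⟨χ * χ, e, fun i =>
    { toFun := fun s => mkFn (fun y => c i y (s y)) ((hc i).comp s.contMDiff)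
      map_add' := fun s t => by ext y; exact map_add (c i y) _ _
      map_smul' := fun f s => by ext y; exact map_smul (c i y) _ _ }, ?_, fun s => ?_, fun T => ?_⟩
  · filter_upwards [hχ] with x hx
    have : χ x = 1 := hx
    simp [this]
  · ext y
    rw [section_sum_apply]
    exact hsum y (s y)
  · ext y
    rw [fn_sum_apply]
    have : FiniteDimensional ℝ (W y) := VectorBundle.finiteDimensional ℝ F W y
    -- T is applied to the frame expansion, which writes it as a sum of rank one operators with
    -- known traces. The square of the cutoff appears because frame and coefficients each carry one
    -- factor.
    have h2 : (χ y * χ y) • fiberHom y T = ∑ i, (c i y).smulRight (T (e i) y) := by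
      ext v
      have h3 := congrArg (fiberHom y T) (hsum y v)
      simp only [map_sum, map_smul, fiberHom_apply] at h3
      simpa using h3
    have h4 := congrArg (LinearMap.trace ℝ (W y)) h2
    rw [map_smul, map_sum] at h4
    simp only [LinearMap.trace_smulRight] at h4
    exact h4

/-- A fibre metric, given as a pairing of sections. -/
structure PosPairing (J : ModelWithCorners ℝ EN HN) (F : Type*) [NormedAddCommGroup F]
    [NormedSpace ℝ F] (W : N → Type*) [TopologicalSpace (TotalSpace F W)]
    [∀ x, AddCommGroup (W x)] [∀ x, Module ℝ (W x)] [∀ x, TopologicalSpace (W x)]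
    [FiberBundle F W] [VectorBundle ℝ F W] where
  toLin : Cₛ^∞⟮J; F, W⟯ →ₗ[C^∞⟮J, N; ℝ⟯] Cₛ^∞⟮J; F, W⟯ →ₗ[C^∞⟮J, N; ℝ⟯] C^∞⟮J, N; ℝ⟯
  symm (s t : Cₛ^∞⟮J; F, W⟯) : toLin s t = toLin t s
  pos (s : Cₛ^∞⟮J; F, W⟯) (x : N) (hx : s x ≠ 0) : 0 < toLin s s x

namespace PosPairing

instance : CoeFun (PosPairing J F W)
    (fun _ => Cₛ^∞⟮J; F, W⟯ → Cₛ^∞⟮J; F, W⟯ →ₗ[C^∞⟮J, N; ℝ⟯] C^∞⟮J, N; ℝ⟯) where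
  coe B := B.toLin

variable (B : PosPairing J F W)

/-- The pairing is tested against t - u itself. -/
theorem eq_at {x : N} {t u : Cₛ^∞⟮J; F, W⟯} (h : ∀ s, B s t x = B s u x) : t x = u x := by
  by_contra hne
  have h1 : (t - u) x ≠ 0 := by
    rw [ContMDiffSection.coe_sub, Pi.sub_apply]
    exact sub_ne_zero.2 hne
  have h2 := B.pos (t - u) x h1
  rw [map_sub (B.toLin (t - u)), ContMDiffMap.coe_sub, Pi.sub_apply, h, sub_self] at h2
  exact lt_irrefl _ h2

theorem ext_right {t u : Cₛ^∞⟮J; F, W⟯} (h : ∀ s, B s t = B s u) : t = u :=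
  ContMDiffSection.ext fun x => B.eq_at fun s => by rw [h]

/-- Cramer's rule: if G is the Gram matrix of a local frame, the vector w = adj(G) φ(e) satisfies G
w = det(G) φ(e). Keeping Δ = det G as a factor makes u a global smooth section without any division.
-/
theorem exists_local_riesz (φ : Cₛ^∞⟮J; F, W⟯ →ₗ[C^∞⟮J, N; ℝ⟯] C^∞⟮J, N; ℝ⟯) (x₀ : N) :
    ∃ (Δ : C^∞⟮J, N; ℝ⟯) (u : Cₛ^∞⟮J; F, W⟯), Δ x₀ ≠ 0 ∧
      ∀ᶠ x in 𝓝 x₀, ∀ s, B s u x = Δ x * φ s x := by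
  classical
  obtain ⟨P, e, ψ, hP, hsum, -⟩ := exists_dual_frame (J := J) (F := F) (W := W) x₀
  let G : Matrix _ _ C^∞⟮J, N; ℝ⟯ := Matrix.of fun i j => B (e i) (e j)
  let w := G.adjugate.mulVec fun i => φ (e i)
  have hx₀ : P x₀ = 1 := hP.self_of_nhds
  have key : ∀ x, P x = 1 → ∀ (s : Cₛ^∞⟮J; F, W⟯)
      (f : Cₛ^∞⟮J; F, W⟯ →ₗ[C^∞⟮J, N; ℝ⟯] C^∞⟮J, N; ℝ⟯),
      f s x = ∑ i, ψ i s x * f (e i) x := fun x hx s f => by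
    have h1 := congrArg (fun g : C^∞⟮J, N; ℝ⟯ => g x) (congrArg f (hsum s))
    simp only [map_sum, map_smul] at h1
    rw [fn_sum_apply] at h1
    simpa [hx] using h1
  refine ⟨G.det, ∑ j, w j • e j, ?_, ?_⟩
  -- A kernel vector v of G at x₀ would give a combination of the frame orthogonal to all sections
  -- at x₀, hence zero there, against linear independence.
  · intro hdet
    let ev : C^∞⟮J, N; ℝ⟯ →+* ℝ := ContMDiffMap.evalRingHom x₀
    have h1 : (ev.mapMatrix G).det = 0 := by
      rw [← RingHom.map_det]
      exact hdet
    obtain ⟨v, hv, hGv⟩ := Matrix.exists_mulVec_eq_zero_iff.2 h1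
    have h2 : (∑ j, v j • e j : Cₛ^∞⟮J; F, W⟯) x₀ = (0 : Cₛ^∞⟮J; F, W⟯) x₀ := by
      refine B.eq_at fun s => ?_
      rw [map_zero, B.symm, key x₀ hx₀ s (B (∑ j, v j • e j))]
      refine Finset.sum_eq_zero fun i _ => ?_
      have h3 := congrFun hGv i
      have h4 : B (∑ j, v j • e j) (e i) x₀ = (ev.mapMatrix G).mulVec v i := by
        rw [B.symm, map_sum, fn_sum_apply, Matrix.mulVec, dotProduct]
        refine Finset.sum_congr rfl fun j _ => ?_
        rw [← algebraMap_smul C^∞⟮J, N; ℝ⟯ (v j) (e j), map_smul]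
        exact mul_comm _ _
      rw [h4, h3, Pi.zero_apply, mul_zero]
    -- The values of the frame span the fibre at x₀, and their number is its dimension.
    have h5 : LinearIndependent ℝ (fun i => e i x₀) := by
      have : FiniteDimensional ℝ (W x₀) := VectorBundle.finiteDimensional ℝ F W x₀
      refine linearIndependent_of_top_le_span_of_card_eq_finrank ?_ ?_
      · rintro z -
        obtain ⟨s, rfl⟩ := exists_section_eq (J := J) (F := F) x₀ z
        have h6 := congrArg (fun u : Cₛ^∞⟮J; F, W⟯ => u x₀) (hsum s)
        simp only [fn_smul_apply, hx₀, one_smul] at h6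
        rw [h6, section_sum_apply]
        exact Submodule.sum_mem _ fun i _ => Submodule.smul_mem _ _ (Submodule.subset_span ⟨i, rfl⟩)
      · rw [← Module.finrank_eq_card_basis (Module.Basis.ofVectorSpace ℝ F)]
        exact (((trivializationAt F W x₀).linearEquivAt ℝ x₀
          (FiberBundle.mem_baseSet_trivializationAt' x₀)).finrank_eq).symm
    rw [section_sum_apply] at h2
    exact hv (funext (Fintype.linearIndependent_iff.1 h5 v h2))
  · filter_upwards [hP] with x hx s
    have hx : P x = 1 := hx
    have h1 : ∀ i, B (e i) (∑ j, w j • e j) = G.det * φ (e i) := fun i => by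
      have h2 : (G.mulVec w) i = G.det * φ (e i) := by
        simp only [w, Matrix.mulVec_mulVec, Matrix.mul_adjugate, Matrix.smul_mulVec,
          Matrix.one_mulVec]
        rfl
      rw [← h2, map_sum, Matrix.mulVec, dotProduct]
      refine Finset.sum_congr rfl fun j _ => ?_
      rw [map_smul, smul_eq_mul, mul_comm]
      rfl
    rw [B.symm, key x hx s (B (∑ j, w j • e j)), key x hx s φ, Finset.mul_sum]
    refine Finset.sum_congr rfl fun i _ => ?_
    rw [B.symm, h1]
    simp only [ContMDiffMap.coe_mul, Pi.mul_apply]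
    ring

/-- The representing vector in each fibre is unique, so the pointwise choices agree near x₀ with the
smooth section Δ⁻¹ v of the local solution. Uniqueness does the gluing. -/
theorem exists_riesz (φ : Cₛ^∞⟮J; F, W⟯ →ₗ[C^∞⟮J, N; ℝ⟯] C^∞⟮J, N; ℝ⟯) :
    ∃ u, ∀ s, B s u = φ s := by
  have h1 : ∀ x, ∃ u : Cₛ^∞⟮J; F, W⟯, ∀ s, B s u x = φ s x := fun x => by
    obtain ⟨Δ, u, hΔ, hu⟩ := B.exists_local_riesz φ x
    refine ⟨(Δ x)⁻¹ • u, fun s => ?_⟩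
    have h2 : B s ((Δ x)⁻¹ • u) x = (Δ x)⁻¹ * B s u x := by
      rw [← algebraMap_smul C^∞⟮J, N; ℝ⟯ (Δ x)⁻¹ u, map_smul]
      rfl
    rw [h2, hu.self_of_nhds, inv_mul_cancel_left₀ hΔ]
  choose u hu using h1
  refine ⟨⟨fun x => u x x, fun x₀ => ?_⟩, fun s => ?_⟩
  · obtain ⟨Δ, v, hΔ, hv⟩ := B.exists_local_riesz φ x₀
    have h3 : ContMDiffAt J (J.prod 𝓘(ℝ, F)) ∞
        (fun x => (⟨x, (Δ x)⁻¹ • v x⟩ : TotalSpace F W)) x₀ :=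
      ContMDiffAt.smul_section (Δ.contMDiff.contMDiffAt.inv₀ hΔ) v.contMDiff.contMDiffAt
    refine h3.congr_of_eventuallyEq ?_
    filter_upwards [hv, Δ.contMDiff.continuous.continuousAt.eventually_ne hΔ] with x hx hΔx
    have h4 : u x x = ((Δ x)⁻¹ • v : Cₛ^∞⟮J; F, W⟯) x := by
      refine B.eq_at fun s => ?_
      have h2 : B s ((Δ x)⁻¹ • v) x = (Δ x)⁻¹ * B s v x := by
        rw [← algebraMap_smul C^∞⟮J, N; ℝ⟯ (Δ x)⁻¹ v, map_smul]
        rfl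
      rw [hu, h2, hx, inv_mul_cancel_left₀ hΔx]
    exact congrArg (fun z : W x => (⟨x, z⟩ : TotalSpace F W)) h4
  · ext x
    rw [← hu x s]
    exact functional_congr (B s) rfl

end PosPairing

/-! ### Traces, differences and duals of connections. -/

section Connections

variable {V : Type*} [LieRing V] [LieAlgebra ℝ V]
  {ρ : V →ₗ⁅ℝ⁆ Derivation ℝ C^∞⟮J, N; ℝ⟯ C^∞⟮J, N; ℝ⟯}

namespace RConnection

variable (D D₀ D₁ : RConnection ρ F W)

@[ext] theorem ext' {D D' : RConnection ρ F W} (h : ∀ a s, D a s = D' a s) : D = D' := by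
  cases D; cases D'
  congr
  ext1 a; ext1 s
  exact h a s

/-- The covariant derivative of sections of the endomorphism bundle. -/
def endDeriv : V →ₗ[ℝ] Module.End C^∞⟮J, N; ℝ⟯ Cₛ^∞⟮J; F, W⟯ →ₗ[ℝ]
    Module.End C^∞⟮J, N; ℝ⟯ Cₛ^∞⟮J; F, W⟯ :=
  LinearMap.mk₂ ℝ
    (fun a T =>
      { toFun := fun s => D a (T s) - T (D a s)
        map_add' := fun s t => by simp only [map_add]; abel
        map_smul' := fun f s => by
          simp only [D.leibniz, map_add, map_smul, smul_sub, RingHom.id_apply]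
          abel })
    (fun a b T => by ext1 s; simp; abel)
    (fun r a T => by ext1 s; simp [smul_sub])
    (fun a S T => by ext1 s; simp; abel)
    (fun r a T => by ext1 s; simp [smul_sub])

theorem endDeriv_apply (a : V) (T : Module.End C^∞⟮J, N; ℝ⟯ Cₛ^∞⟮J; F, W⟯) (s : Cₛ^∞⟮J; F, W⟯) :
    D.endDeriv a T s = D a (T s) - T (D a s) := rfl

theorem endDeriv_mul (a : V) (S T : Module.End C^∞⟮J, N; ℝ⟯ Cₛ^∞⟮J; F, W⟯) :
    D.endDeriv a (S * T) = D.endDeriv a S * T + S * D.endDeriv a T := by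
  ext1 s
  simp [endDeriv_apply]

/-- The trace is parallel. It is computed with a frame e and a dual frame φ, valid up to a cutoff P;
differentiating the identities for P s and P Tr T gives the claim at the point x, where P is 1. -/
theorem anchor_Tr (a : V) (T : Module.End C^∞⟮J, N; ℝ⟯ Cₛ^∞⟮J; F, W⟯) :
    ρ a (Tr T) = Tr (D.endDeriv a T) := by
  ext x
  obtain ⟨P, e, φ, hP, hsum, hTr⟩ := exists_dual_frame (J := J) (F := F) (W := W) x
  have hx : P x = 1 := hP.self_of_nhds
  -- The covariant derivative of the dual frame; the Leibniz terms cancel, which makes it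
  -- C^∞-linear.
  let ψ := fun i => ({
      toFun := fun s => ρ a (φ i s) - φ i (D a s)
      map_add' := fun s t => by simp only [map_add]; abel
      map_smul' := fun f s => by
        simp only [D.leibniz, map_add, map_smul, smul_eq_mul, Derivation.leibniz, RingHom.id_apply]
        ring } : Cₛ^∞⟮J; F, W⟯ →ₗ[C^∞⟮J, N; ℝ⟯] C^∞⟮J, N; ℝ⟯)
  have h1 : ∀ s, ρ a P • s = ∑ i, (ψ i s • e i + φ i s • D a (e i)) := fun s => by
    have h := congrArg (D a) (hsum s)
    rw [D.leibniz, hsum (D a s), map_sum] at h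
    rw [eq_sub_of_add_eq' h, ← Finset.sum_sub_distrib]
    refine Finset.sum_congr rfl fun i _ => ?_
    rw [D.leibniz]
    simp only [ψ, LinearMap.coe_mk, AddHom.coe_mk, sub_smul]
    abel
  -- The trace of `h1` composed with T: the derivative of the cutoff accounts exactly for the
  -- derivatives of frame and dual frame. The same sum occurs in `h5`, so the two cancel without
  -- knowing that ρ a P vanishes at x.
  have h2 : P * (ρ a P * Tr T) = P * ∑ i, (ψ i (T (e i)) + φ i (T (D a (e i)))) := by
    have h3 : P * (ρ a P * Tr T) = ∑ j, φ j (T (ρ a P • e j)) := by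
      rw [mul_left_comm, hTr, Finset.mul_sum]
      refine Finset.sum_congr rfl fun j _ => ?_
      rw [map_smul, map_smul, smul_eq_mul]
    have h4 : ∀ (f : Cₛ^∞⟮J; F, W⟯ →ₗ[C^∞⟮J, N; ℝ⟯] C^∞⟮J, N; ℝ⟯) s,
        P * f s = ∑ j, φ j s * f (e j) := fun f s => by
      rw [← smul_eq_mul, ← map_smul, hsum, map_sum]
      simp
    simp only [h3, h1, map_sum, map_add, map_smul, smul_eq_mul, Finset.mul_sum, mul_add]
    rw [Finset.sum_comm]
    refine Finset.sum_congr rfl fun i _ => ?_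
    rw [Finset.sum_add_distrib, h4 (ψ i), h4 (φ i)]
    simp only [mul_comm]
  have h5 : ρ a (P * Tr T) = ∑ i, (ψ i (T (e i)) + φ i (T (D a (e i)))) +
      P * Tr (D.endDeriv a T) := by
    rw [hTr, hTr, map_sum, ← Finset.sum_add_distrib]
    refine Finset.sum_congr rfl fun i _ => ?_
    simp only [ψ, LinearMap.coe_mk, AddHom.coe_mk, endDeriv_apply, map_sub]
    abel
  rw [Derivation.leibniz] at h5
  have h6 := congrArg (fun f : C^∞⟮J, N; ℝ⟯ => f x) h5
  have h7 := congrArg (fun f : C^∞⟮J, N; ℝ⟯ => f x) h2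
  simp only [ContMDiffMap.coe_add, ContMDiffMap.coe_mul, Pi.add_apply, Pi.mul_apply, hx, one_mul,
    smul_eq_mul] at h6 h7
  linarith

/-- The difference of two connections, as a `1`-form with values in the endomorphism bundle. -/
def diff : V →ₗ[ℝ] Module.End C^∞⟮J, N; ℝ⟯ Cₛ^∞⟮J; F, W⟯ where
  toFun a :=
    { toFun := fun s => D₁ a s - D₀ a s
      map_add' := fun s t => by simp only [map_add]; abel
      map_smul' := fun f s => by
        simp only [leibniz, smul_sub, RingHom.id_apply]
        abel }
  map_add' a b := by ext1 s; simp; abel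
  map_smul' r a := by ext1 s; simp [smul_sub]

theorem diff_apply (a : V) (s : Cₛ^∞⟮J; F, W⟯) : diff D₀ D₁ a s = D₁ a s - D₀ a s := rfl

theorem curvature_apply (a b : V) (s : Cₛ^∞⟮J; F, W⟯) :
    D.curvature a b s = D a (D b s) - D b (D a s) - D ⁅a, b⁆ s := rfl

/-- The mean of two connections. -/
def mean : RConnection ρ F W where
  toLin := (1 / 2 : ℝ) • (D₀.toLin + D₁.toLin)
  leibniz a f s := by
    simp only [LinearMap.smul_apply, LinearMap.add_apply, leibniz, smul_add]
    have h : ρ a f • s = (1 / 2 : ℝ) • ρ a f • s + (1 / 2 : ℝ) • ρ a f • s := by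
      rw [← add_smul]
      norm_num
    conv_rhs => rw [h]
    rw [smul_comm f, smul_comm f]
    abel

theorem mean_apply (a : V) (s : Cₛ^∞⟮J; F, W⟯) :
    mean D₀ D₁ a s = (1 / 2 : ℝ) • (D₀ a s + D₁ a s) := rfl

variable {D₀ D₁}

theorem IsFlat.apply_lie (h : D.IsFlat) (a b : V) (s : Cₛ^∞⟮J; F, W⟯) :
    D ⁅a, b⁆ s = D a (D b s) - D b (D a s) := by
  have := LinearMap.congr_fun (LinearMap.congr_fun (LinearMap.congr_fun h a) b) s
  rw [curvature_apply] at this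
  exact (sub_eq_zero.1 this).symm

/-- For flat D₀ and D₁ the covariant differentials of θ are -θ ∧ θ and θ ∧ θ; their mean vanishes.
This is the hypothesis `hθ` of `covDiff_wedgePow`. -/
theorem mean_endDeriv_diff (h₀ : D₀.IsFlat) (h₁ : D₁.IsFlat) (a b : V) :
    (mean D₀ D₁).endDeriv a (diff D₀ D₁ b) - (mean D₀ D₁).endDeriv b (diff D₀ D₁ a) =
      diff D₀ D₁ ⁅a, b⁆ := by
  ext1 s
  simp only [LinearMap.sub_apply, endDeriv_apply, diff_apply, mean_apply, h₀.apply_lie,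
    h₁.apply_lie, map_sub, map_add, map_smul]
  module

variable (D₀ D₁) in
/-- The form `Tr (θ ∧ ⋯ ∧ θ)`, where `θ` is the difference of two connections. -/
def diffTrace (n : ℕ) : V [⋀^Fin n]→ₗ[ℝ] C^∞⟮J, N; ℝ⟯ :=
  Tr.compAlternatingMap (wedgePow (diff D₀ D₁) n)

variable (ρ) in
/-- The action of `V` on functions, as a linear map to the linear operators. -/
def anchorLM : V →ₗ[ℝ] C^∞⟮J, N; ℝ⟯ →ₗ[ℝ] C^∞⟮J, N; ℝ⟯ where
  toFun a := (ρ a : C^∞⟮J, N; ℝ⟯ →ₗ[ℝ] C^∞⟮J, N; ℝ⟯)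
  map_add' a b := by ext; simp
  map_smul' r a := by ext; simp

theorem d_eq_covDiff (n : ℕ) (η : V [⋀^Fin n]→ₗ[ℝ] C^∞⟮J, N; ℝ⟯) :
    d ρ n η = covDiff (anchorLM ρ) n η := by
  cases n with
  | zero => rfl
  | succ n => rfl

/-- The trace turns the differential of the mean connection into d, and θ is closed for the mean
connection, so its powers are closed as well. -/
theorem d_diffTrace (h₀ : D₀.IsFlat) (h₁ : D₁.IsFlat) (n : ℕ) :
    d ρ n (diffTrace D₀ D₁ n) = 0 := by
  rw [d_eq_covDiff, diffTrace, ← compAlternatingMap_covDiff Tr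
    (δ := (mean D₀ D₁).endDeriv) (fun a T => ((mean D₀ D₁).anchor_Tr a T).symm),
    covDiff_wedgePow (mean D₀ D₁).endDeriv_mul (mean_endDeriv_diff h₀ h₁)]
  ext; simp

theorem diffTrace_self (n : ℕ) : diffTrace D D (n + 1) = 0 := by
  have : diff D D = 0 := by
    ext1 a; ext1 s
    simp [diff_apply]
  rw [diffTrace, this, wedgePow_zero_succ]
  ext; simp

theorem diffTrace_apply (n : ℕ) (a : Fin n → V) (x : N) :
    diffTrace D₀ D₁ n a x = LinearMap.trace ℝ (W x)
      (wedgePow ((fiberHom x).toLinearMap ∘ₗ diff D₀ D₁) n a) := by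
  rw [← compAlternatingMap_wedgePow]
  rfl

end RConnection

namespace PosPairing

variable (B : PosPairing J F W) (D : RConnection ρ F W)

/-- `D'` is dual to `D` with respect to the pairing `B`. -/
def IsDual (D D' : RConnection ρ F W) : Prop :=
  ∀ a s t, ρ a (B s t) = B (D a s) t + B s (D' a t)

theorem IsDual.apply {B : PosPairing J F W} {D D' : RConnection ρ F W} (h : B.IsDual D D') (a : V)
    (s t : Cₛ^∞⟮J; F, W⟯) : B s (D' a t) = ρ a (B s t) - B (D a s) t := by
  rw [h, add_sub_cancel_left]

theorem IsDual.unique {B : PosPairing J F W} {D D' D'' : RConnection ρ F W} (h : B.IsDual D D')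
    (h' : B.IsDual D D'') : D' = D'' := by
  ext1 a t
  exact B.ext_right fun s => by rw [h.apply, h'.apply]

/-- The functional s ↦ ρ_a B(s, t) - B(D_a s, t) is C^∞-linear because the Leibniz terms cancel, so
it is represented by a section, the value of the dual connection on t. Uniqueness of the
representing section gives all the linearity and the Leibniz rule. -/
theorem exists_isDual : ∃ D', B.IsDual D D' := by
  have h : ∀ a t, ∃ u, ∀ s, B s u = ρ a (B s t) - B (D a s) t := fun a t =>
    B.exists_riesz
      { toFun := fun s => ρ a (B s t) - B (D a s) t
        map_add' := fun s s' => by simp only [map_add, LinearMap.add_apply]; abel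
        map_smul' := fun f s => by
          simp only [D.leibniz, map_add, map_smul, LinearMap.add_apply, LinearMap.smul_apply,
            smul_eq_mul, Derivation.leibniz, RingHom.id_apply]
          ring }
  choose u hu using h
  have hsmul : ∀ (r : ℝ) s t, B s (r • t) = r • B s t := fun r s t => by
    rw [← algebraMap_smul C^∞⟮J, N; ℝ⟯ r t, map_smul, algebraMap_smul]
  refine ⟨⟨LinearMap.mk₂ ℝ u (fun a b t => B.ext_right fun s => ?_)
    (fun r a t => B.ext_right fun s => ?_) (fun a t t' => B.ext_right fun s => ?_)
    (fun r a t => B.ext_right fun s => ?_), fun a f t => B.ext_right fun s => ?_⟩, fun a s t => ?_⟩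
  · simp only [map_add, LinearMap.add_apply, hu, Derivation.add_apply]; abel
  · rw [hsmul, hu, hu, map_smul, map_smul, LinearMap.smul_apply, B.symm (r • D a s), hsmul,
      B.symm t, smul_sub, Derivation.smul_apply]
  · simp only [map_add, hu]; abel
  · rw [hsmul, hu, hu, hsmul, hsmul, Derivation.map_smul, smul_sub]
  · simp only [LinearMap.mk₂_apply, map_add, map_smul, hu, smul_eq_mul, Derivation.leibniz]
    ring
  · simp only [LinearMap.mk₂_apply, hu]
    abel

/-- The curvature of the dual is minus the adjoint of the curvature, because ρ respects brackets. -/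
theorem IsDual.isFlat {B : PosPairing J F W} {D D' : RConnection ρ F W} (h : B.IsDual D D')
    (hD : D.IsFlat) : D'.IsFlat := by
  refine LinearMap.ext fun a => LinearMap.ext fun b => LinearMap.ext fun t =>
    B.ext_right fun s => ?_
  simp only [RConnection.curvature_apply, map_sub, h.apply, hD.apply_lie, LieHom.map_lie,
    Derivation.commutator_apply, LinearMap.sub_apply, LinearMap.zero_apply, map_zero]
  abel

end PosPairing

end Connections

end Frames

/-! ### Curvature of affine combinations, and Chern forms as wedge powers. -/

section Curvature

variable {EN : Type*} [NormedAddCommGroup EN] [NormedSpace ℝ EN]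
  {HN : Type*} [TopologicalSpace HN] {J : ModelWithCorners ℝ EN HN}
  {N : Type*} [TopologicalSpace N] [ChartedSpace HN N]
  {F : Type*} [NormedAddCommGroup F] [NormedSpace ℝ F]
  {W : N → Type*} [TopologicalSpace (TotalSpace F W)]
  [∀ x, AddCommGroup (W x)] [∀ x, Module ℝ (W x)] [∀ x, TopologicalSpace (W x)]
  [FiberBundle F W] [VectorBundle ℝ F W]
  [FiniteDimensional ℝ EN] [T2Space N] [IsManifold J ∞ N]
  [FiniteDimensional ℝ F] [ContMDiffVectorBundle ∞ F W J]
  {V : Type*} [LieRing V] [LieAlgebra ℝ V]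
  {ρ : V →ₗ⁅ℝ⁆ Derivation ℝ C^∞⟮J, N; ℝ⟯ C^∞⟮J, N; ℝ⟯}

namespace RConnection

variable {D₀ D₁ : RConnection ρ F W}

theorem affineComb_apply (f : C^∞⟮J, N; ℝ⟯) (a : V) (s : Cₛ^∞⟮J; F, W⟯) :
    affineComb D₀ D₁ f a s = (1 - f) • D₀ a s + f • D₁ a s := rfl

/-- This is df ∧ θ + (f² - f) θ ∧ θ, the terms (1 - f) R⁰ + f R¹ of the general formula being zero.
-/
theorem curvature_affineComb (h₀ : D₀.IsFlat) (h₁ : D₁.IsFlat) (f : C^∞⟮J, N; ℝ⟯) (a b : V)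
    (s : Cₛ^∞⟮J; F, W⟯) :
    (affineComb D₀ D₁ f).curvature a b s = ρ a f • diff D₀ D₁ b s - ρ b f • diff D₀ D₁ a s +
      (f * f - f) • (diff D₀ D₁ a (diff D₀ D₁ b s) - diff D₀ D₁ b (diff D₀ D₁ a s)) := by
  simp only [curvature_apply, affineComb_apply, diff_apply, map_add, map_sub, leibniz,
    h₀.apply_lie, h₁.apply_lie, Derivation.map_one_eq_zero, zero_sub]
  module

/-- Peeling off two arguments at a time turns the sum over permutations into an iterated `twoWedge`.
Each `twoWedge` contains a factor 1/2, and together these account for the normalization 1/2^p. -/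
theorem curvaturePow_eq (D : RConnection ρ F W) (p : ℕ) :
    D.curvaturePow p = twoWedgePow D.curvature p := by
  have key : ∀ p, MultilinearMap.alternatization (D.curvatureProd p) =
      (2 ^ p : ℝ) • twoWedgePow D.curvature p := by
    intro p
    induction p with
    | zero =>
      ext a : 1
      simp [MultilinearMap.alternatization_apply, twoWedgePow, curvatureProd]
    | succ p ih =>
      have h1 := alternatization_succ (n := 2 * p + 1) (D.curvatureProd (p + 1))
      refine h1.trans ?_
      have h2 : alternatizationLM ∘ₗ (MultilinearMap.curryLeft (n := 2 * p + 1)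
          (M := fun _ => V) (D.curvatureProd (p + 1))) =
          AlternatingMap.alternatizeUncurryFinLM ∘ₗ
            ((2 ^ p : ℝ) • bilinSMul D.curvature (twoWedgePow D.curvature p)) := by
        refine LinearMap.ext fun x => ?_
        refine (alternatization_succ (n := 2 * p) (MultilinearMap.curryLeft (n := 2 * p + 1)
          (M := fun _ => V) (D.curvatureProd (p + 1)) x)).trans ?_
        refine congrArg AlternatingMap.alternatizeUncurryFin (LinearMap.ext fun y => ?_)
        have h3 : (MultilinearMap.curryLeft (n := 2 * p) (M := fun _ => V)
            (MultilinearMap.curryLeft (n := 2 * p + 1) (M := fun _ => V)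
              (D.curvatureProd (p + 1)) x) y) =
            (LinearMap.mulLeft ℝ (D.curvature x y)).compMultilinearMap (D.curvatureProd p) := by
          ext1 v
          exact (congrArg List.prod List.ofFn_succ).trans List.prod_cons
        refine (congrArg MultilinearMap.alternatization h3).trans ?_
        rw [LinearMap.compMultilinearMap_alternatization, ih]
        ext v : 1
        simp
      rw [h2, twoWedgePow, twoWedge, LinearMap.comp_smul,
        AlternatingMap.alternatizeUncurryFin_smul, smul_smul]
      congr 1
      rw [pow_succ]
      ring
  rw [curvaturePow, key, smul_smul]
  simp

end RConnection

end Curvature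

/-! ### Chern–Simons forms of two flat connections. -/

section ChernSimons

variable {EM : Type*} [NormedAddCommGroup EM] [NormedSpace ℝ EM] [FiniteDimensional ℝ EM]
  {M : Type*} [TopologicalSpace M] [ChartedSpace EM M] [IsManifold 𝓘(ℝ, EM) ∞ M] [T2Space M]
  {FA : Type*} [NormedAddCommGroup FA] [NormedSpace ℝ FA] [FiniteDimensional ℝ FA]
  {A : M → Type*} [TopologicalSpace (TotalSpace FA A)]
  [∀ x, AddCommGroup (A x)] [∀ x, Module ℝ (A x)] [∀ x, TopologicalSpace (A x)]
  [FiberBundle FA A] [VectorBundle ℝ FA A] [ContMDiffVectorBundle ∞ FA A 𝓘(ℝ, EM)]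
  {𝒜 : LieAlgebroid EM FA A}
  {F : Type*} [NormedAddCommGroup F] [NormedSpace ℝ F] [FiniteDimensional ℝ F]
  {E : M → Type*} [TopologicalSpace (TotalSpace F E)]
  [∀ x, AddCommGroup (E x)] [∀ x, Module ℝ (E x)] [∀ x, TopologicalSpace (E x)]
  [FiberBundle F E] [VectorBundle ℝ F E] [ContMDiffVectorBundle ∞ F E 𝓘(ℝ, EM)]

/-- Pulled back sections take every value at (t, x), so they determine a tensorial operator. On them
the time derivative vanishes and lifted connections act as on M. -/
theorem fiberHom_pb_eq (T : Module.End C^∞⟮LI EM, ℝ × M; ℝ⟯ Cₛ^∞⟮LI EM; F, PB EM E⟯) {t : ℝ} {x : M}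
    {L : E x →ₗ[ℝ] E x}
    (h : ∀ s : Cₛ^∞⟮𝓘(ℝ, EM); F, E⟯, val (T (pullSec s)) (t, x) = L (s x)) :
    fiberHom (t, x) T = L := by
  refine fiberHom_eq T fun σ => ?_
  obtain ⟨s, hs⟩ := exists_section_eq (J := 𝓘(ℝ, EM)) (F := F) x (val σ (t, x))
  have h1 : pullSec s (t, x) = σ (t, x) := hs
  rw [← fiberHom_apply, ← h1, fiberHom_apply]
  exact h s

theorem timeDeriv_pullSec (s : Cₛ^∞⟮𝓘(ℝ, EM); F, E⟯) (p : ℝ × M) :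
    timeDeriv (pullSec s) p = 0 := by
  simp only [timeDeriv, val_pullSec, deriv_const, map_zero]

theorem slice_pullSec (s : Cₛ^∞⟮𝓘(ℝ, EM); F, E⟯) (t : ℝ) : slice (pullSec s) t = s := rfl

namespace RConnection

theorem lift_pullSec (D : RConnection 𝒜.anchorHom F E) (z : ℝ × 𝒜.Sec)
    (s : Cₛ^∞⟮𝓘(ℝ, EM); F, E⟯) : D.lift z (pullSec s) = pullSec (D z.2 s) := by
  obtain ⟨c, a⟩ := z
  refine val_ext fun t x => ?_
  rw [lift_apply, timeDeriv_pullSec, smul_zero, zero_add, slice_pullSec, val_pullSec]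

theorem IsFlat.lift {D : RConnection 𝒜.anchorHom F E} (h : D.IsFlat) : D.lift.IsFlat := by
  refine LinearMap.ext fun z => LinearMap.ext fun w => LinearMap.ext fun σ => val_ext fun t x => ?_
  have h1 : fiberHom (t, x) (D.lift.curvature z w) = (0 : E x →ₗ[ℝ] E x) := by
    refine fiberHom_pb_eq _ fun s => ?_
    simp only [curvature_apply, lift_pullSec, LieAlgebroid.line_lie, h.apply_lie]
    change val (pullSec _ - pullSec _ - pullSec _) (t, x) = 0
    exact sub_self (D z.2 (D w.2 s) x - D w.2 (D z.2 s) x)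
  exact (fiberHom_apply (D.lift.curvature z w) (t, x) σ).symm.trans
    (LinearMap.congr_fun h1 (val σ (t, x)))

theorem fiberHom_diff_lift (D₀ D₁ : RConnection 𝒜.anchorHom F E) (z : ℝ × 𝒜.Sec) (t : ℝ) (x : M) :
    fiberHom (t, x) (diff D₀.lift D₁.lift z) = fiberHom x (diff D₀ D₁ z.2) := by
  refine fiberHom_pb_eq _ fun s => ?_
  rw [diff_apply, lift_pullSec, lift_pullSec]
  exact (fiberHom_apply (diff D₀ D₁ z.2) x s).symm

theorem lineAnchorHom_timeFn (z : ℝ × 𝒜.Sec) (t : ℝ) (x : M) :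
    𝒜.lineAnchorHom z (timeFn EM M) (t, x) = z.1 := by
  obtain ⟨c, a⟩ := z
  refine (𝒜.lineDerivation_apply c a _ t x).trans ?_
  have h1 : sliceFn (timeFn EM M) t = algebraMap ℝ _ t := rfl
  have h2 : (fun s => timeFn EM M (s, x)) = fun s => s := rfl
  rw [h1, h2, Derivation.map_algebraMap]
  simp

/-- In the algebra End(E_x) the curvature of the affine connection at (t, x) is dt ∧ Θ + (t² - t) Θ
∧ Θ, so the power formula applies with scalar coefficients; contraction with ∂_t leaves its dt part.
-/
theorem ch_aff_apply {D₀ D₁ : RConnection 𝒜.anchorHom F E} (h₀ : D₀.IsFlat) (h₁ : D₁.IsFlat)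
    (q : ℕ) (a : Fin (2 * q + 1) → 𝒜.Sec) (t : ℝ) (x : M) :
    (aff D₀ D₁).ch (q + 1)
      (Matrix.vecCons (1, 0) (fun i => (0, a i)) : Fin (2 * q + 2) → ℝ × 𝒜.Sec) (t, x) =
    ((q + 1) * (t * t - t) ^ q) * diffTrace D₀ D₁ (2 * q + 1) a x := by
  let Θ : ℝ × 𝒜.Sec →ₗ[ℝ] Module.End ℝ (PB EM E (t, x)) :=
    (fiberHom (t, x)).toLinearMap ∘ₗ diff D₀.lift D₁.lift
  let r : ℝ × 𝒜.Sec →ₗ[ℝ] ℝ × 𝒜.Sec →ₗ[ℝ] Module.End ℝ (PB EM E (t, x)) :=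
    (aff D₀ D₁).curvature.compr₂ (fiberHom (t, x)).toLinearMap
  have hr : ∀ z w, r z w = LinearMap.fst ℝ ℝ 𝒜.Sec z • Θ w - LinearMap.fst ℝ ℝ 𝒜.Sec w • Θ z +
      (t * t - t) • (Θ z * Θ w - Θ w * Θ z) := by
    intro z w
    refine fiberHom_eq _ fun σ => ?_
    rw [aff, curvature_affineComb h₀.lift h₁.lift]
    have e1 := lineAnchorHom_timeFn z t x
    have e2 := lineAnchorHom_timeFn w t x
    have e3 : timeFn EM M (t, x) = t := rfl
    simp only [ContMDiffSection.coe_add, ContMDiffSection.coe_sub, Pi.add_apply, Pi.sub_apply,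
      fn_smul_apply, ContMDiffMap.coe_sub, ContMDiffMap.coe_mul, Pi.mul_apply, e1, e2, e3]
    simp only [Θ, LinearMap.add_apply, LinearMap.sub_apply, LinearMap.smul_apply,
      Module.End.mul_apply, LinearMap.comp_apply, AlgHom.toLinearMap_apply, fiberHom_apply,
      LinearMap.fst_apply]
  have hΘ : Θ (1, 0) = 0 := by
    refine (fiberHom_diff_lift D₀ D₁ (1, 0) t x).trans ?_
    exact (congrArg _ (map_zero (diff D₀ D₁))).trans (map_zero _)
  have h1 : (aff D₀ D₁).ch (q + 1)
      (Matrix.vecCons (1, 0) (fun i => (0, a i)) : Fin (2 * q + 2) → ℝ × 𝒜.Sec) (t, x) =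
      LinearMap.trace ℝ _ (twoWedgePow r (q + 1)
        (Matrix.vecCons (1, 0) (fun i => (0, a i)) : Fin (2 * q + 2) → ℝ × 𝒜.Sec)) := by
    rw [← compAlternatingMap_twoWedgePow, ← curvaturePow_eq]
    rfl
  have h2 : twoWedgePow r (q + 1)
      (Matrix.vecCons (1, 0) (fun i => (0, a i)) : Fin (2 * q + 2) → ℝ × 𝒜.Sec) =
      ((q + 1 : ℝ) * (t * t - t) ^ q) • wedgePow Θ (2 * q + 1) (fun i => (0, a i)) :=
    DFunLike.congr_fun (contract_twoWedgePow hr (z := (1, 0)) rfl hΘ q) (fun i => (0, a i))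
  have h3 : wedgePow Θ (2 * q + 1) (fun i => (0, a i)) =
      wedgePow ((fiberHom x).toLinearMap ∘ₗ diff D₀ D₁) (2 * q + 1) a := by
    have e : Θ ∘ₗ LinearMap.inr ℝ ℝ 𝒜.Sec = (fiberHom x).toLinearMap ∘ₗ diff D₀ D₁ :=
      LinearMap.ext fun b => fiberHom_diff_lift D₀ D₁ (0, b) t x
    exact DFunLike.congr_fun ((wedgePow_compLinearMap (LinearMap.inr ℝ ℝ 𝒜.Sec) Θ (2 * q + 1)).trans
      (congrArg (fun θ : 𝒜.Sec →ₗ[ℝ] Module.End ℝ (E x) => wedgePow θ (2 * q + 1)) e)) a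
  rw [h1, diffTrace_apply]
  refine (congrArg (LinearMap.trace ℝ (E x))
    (h2.trans (congrArg (fun w => ((q + 1 : ℝ) * (t * t - t) ^ q) • w) h3))).trans ?_
  exact map_smul (LinearMap.trace ℝ (E x)) _ _

/-- The integrand is a function of t times a form that does not depend on t. The value of the
constant never matters, only that it is the same for all pairs of connections. -/
theorem chernSimons_eq_smul {D₀ D₁ : RConnection 𝒜.anchorHom F E} (h₀ : D₀.IsFlat) (h₁ : D₁.IsFlat)
    (q : ℕ) : chernSimons D₀ D₁ (q + 1) =
      (∫ t in (0 : ℝ)..1, ((q + 1) * (t * t - t) ^ q : ℝ)) • diffTrace D₀ D₁ (2 * q + 1) := by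
  ext a x
  refine (chernSimons_succ_apply D₀ D₁ q a x).trans ?_
  simp only [ch_aff_apply h₀ h₁]
  rw [intervalIntegral.integral_mul_const]
  rfl

end RConnection

end ChernSimons

/-! ### Naturality of the differential under Lie algebra homomorphisms. -/

section Pullback

open AlternatingMap

variable {V V' N : Type*} [LieRing V] [LieAlgebra ℝ V] [LieRing V'] [LieAlgebra ℝ V']
  [AddCommGroup N] [Module ℝ N]

theorem covDiff_compLinearMap (L : V' →ₗ[ℝ] V) (hL : ∀ x y, L ⁅x, y⁆ = ⁅L x, L y⁆)
    (δ : V →ₗ[ℝ] N →ₗ[ℝ] N) (n : ℕ) (η : V [⋀^Fin n]→ₗ[ℝ] N) :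
    (covDiff δ n η).compLinearMap L = covDiff (δ ∘ₗ L) n (η.compLinearMap L) := by
  have h1 : ∀ (n : ℕ) (η : V [⋀^Fin n]→ₗ[ℝ] N),
      (alternatizeUncurryFin (derivForm δ η)).compLinearMap L =
        alternatizeUncurryFin (derivForm (δ ∘ₗ L) (η.compLinearMap L)) := fun n η =>
    compLinearMap_alternatizeUncurryFin _ _ _ fun x => rfl
  cases n with
  | zero => exact h1 0 η
  | succ n =>
    have h2 : (alternatizeUncurryFin (alternatizeUncurryFinLM ∘ₗ lieContract η)).compLinearMap L =
        alternatizeUncurryFin (alternatizeUncurryFinLM ∘ₗ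
          lieContract (η.compLinearMap L)) := by
      refine compLinearMap_alternatizeUncurryFin _ _ _ fun x => ?_
      refine (compLinearMap_alternatizeUncurryFin _ _ _ fun y => ?_).symm
      ext v
      simp only [lieContract_apply, contract_apply, AlternatingMap.compLinearMap_apply, ← hL]
      congr 1
      ext i
      exact Fin.cases rfl (fun i => rfl) i
    rw [covDiff, covDiff, ← h1, ← h2]
    ext v; simp

end Pullback

/-! ### Integration over [0, 1] and derivations. -/

section Integral

variable {EM : Type*} [NormedAddCommGroup EM] [NormedSpace ℝ EM] [FiniteDimensional ℝ EM]
  {M : Type*} [TopologicalSpace M] [ChartedSpace EM M] [IsManifold 𝓘(ℝ, EM) ∞ M]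

-- Differentiation under the integral sign; the dominating constant is a bound of the continuous
-- partial derivative on the compact set [0, 1] × closed ball.
open MeasureTheory in
theorem fderiv_integral_param {U : Set EM} (hU : IsOpen U) {g : ℝ × EM → ℝ}
    (hg : ContDiffOn ℝ ∞ g (Set.univ ×ˢ U)) {y : EM} (hy : y ∈ U) (v : EM) :
    fderiv ℝ (fun z => ∫ t in (0 : ℝ)..1, g (t, z)) y v =
      ∫ t in (0 : ℝ)..1, fderiv ℝ (fun z => g (t, z)) y v := by
  have hUo : IsOpen ((Set.univ : Set ℝ) ×ˢ U) := isOpen_univ.prod hU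
  have hd : ∀ t, ∀ z ∈ U, HasFDerivAt (fun z => g (t, z))
      ((fderiv ℝ g (t, z)).comp (ContinuousLinearMap.inr ℝ ℝ EM)) z := fun t z hz =>
    (((hg.contDiffAt (hUo.mem_nhds ⟨trivial, hz⟩)).differentiableAt (by simp)).hasFDerivAt).comp z
      (hasFDerivAt_prodMk_right t z)
  have hc : ContinuousOn (fderiv ℝ g) (Set.univ ×ˢ U) :=
    hg.continuousOn_fderiv_of_isOpen hUo (by simp)
  obtain ⟨ε, hε, hεU⟩ := Metric.nhds_basis_closedBall.mem_iff.1 (hU.mem_nhds hy)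
  have hK : IsCompact (Set.Icc (0 : ℝ) 1 ×ˢ Metric.closedBall y ε) :=
    isCompact_Icc.prod (isCompact_closedBall y ε)
  have hc' : ContinuousOn (fun p => (fderiv ℝ g p).comp (ContinuousLinearMap.inr ℝ ℝ EM))
      (Set.univ ×ˢ U) := hc.clm_comp continuousOn_const
  obtain ⟨C, hC⟩ := hK.exists_bound_of_continuousOn
    (hc'.mono (Set.prod_mono (Set.subset_univ _) hεU))
  have hslice : ∀ z ∈ U, Continuous fun t : ℝ => g (t, z) := fun z hz =>
    continuousOn_univ.1 (hg.continuousOn.comp (Continuous.prodMk_left z).continuousOn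
      fun t _ => ⟨trivial, hz⟩)
  have hslice' : Continuous fun t : ℝ =>
      (fderiv ℝ g (t, y)).comp (ContinuousLinearMap.inr ℝ ℝ EM) :=
    continuousOn_univ.1 (hc'.comp (Continuous.prodMk_left y).continuousOn
      fun t _ => ⟨trivial, hy⟩)
  have h := intervalIntegral.hasFDerivAt_integral_of_dominated_of_fderiv_le (𝕜 := ℝ)
    (μ := volume) (a := 0) (b := 1) (F := fun z t => g (t, z)) (x₀ := y)
    (F' := fun z t => (fderiv ℝ g (t, z)).comp (ContinuousLinearMap.inr ℝ ℝ EM))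
    (bound := fun _ => C) (s := Metric.closedBall y ε) (Metric.closedBall_mem_nhds y hε)
    (by
      filter_upwards [hU.mem_nhds hy] with z hz using (hslice z hz).aestronglyMeasurable)
    ((hslice y hy).intervalIntegrable 0 1) hslice'.aestronglyMeasurable
    (Filter.Eventually.of_forall fun t ht z hz => hC (t, z) ⟨by
      rw [Set.uIoc_of_le zero_le_one] at ht
      exact ⟨ht.1.le, ht.2⟩, hz⟩)
    (intervalIntegrable_const)
    (Filter.Eventually.of_forall fun t _ z hz => hd t z (hεU hz))
  rw [h.fderiv, ContinuousLinearMap.intervalIntegral_apply (hslice'.intervalIntegrable 0 1)]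
  exact intervalIntegral.integral_congr fun t _ => by
    rw [(hd t y hy).fderiv]

variable [T2Space M]
  {FA : Type*} [NormedAddCommGroup FA] [NormedSpace ℝ FA] [FiniteDimensional ℝ FA]
  {A : M → Type*} [TopologicalSpace (TotalSpace FA A)]
  [∀ x, AddCommGroup (A x)] [∀ x, Module ℝ (A x)] [∀ x, TopologicalSpace (A x)]
  [FiberBundle FA A] [VectorBundle ℝ FA A] [ContMDiffVectorBundle ∞ FA A 𝓘(ℝ, EM)]
  {𝒜 : LieAlgebroid EM FA A}

theorem dirDeriv_integral (f : C^∞⟮LI EM, ℝ × M; ℝ⟯) (x : M) (v : TangentSpace 𝓘(ℝ, EM) x) :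
    dirDeriv 𝓘(ℝ, EM) (intLM f) x v =
      ∫ t in (0 : ℝ)..1, dirDeriv 𝓘(ℝ, EM) (sliceFn f t) x v := by
  rw [dirDeriv_eq_fderiv _ _ ((intLM f).contMDiff.mdifferentiable (by simp) x)]
  have h1 : ContMDiffOn 𝓘(ℝ, EM) 𝓘(ℝ, EM) ∞ (chartAt EM x).symm (chartAt EM x).target :=
    contMDiffOn_chart_symm
  have h2 : ContMDiffOn (LI EM) (LI EM) ∞
      (fun p : ℝ × EM => (p.1, (chartAt EM x).symm p.2)) (Set.univ ×ˢ (chartAt EM x).target) :=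
    contMDiffOn_fst.prodMk (h1.comp contMDiffOn_snd (fun p hp => hp.2))
  have h3 := f.contMDiff.comp_contMDiffOn h2
  have h4 : ContDiffOn ℝ ∞ (fun p : ℝ × EM => f (p.1, (chartAt EM x).symm p.2))
      (Set.univ ×ˢ (chartAt EM x).target) := by
    rw [← contMDiffOn_iff_contDiffOn, modelWithCornersSelf_prod, ← chartedSpaceSelf_prod]
    exact h3
  refine (fderiv_integral_param (chartAt EM x).open_target h4 (mem_chart_target EM x) v).trans ?_
  exact intervalIntegral.integral_congr fun t _ =>
    (dirDeriv_eq_fderiv _ _ ((sliceFn f t).contMDiff.mdifferentiable (by simp) x) v).symm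

theorem intLM_lineAnchorHom (a : 𝒜.Sec) (f : C^∞⟮LI EM, ℝ × M; ℝ⟯) :
    intLM (𝒜.lineAnchorHom (0, a) f) = 𝒜.anchorHom a (intLM f) := by
  ext x
  refine Eq.trans ?_ (dirDeriv_integral f x _).symm
  refine intervalIntegral.integral_congr fun t _ => ?_
  refine (𝒜.lineDerivation_apply 0 a f t x).trans ?_
  rw [zero_mul, zero_add]
  rfl

theorem intLM_timeDerivative (f : C^∞⟮LI EM, ℝ × M; ℝ⟯) :
    intLM (𝒜.lineAnchorHom (1, 0) f) = sliceFn f 1 - sliceFn f 0 := by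
  ext x
  have h1 : ∀ t, 𝒜.lineAnchorHom (1, 0) f (t, x) = deriv (fun s => f (s, x)) t := fun t => by
    refine (𝒜.lineDerivation_apply 1 0 f t x).trans ?_
    have : 𝒜.anchorDerivation 0 (sliceFn f t) = 0 :=
      congrArg (fun δ => δ (sliceFn f t)) (map_zero 𝒜.anchorHom)
    rw [this, one_mul]
    exact add_zero _
  have h2 : ContDiff ℝ ∞ fun s => f (s, x) := by
    rw [← contMDiff_iff_contDiff]
    exact f.contMDiff.comp (contMDiff_id.prodMk contMDiff_const)
  refine (intervalIntegral.integral_congr fun t _ => h1 t).trans ?_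
  exact intervalIntegral.integral_deriv_eq_sub
    (fun t _ => (h2.differentiable (by simp)) t)
    ((h2.continuous_deriv (by simp)).intervalIntegrable 0 1)

end Integral

/-! ### Stokes' formula on Tℝ × A. -/

section Stokes

variable {EM : Type*} [NormedAddCommGroup EM] [NormedSpace ℝ EM] [FiniteDimensional ℝ EM]
  {M : Type*} [TopologicalSpace M] [ChartedSpace EM M] [IsManifold 𝓘(ℝ, EM) ∞ M] [T2Space M]
  {FA : Type*} [NormedAddCommGroup FA] [NormedSpace ℝ FA] [FiniteDimensional ℝ FA]
  {A : M → Type*} [TopologicalSpace (TotalSpace FA A)]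
  [∀ x, AddCommGroup (A x)] [∀ x, Module ℝ (A x)] [∀ x, TopologicalSpace (A x)]
  [FiberBundle FA A] [VectorBundle ℝ FA A] [ContMDiffVectorBundle ∞ FA A 𝓘(ℝ, EM)]
  {𝒜 : LieAlgebroid EM FA A}

/-- Stokes' formula for closed forms on `Tℝ × A`. -/
theorem d_fibreIntegral {n : ℕ} {η : (ℝ × 𝒜.Sec) [⋀^Fin (n + 1)]→ₗ[ℝ] C^∞⟮LI EM, ℝ × M; ℝ⟯}
    (hη : d 𝒜.lineAnchorHom (n + 1) η = 0) (a : Fin (n + 1) → 𝒜.Sec) :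
    d 𝒜.anchorHom n (fibreIntegral η) a =
      sliceFn (η fun i => (0, a i)) 1 - sliceFn (η fun i => (0, a i)) 0 := by
  have hz : ∀ w : ℝ × 𝒜.Sec, ⁅((1, 0) : ℝ × 𝒜.Sec), w⁆ = 0 := fun w => by
    rw [LieAlgebroid.line_lie, zero_lie]
    rfl
  rw [RConnection.d_eq_covDiff] at hη
  rw [RConnection.d_eq_covDiff]
  -- Since η is closed, Cartan's formula reads d(ι_{∂_t} η) = ∂_t η. Restricting to Γ(A) and
  -- integrating over t leaves the boundary values.
  have h1 := contract_covDiff hz n η (δ := RConnection.anchorLM 𝒜.lineAnchorHom)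
  rw [hη, map_zero] at h1
  have h2 := (sub_eq_zero.1 h1.symm).symm
  have h3 : fibreIntegral η = intLM.compAlternatingMap
      ((contract (1, 0) η).compLinearMap (LinearMap.inr ℝ ℝ 𝒜.Sec)) := rfl
  have h4 := covDiff_compLinearMap (LinearMap.inr ℝ ℝ 𝒜.Sec) (fun x y => rfl)
    (RConnection.anchorLM 𝒜.lineAnchorHom) n (contract (1, 0) η)
  rw [h2] at h4
  rw [h3, ← compAlternatingMap_covDiff intLM
    (δ := RConnection.anchorLM 𝒜.lineAnchorHom ∘ₗ LinearMap.inr ℝ ℝ 𝒜.Sec)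
    (δ' := RConnection.anchorLM 𝒜.anchorHom)
    (fun a f => intLM_lineAnchorHom a f), ← h4]
  exact intLM_timeDerivative _

end Stokes

/-! ### Metrics as pairings, and a path between two metrics. -/

section Metrics

variable {EM : Type*} [NormedAddCommGroup EM] [NormedSpace ℝ EM] [FiniteDimensional ℝ EM]
  {M : Type*} [TopologicalSpace M] [ChartedSpace EM M] [IsManifold 𝓘(ℝ, EM) ∞ M] [T2Space M]
  {F : Type*} [NormedAddCommGroup F] [NormedSpace ℝ F] [FiniteDimensional ℝ F]
  {E : M → Type*} [TopologicalSpace (TotalSpace F E)]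
  [∀ x, AddCommGroup (E x)] [∀ x, Module ℝ (E x)] [∀ x, TopologicalSpace (E x)]
  [∀ x, IsTopologicalAddGroup (E x)] [∀ x, ContinuousConstSMul ℝ (E x)]
  [FiberBundle F E] [VectorBundle ℝ F E] [ContMDiffVectorBundle ∞ F E 𝓘(ℝ, EM)]

/-- The pairing of sections given by a metric. -/
def metricPairing (h : ContMDiffRiemannianMetric 𝓘(ℝ, EM) ∞ F E) :
    PosPairing 𝓘(ℝ, EM) F E where
  toLin := LinearMap.mk₂ _ (pairing h)
    (fun s s' t => by ext x; exact congrArg (fun l => l (t x)) (map_add (h.inner x) (s x) (s' x)))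
    (fun f s t => by ext x; exact congrArg (fun l => l (t x)) (map_smul (h.inner x) (f x) (s x)))
    (fun s t t' => by ext x; exact map_add (h.inner x (s x)) (t x) (t' x))
    (fun f s t => by ext x; exact map_smul (h.inner x (s x)) (f x) (t x))
  symm s t := by ext x; exact h.symm x (s x) (t x)
  pos s x hx := h.pos x (s x) hx

/-- The smooth function `(t, x) ↦ h(σ(t, x), τ(t, x))` for sections `σ`, `τ` of the pullback. -/
def pbPairing (h : ContMDiffRiemannianMetric 𝓘(ℝ, EM) ∞ F E) (σ τ : Cₛ^∞⟮LI EM; F, PB EM E⟯) :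
    C^∞⟮LI EM, ℝ × M; ℝ⟯ :=
  mkFn (fun p => h.inner p.2 (val σ p) (val τ p)) (by
    intro p
    have h0 : ContMDiffAt (LI EM) (𝓘(ℝ, EM).prod 𝓘(ℝ, F →L[ℝ] F →L[ℝ] ℝ)) ∞
        (fun p : ℝ × M => TotalSpace.mk' (F →L[ℝ] F →L[ℝ] ℝ)
          (E := fun x => E x →L[ℝ] E x →L[ℝ] ℝ) p.2 (h.inner p.2)) p :=
      h.contMDiff.contMDiffAt.comp p contMDiffAt_snd
    have h1 : ContMDiffAt (LI EM) (𝓘(ℝ, EM).prod 𝓘(ℝ)) ∞ (fun p : ℝ × M =>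
        TotalSpace.mk' ℝ (E := Bundle.Trivial M ℝ) p.2 (h.inner p.2 (val σ p) (val τ p))) p :=
      ContMDiffAt.clm_bundle_apply₂ (F₁ := F) (F₂ := F) h0
        (contMDiff_val σ p) (contMDiff_val τ p)
    simp only [contMDiffAt_totalSpace] at h1
    exact h1.2)

/-- The `C^∞(ℝ × M)`-bilinear extension of a metric to the sections of the pullback. -/
def pbForm (h : ContMDiffRiemannianMetric 𝓘(ℝ, EM) ∞ F E) :
    Cₛ^∞⟮LI EM; F, PB EM E⟯ →ₗ[C^∞⟮LI EM, ℝ × M; ℝ⟯] Cₛ^∞⟮LI EM; F, PB EM E⟯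
      →ₗ[C^∞⟮LI EM, ℝ × M; ℝ⟯] C^∞⟮LI EM, ℝ × M; ℝ⟯ :=
  LinearMap.mk₂ _ (pbPairing h)
    (fun s s' t => by
      ext p; exact congrArg (fun l => l (val t p)) (map_add (h.inner p.2) (val s p) (val s' p)))
    (fun f s t => by
      ext p; exact congrArg (fun l => l (val t p)) (map_smul (h.inner p.2) (f p) (val s p)))
    (fun s t t' => by ext p; exact map_add (h.inner p.2 (val s p)) (val t p) (val t' p))
    (fun f s t => by ext p; exact map_smul (h.inner p.2 (val s p)) (f p) (val t p))

/-- The path of metrics `(1 - t)² h₁ + t² h₂`, as a pairing of sections of the pullback. -/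
def pathPairing (h₁ h₂ : ContMDiffRiemannianMetric 𝓘(ℝ, EM) ∞ F E) :
    PosPairing (LI EM) F (PB EM E) where
  toLin := ((1 - timeFn EM M) ^ 2) • pbForm h₁ + ((timeFn EM M) ^ 2) • pbForm h₂
  symm σ τ := by
    ext p
    have e₁ : h₁.inner p.2 (val σ p) (val τ p) = h₁.inner p.2 (val τ p) (val σ p) := h₁.symm _ _ _
    have e₂ : h₂.inner p.2 (val σ p) (val τ p) = h₂.inner p.2 (val τ p) (val σ p) := h₂.symm _ _ _
    change (1 - p.1) ^ 2 * h₁.inner p.2 (val σ p) (val τ p) + p.1 ^ 2 * h₂.inner p.2 _ _ =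
      (1 - p.1) ^ 2 * h₁.inner p.2 (val τ p) (val σ p) + p.1 ^ 2 * h₂.inner p.2 _ _
    rw [e₁, e₂]
  pos σ p hp := by
    have e₁ : 0 < h₁.inner p.2 (val σ p) (val σ p) := h₁.pos _ _ hp
    have e₂ : 0 < h₂.inner p.2 (val σ p) (val σ p) := h₂.pos _ _ hp
    change 0 < (1 - p.1) ^ 2 * h₁.inner p.2 (val σ p) (val σ p) +
      p.1 ^ 2 * h₂.inner p.2 (val σ p) (val σ p)
    -- The squares keep both coefficients nonnegative for every real t, not only on [0, 1], and they
    -- never vanish together.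
    by_cases ht : p.1 = 0
    · rw [ht]
      simpa using e₁
    · have : 0 < p.1 ^ 2 := by positivity
      positivity

theorem pathPairing_apply (h₁ h₂ : ContMDiffRiemannianMetric 𝓘(ℝ, EM) ∞ F E)
    (σ τ : Cₛ^∞⟮LI EM; F, PB EM E⟯) (t : ℝ) (x : M) :
    pathPairing h₁ h₂ σ τ (t, x) = (1 - t) ^ 2 * pairing h₁ (slice σ t) (slice τ t) x +
      t ^ 2 * pairing h₂ (slice σ t) (slice τ t) x := rfl

end Metrics

/-! ### Restriction to {t} × M and the homotopy between two metrics. -/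

section Restriction

variable {EM : Type*} [NormedAddCommGroup EM] [NormedSpace ℝ EM] [FiniteDimensional ℝ EM]
  {M : Type*} [TopologicalSpace M] [ChartedSpace EM M] [IsManifold 𝓘(ℝ, EM) ∞ M] [T2Space M]
  {FA : Type*} [NormedAddCommGroup FA] [NormedSpace ℝ FA] [FiniteDimensional ℝ FA]
  {A : M → Type*} [TopologicalSpace (TotalSpace FA A)]
  [∀ x, AddCommGroup (A x)] [∀ x, Module ℝ (A x)] [∀ x, TopologicalSpace (A x)]
  [FiberBundle FA A] [VectorBundle ℝ FA A] [ContMDiffVectorBundle ∞ FA A 𝓘(ℝ, EM)]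
  {𝒜 : LieAlgebroid EM FA A}
  {F : Type*} [NormedAddCommGroup F] [NormedSpace ℝ F] [FiniteDimensional ℝ F]
  {E : M → Type*} [TopologicalSpace (TotalSpace F E)]
  [∀ x, AddCommGroup (E x)] [∀ x, Module ℝ (E x)] [∀ x, TopologicalSpace (E x)]
  [FiberBundle F E] [VectorBundle ℝ F E] [ContMDiffVectorBundle ∞ F E 𝓘(ℝ, EM)]

namespace RConnection

/-- A trace at (t, x) only involves End(E_x), where θ is determined by its action on pulled back
sections; so agreement of D' with D₁ on those at the single time t suffices. -/
theorem sliceFn_diffTrace {D D₁ : RConnection 𝒜.anchorHom F E}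
    {D' : RConnection 𝒜.lineAnchorHom F (PB EM E)} {t : ℝ}
    (h : ∀ a s, slice (D' (0, a) (pullSec s)) t = D₁ a s) (n : ℕ) (a : Fin n → 𝒜.Sec) :
    sliceFn (diffTrace D.lift D' n fun i => (0, a i)) t = diffTrace D D₁ n a := by
  ext x
  rw [sliceFn_apply, diffTrace_apply, diffTrace_apply]
  have e : ((fiberHom (t, x)).toLinearMap ∘ₗ diff D.lift D') ∘ₗ LinearMap.inr ℝ ℝ 𝒜.Sec =
      ((fiberHom x).toLinearMap ∘ₗ diff D D₁ : 𝒜.Sec →ₗ[ℝ] Module.End ℝ (E x)) := by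
    have key : ∀ b s, val (diff D.lift D' (0, b) (pullSec s)) (t, x) =
        fiberHom x (diff D D₁ b) (s x) := fun b s => by
      rw [fiberHom_apply, diff_apply, diff_apply, lift_pullSec, ← h b s]
      rfl
    exact LinearMap.ext fun b => fiberHom_pb_eq _ fun s => key b s
  have h1 := DFunLike.congr_fun ((wedgePow_compLinearMap (LinearMap.inr ℝ ℝ 𝒜.Sec)
    ((fiberHom (t, x)).toLinearMap ∘ₗ diff D.lift D') n).trans
    (congrArg (fun θ : 𝒜.Sec →ₗ[ℝ] Module.End ℝ (E x) => wedgePow θ n) e)) a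
  exact congrArg (LinearMap.trace ℝ (E x)) h1

variable [∀ x, IsTopologicalAddGroup (E x)] [∀ x, ContinuousConstSMul ℝ (E x)]

/-- On arguments from Γ(A) and pulled back sections, duality on ℝ × M restricts to the duality
relation on {t} × M, whose solution is unique. -/
theorem slice_isDual {B : PosPairing (LI EM) F (PB EM E)}
    {D D₁ : RConnection 𝒜.anchorHom F E} {D' : RConnection 𝒜.lineAnchorHom F (PB EM E)}
    (hD' : B.IsDual D.lift D') {h : ContMDiffRiemannianMetric 𝓘(ℝ, EM) ∞ F E}
    (hD₁ : D.IsDual h D₁) {t : ℝ}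
    (hB : ∀ σ τ, sliceFn (B σ τ) t = pairing h (slice σ t) (slice τ t)) (a : 𝒜.Sec)
    (s : Cₛ^∞⟮𝓘(ℝ, EM); F, E⟯) : slice (D' (0, a) (pullSec s)) t = D₁ a s := by
  refine (metricPairing h).ext_right fun s' => ?_
  have h1 : (metricPairing h).IsDual D D₁ := hD₁
  rw [h1.apply]
  change pairing h s' _ = 𝒜.anchorHom a (pairing h s' s) - pairing h (D a s') s
  have h2 := congrArg (fun f => sliceFn f t) (hD'.apply (0, a) (pullSec s') (pullSec s))
  have h3 : sliceFn (𝒜.lineAnchorHom (0, a) (B (pullSec s') (pullSec s))) t =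
      𝒜.anchorHom a (sliceFn (B (pullSec s') (pullSec s)) t) := by
    ext x
    refine (𝒜.lineDerivation_apply 0 a _ t x).trans ?_
    rw [zero_mul, zero_add]
    rfl
  have h4 : ∀ f g : C^∞⟮LI EM, ℝ × M; ℝ⟯, sliceFn (f - g) t = sliceFn f t - sliceFn g t :=
    fun f g => rfl
  simp only [h4, h3, hB, lift_pullSec] at h2
  exact h2

/-- The primitive is the integral over [0, 1] of the closed form attached to the lift of D and its
dual for the path of metrics. -/
theorem exists_d_eq_diffTrace_sub {D D₁ D₂ : RConnection 𝒜.anchorHom F E} (hD : D.IsFlat)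
    {h₁ h₂ : ContMDiffRiemannianMetric 𝓘(ℝ, EM) ∞ F E} (hD₁ : D.IsDual h₁ D₁)
    (hD₂ : D.IsDual h₂ D₂) (n : ℕ) [SigmaCompactSpace M] :
    ∃ η, d 𝒜.anchorHom n η = diffTrace D D₂ (n + 1) - diffTrace D D₁ (n + 1) := by
  obtain ⟨D', hD'⟩ := (pathPairing h₁ h₂).exists_isDual D.lift
  refine ⟨fibreIntegral (diffTrace D.lift D' (n + 1)), AlternatingMap.ext fun a => ?_⟩
  refine (d_fibreIntegral (d_diffTrace hD.lift (hD'.isFlat hD.lift) (n + 1)) a).trans ?_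
  -- The path (1 - t)² h₁ + t² h₂ is h₁ at t = 0 and h₂ at t = 1.
  rw [sliceFn_diffTrace (t := 0) (slice_isDual hD' hD₁ fun σ τ => ?_),
    sliceFn_diffTrace (t := 1) (slice_isDual hD' hD₂ fun σ τ => ?_)]
  · rfl
  · ext x
    rw [sliceFn_apply, pathPairing_apply]
    simp
  · ext x
    rw [sliceFn_apply, pathPairing_apply]
    simp

end RConnection

end Restriction

/-! ### Existence of a metric. -/

section Existence

variable {EM : Type*} [NormedAddCommGroup EM] [NormedSpace ℝ EM] [FiniteDimensional ℝ EM]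
  {M : Type*} [TopologicalSpace M] [ChartedSpace EM M] [IsManifold 𝓘(ℝ, EM) ∞ M] [T2Space M]
  {F : Type*} [NormedAddCommGroup F] [NormedSpace ℝ F] [FiniteDimensional ℝ F]
  {E : M → Type*} [TopologicalSpace (TotalSpace F E)]
  [∀ x, AddCommGroup (E x)] [∀ x, Module ℝ (E x)] [∀ x, TopologicalSpace (E x)]
  [FiberBundle F E] [VectorBundle ℝ F E]

variable (F) in
theorem exists_posDef_form : ∃ g : F →L[ℝ] F →L[ℝ] ℝ,
    (∀ v w, g v w = g w v) ∧ ∀ v, v ≠ 0 → 0 < g v v := by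
  let e : F ≃L[ℝ] EuclideanSpace ℝ (Fin (Module.finrank ℝ F)) :=
    ContinuousLinearEquiv.ofFinrankEq (by simp)
  let e' : F →L[ℝ] EuclideanSpace ℝ (Fin (Module.finrank ℝ F)) := e
  refine ⟨(innerSL ℝ).bilinearComp e' e', fun v w => ?_, fun v hv => ?_⟩
  · exact real_inner_comm (e w) (e v)
  · have : 0 < inner ℝ (e v) (e v) := real_inner_self_pos.2 (by simpa using hv)
    exact this

/-- Boundedness of the unit ball is part of the data of a Riemannian metric. It follows from the
positive minimum m of g on the compact unit sphere, since m ‖v‖² ≤ g(v, v). -/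
theorem isVonNBounded_of_posDef {g : F →L[ℝ] F →L[ℝ] ℝ} (hg : ∀ v, v ≠ 0 → 0 < g v v) :
    Bornology.IsVonNBounded ℝ {v : F | g v v < 1} := by
  have hc : Continuous fun v => g v v := g.continuous.clm_apply continuous_id
  rw [NormedSpace.isVonNBounded_iff']
  rcases (Metric.sphere (0 : F) 1).eq_empty_or_nonempty with h | h
  · refine ⟨0, fun v _ => ?_⟩
    by_contra hv
    have : v ≠ 0 := by
      rintro rfl
      simp at hv
    have h1 : ‖v‖⁻¹ • v ∈ Metric.sphere (0 : F) 1 := by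
      simp [norm_smul, this]
    rw [h] at h1
    exact h1
  · obtain ⟨u, hu, hmin⟩ := (isCompact_sphere (0 : F) 1).exists_isMinOn h hc.continuousOn
    have hu0 : u ≠ 0 := by
      rintro rfl
      simp at hu
    have hm := hg u hu0
    -- From ‖v‖² < 1/m and 2‖v‖ ≤ ‖v‖² + 1 this is a bound for ‖v‖ without a square root.
    refine ⟨(g u u)⁻¹ + 1, fun v hv => ?_⟩
    by_cases hv0 : v = 0
    · rw [hv0, norm_zero]
      positivity
    have hn : 0 < ‖v‖ := norm_pos_iff.2 hv0
    have h1 : ‖v‖⁻¹ • v ∈ Metric.sphere (0 : F) 1 := by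
      simp [norm_smul, hv0]
    have h2 : g u u ≤ g (‖v‖⁻¹ • v) (‖v‖⁻¹ • v) := hmin h1
    simp only [map_smul, smul_apply, smul_eq_mul] at h2
    have h3 : g u u * ‖v‖ ^ 2 ≤ g v v := by
      have := mul_le_mul_of_nonneg_right h2 (sq_nonneg ‖v‖)
      refine this.trans_eq ?_
      field_simp
    have h4 : g v v < 1 := hv
    have h5 : ‖v‖ ^ 2 < (g u u)⁻¹ := by
      rw [lt_inv_comm₀ (by positivity) hm, lt_inv_comm₀ hm (by positivity)]
      rw [← one_div, lt_div_iff₀ hm]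
      linarith
    nlinarith [sq_nonneg (‖v‖ - 1)]

variable [∀ x, IsTopologicalAddGroup (E x)] [∀ x, ContinuousConstSMul ℝ (E x)]

theorem _root_.ContinuousLinearEquiv.isVonNBounded_of_posDef {G : Type*} [AddCommGroup G]
    [Module ℝ G] [TopologicalSpace G] [IsTopologicalAddGroup G] [ContinuousConstSMul ℝ G]
    (e : G ≃L[ℝ] F) {g : G →L[ℝ] G →L[ℝ] ℝ} (hg : ∀ v, v ≠ 0 → 0 < g v v) :
    Bornology.IsVonNBounded ℝ {v : G | g v v < 1} := by
  have h := (RLin.isVonNBounded_of_posDef (F := F)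
    (g := (ContinuousLinearMap.precomp ℝ (e.symm : F →L[ℝ] G)).comp (g.comp (e.symm : F →L[ℝ] G)))
    fun v hv => hg (e.symm v) (e.symm.map_eq_zero_iff.not.2 hv)).image (e.symm : F →L[ℝ] G)
  refine Bornology.IsVonNBounded.subset ?_ h
  intro v hv
  exact ⟨e v, by simpa using hv, by simp⟩

-- A constant positive form on the model fibre is transported through the trivialization at x₀; it
-- is smooth because its coordinate expression is constant.
set_option synthInstance.maxHeartbeats 200000 in
theorem exists_local_metric [ContMDiffVectorBundle ∞ F E 𝓘(ℝ, EM)] (x₀ : M) :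
    ∃ U ∈ 𝓝 x₀, ∃ s : ∀ x, E x →L[ℝ] E x →L[ℝ] ℝ,
      ContMDiffOn 𝓘(ℝ, EM) (𝓘(ℝ, EM).prod 𝓘(ℝ, F →L[ℝ] F →L[ℝ] ℝ)) ∞
        (fun x => TotalSpace.mk' (F →L[ℝ] F →L[ℝ] ℝ)
          (E := fun x => E x →L[ℝ] E x →L[ℝ] ℝ) x (s x)) U ∧
      ∀ y ∈ U, (∀ v w, s y v w = s y w v) ∧ ∀ v, v ≠ 0 → 0 < s y v v := by
  obtain ⟨g, hsymm, hpos⟩ := exists_posDef_form F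
  let tr := trivializationAt F E x₀
  let tr' := trivializationAt (F →L[ℝ] F →L[ℝ] ℝ) (fun x => E x →L[ℝ] E x →L[ℝ] ℝ) x₀
  have hb : tr'.baseSet = tr.baseSet ∩ (tr.baseSet ∩ Set.univ) := rfl
  have hb' : tr'.baseSet = tr.baseSet := by rw [hb, Set.inter_univ, Set.inter_self]
  refine ⟨tr.baseSet, tr.open_baseSet.mem_nhds (FiberBundle.mem_baseSet_trivializationAt' x₀),
    fun x => tr'.symm x g, ?_, fun y hy => ?_⟩
  · have h : ContMDiffOn 𝓘(ℝ, EM) 𝓘(ℝ, F →L[ℝ] F →L[ℝ] ℝ) ∞ (fun _ : M => g) tr'.baseSet :=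
      contMDiffOn_const
    rw [← hb']
    refine (Trivialization.contMDiffOn_section_baseSet_iff (F := F →L[ℝ] F →L[ℝ] ℝ)
      (E := fun x => E x →L[ℝ] E x →L[ℝ] ℝ) (IB := 𝓘(ℝ, EM)) (n := ∞) tr').2 ?_
    refine h.congr fun y hy => ?_
    rw [tr'.apply_mk_symm hy]
  · have key : ∀ v w, tr'.symm y g v w =
        g (tr.continuousLinearMapAt ℝ y v) (tr.continuousLinearMapAt ℝ y w) := by
      intro v w
      have h1 : ContinuousLinearMap.inCoordinates F E (F →L[ℝ] ℝ) (fun x => E x →L[ℝ] ℝ)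
          x₀ y x₀ y (tr'.symm y g) = g :=
        congrArg Prod.snd (tr'.apply_mk_symm (by rwa [hb']) g)
      have h2 := inCoordinates_apply_eq₂ (F₃ := ℝ) (E₃ := Bundle.Trivial M ℝ) (ϕ := tr'.symm y g)
        (v := tr.continuousLinearMapAt ℝ y v) (w := tr.continuousLinearMapAt ℝ y w) hy hy trivial
      have h3 : ∀ v, tr.symm y (tr.continuousLinearMapAt ℝ y v) = v := fun v =>
        (tr.symmL_apply (R := ℝ) hy _).symm.trans (tr.symmL_continuousLinearMapAt (R := ℝ) hy v)
      rw [h3, h3] at h2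
      have h4 := DFunLike.congr_fun (DFunLike.congr_fun h1 (tr.continuousLinearMapAt ℝ y v))
        (tr.continuousLinearMapAt ℝ y w)
      refine Eq.trans ?_ (h2.symm.trans h4)
      simp
    refine ⟨fun v w => ?_, fun v hv => ?_⟩
    · rw [key, key, hsymm]
    · rw [key]
      refine hpos _ fun h => hv ?_
      have := tr.symmL_continuousLinearMapAt (R := ℝ) hy v
      rw [h, map_zero] at this
      exact this.symm

/-- Positive definite symmetric forms make up a convex set in each fibre, so local metrics are glued
by a partition of unity. -/
theorem exists_metric [SigmaCompactSpace M] [ContMDiffVectorBundle ∞ F E 𝓘(ℝ, EM)] :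
    Nonempty (ContMDiffRiemannianMetric 𝓘(ℝ, EM) ∞ F E) := by
  have i₁ : ∀ x, IsTopologicalAddGroup (E x →L[ℝ] ℝ) := fun x => inferInstance
  have i₂ : ∀ x, ContinuousAdd (E x →L[ℝ] ℝ) := fun x => inferInstance
  have key : ∃ s : Cₛ^∞⟮𝓘(ℝ, EM); F →L[ℝ] F →L[ℝ] ℝ, fun x => E x →L[ℝ] E x →L[ℝ] ℝ⟯,
      ∀ x, (∀ v w, s x v w = s x w v) ∧ ∀ v, v ≠ 0 → 0 < s x v v := by
    refine exists_contMDiffSection_forall_mem_convex_of_local (n := ⊤) 𝓘(ℝ, EM)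
      (F_fiber := F →L[ℝ] F →L[ℝ] ℝ) (fun x => E x →L[ℝ] E x →L[ℝ] ℝ)
      (fun x => {g | (∀ v w, g v w = g w v) ∧ ∀ v, v ≠ 0 → 0 < g v v}) ?_ exists_local_metric
    intro x g₁ h₁ g₂ h₂ α β hα hβ hαβ
    refine ⟨fun v w => ?_, fun v hv => ?_⟩
    · change α * g₁ v w + β * g₂ v w = α * g₁ w v + β * g₂ w v
      rw [h₁.1 v w, h₂.1 v w]
    · change 0 < α * g₁ v v + β * g₂ v v
      have e₁ := h₁.2 v hv
      have e₂ := h₂.2 v hv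
      rcases hα.eq_or_lt with rfl | hα
      · rw [zero_add] at hαβ
        rw [hαβ]
        simpa using e₂
      · positivity
  obtain ⟨s, hs⟩ := key
  exact ⟨⟨s, fun x => (hs x).1, fun x => (hs x).2,
    fun x => (fibreEquiv (F := F) (E := E) x).isVonNBounded_of_posDef (hs x).2, s.contMDiff⟩⟩

end Existence

/-! ### The secondary classes. -/

section Secondary

variable {EM : Type*} [NormedAddCommGroup EM] [NormedSpace ℝ EM] [FiniteDimensional ℝ EM]
  {M : Type*} [TopologicalSpace M] [ChartedSpace EM M] [IsManifold 𝓘(ℝ, EM) ∞ M]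
  [T2Space M] [SigmaCompactSpace M]
  {FA : Type*} [NormedAddCommGroup FA] [NormedSpace ℝ FA] [FiniteDimensional ℝ FA]
  {A : M → Type*} [TopologicalSpace (TotalSpace FA A)]
  [∀ x, AddCommGroup (A x)] [∀ x, Module ℝ (A x)] [∀ x, TopologicalSpace (A x)]
  [FiberBundle FA A] [VectorBundle ℝ FA A] [ContMDiffVectorBundle ∞ FA A 𝓘(ℝ, EM)]
  {𝒜 : LieAlgebroid EM FA A}
  {F : Type*} [NormedAddCommGroup F] [NormedSpace ℝ F] [FiniteDimensional ℝ F]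
  {E : M → Type*} [TopologicalSpace (TotalSpace F E)]
  [∀ x, AddCommGroup (E x)] [∀ x, Module ℝ (E x)] [∀ x, TopologicalSpace (E x)]
  [∀ x, IsTopologicalAddGroup (E x)] [∀ x, ContinuousConstSMul ℝ (E x)]
  [FiberBundle F E] [VectorBundle ℝ F E] [ContMDiffVectorBundle ∞ F E 𝓘(ℝ, EM)]

namespace RConnection

variable {D D₁ D₂ : RConnection 𝒜.anchorHom F E}
  {h h₁ h₂ : ContMDiffRiemannianMetric 𝓘(ℝ, EM) ∞ F E}

theorem existsUnique_isDual (D : RConnection 𝒜.anchorHom F E)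
    (h : ContMDiffRiemannianMetric 𝓘(ℝ, EM) ∞ F E) : ∃! D', D.IsDual h D' := by
  obtain ⟨D', hD'⟩ := (metricPairing h).exists_isDual D
  exact ⟨D', hD', fun D'' hD'' =>
    PosPairing.IsDual.unique (B := metricPairing h) hD'' hD'⟩

theorem IsDual.isFlat (hD₁ : D.IsDual h D₁) (hD : D.IsFlat) : D₁.IsFlat :=
  PosPairing.IsDual.isFlat (B := metricPairing h) hD₁ hD

theorem d_chernSimons (hD : D.IsFlat) (hD₁ : D₁.IsFlat) (q : ℕ) :
    d 𝒜.anchorHom (2 * q + 1) (chernSimons D D₁ (q + 1)) = 0 := by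
  rw [chernSimons_eq_smul hD hD₁]
  exact (map_smul (d 𝒜.anchorHom (2 * q + 1)) _ _).trans
    ((congrArg _ (d_diffTrace hD hD₁ _)).trans (smul_zero _))

theorem cohomologyClass_chernSimons_eq (hD : D.IsFlat) (hD₁ : D.IsDual h₁ D₁)
    (hD₂ : D.IsDual h₂ D₂) (q : ℕ)
    (hc₁ : d 𝒜.anchorHom (2 * q + 1) (chernSimons D D₁ (q + 1)) = 0)
    (hc₂ : d 𝒜.anchorHom (2 * q + 1) (chernSimons D D₂ (q + 1)) = 0) :
    cohomologyClass 𝒜.anchorHom (chernSimons D D₁ (q + 1)) hc₁ =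
      cohomologyClass 𝒜.anchorHom (chernSimons D D₂ (q + 1)) hc₂ := by
  refine (Submodule.Quotient.eq _).2 ?_
  -- The metrics enter in reverse order, since the quotient asks for the form of D₁ minus that of
  -- D₂.
  obtain ⟨η, hη⟩ := exists_d_eq_diffTrace_sub hD hD₂ hD₁ (2 * q)
  refine ⟨(∫ t in (0 : ℝ)..1, ((q + 1) * (t * t - t) ^ q : ℝ)) • η, ?_⟩
  refine (map_smul (d 𝒜.anchorHom (2 * q)) _ η).trans ?_
  rw [hη, smul_sub]
  have e₁ := chernSimons_eq_smul hD (hD₁.isFlat hD) q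
  have e₂ := chernSimons_eq_smul hD (hD₂.isFlat hD) q
  exact (congrArg₂ (· - ·) e₁ e₂).symm

theorem chernSimons_self (hD : D.IsFlat) (q : ℕ) : chernSimons D D (q + 1) = 0 := by
  refine (chernSimons_eq_smul hD hD q).trans ?_
  rw [diffTrace_self, smul_zero]

end RConnection

end Secondary

end RLin

end

theorem mainTheorem3
    {EM : Type*} [NormedAddCommGroup EM] [NormedSpace ℝ EM] [FiniteDimensional ℝ EM]
    {M : Type*} [TopologicalSpace M] [ChartedSpace EM M] [IsManifold 𝓘(ℝ, EM) ∞ M]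
    [T2Space M] [SigmaCompactSpace M]
    {FA : Type*} [NormedAddCommGroup FA] [NormedSpace ℝ FA] [FiniteDimensional ℝ FA]
    {A : M → Type*} [TopologicalSpace (TotalSpace FA A)]
    [∀ x, AddCommGroup (A x)] [∀ x, Module ℝ (A x)] [∀ x, TopologicalSpace (A x)]
    [FiberBundle FA A] [VectorBundle ℝ FA A] [ContMDiffVectorBundle ∞ FA A 𝓘(ℝ, EM)]
    (𝒜 : RLin.LieAlgebroid EM FA A)
    {F : Type*} [NormedAddCommGroup F] [NormedSpace ℝ F] [FiniteDimensional ℝ F]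
    {E : M → Type*} [TopologicalSpace (TotalSpace F E)]
    [∀ x, AddCommGroup (E x)] [∀ x, Module ℝ (E x)] [∀ x, TopologicalSpace (E x)]
    [∀ x, IsTopologicalAddGroup (E x)] [∀ x, ContinuousConstSMul ℝ (E x)]
    [FiberBundle F E] [VectorBundle ℝ F E] [ContMDiffVectorBundle ∞ F E 𝓘(ℝ, EM)]
    (D : RLin.RConnection 𝒜.anchorHom F E) (hD : D.IsFlat) (p : ℕ) (hp : 1 ≤ p) :
    -- every metric has exactly one dual connection
    (∀ h : ContMDiffRiemannianMetric 𝓘(ℝ, EM) ∞ F E, ∃! D', D.IsDual h D') ∧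
    -- the Chern-Simons form of the connection and its dual is closed
    (∀ (h : ContMDiffRiemannianMetric 𝓘(ℝ, EM) ∞ F E) (D' : RLin.RConnection 𝒜.anchorHom F E),
      D.IsDual h D' → RLin.d 𝒜.anchorHom (2 * p - 1) (D.chernSimons D' p) = 0) ∧
    -- its cohomology class does not depend on the metric
    (∀ (h₁ h₂ : ContMDiffRiemannianMetric 𝓘(ℝ, EM) ∞ F E)
      (D₁ D₂ : RLin.RConnection 𝒜.anchorHom F E), D.IsDual h₁ D₁ → D.IsDual h₂ D₂ →
      ∀ (hc₁ : RLin.d 𝒜.anchorHom (2 * p - 1) (D.chernSimons D₁ p) = 0)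
        (hc₂ : RLin.d 𝒜.anchorHom (2 * p - 1) (D.chernSimons D₂ p) = 0),
      RLin.cohomologyClass 𝒜.anchorHom (D.chernSimons D₁ p) hc₁ =
        RLin.cohomologyClass 𝒜.anchorHom (D.chernSimons D₂ p) hc₂) ∧
    -- hence there is a well defined secondary characteristic class in degree `2p - 1`
    (∃! u : RLin.Cohomology 𝒜.anchorHom (2 * p - 1),
      ∀ (h : ContMDiffRiemannianMetric 𝓘(ℝ, EM) ∞ F E) (D' : RLin.RConnection 𝒜.anchorHom F E),
        D.IsDual h D' → ∃ hc : RLin.d 𝒜.anchorHom (2 * p - 1) (D.chernSimons D' p) = 0,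
          RLin.cohomologyClass 𝒜.anchorHom (D.chernSimons D' p) hc = u) ∧
    -- and it vanishes if there is an invariant metric
    ((∃ h₀ : ContMDiffRiemannianMetric 𝓘(ℝ, EM) ∞ F E, D.IsInvariant h₀) →
      ∀ (h : ContMDiffRiemannianMetric 𝓘(ℝ, EM) ∞ F E) (D' : RLin.RConnection 𝒜.anchorHom F E),
        D.IsDual h D' → ∃ hc : RLin.d 𝒜.anchorHom (2 * p - 1) (D.chernSimons D' p) = 0,
          RLin.cohomologyClass 𝒜.anchorHom (D.chernSimons D' p) hc = 0) := by
  obtain ⟨q, rfl⟩ : ∃ q, p = q + 1 := ⟨p - 1, by omega⟩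
  have hclosed : ∀ (h : ContMDiffRiemannianMetric 𝓘(ℝ, EM) ∞ F E)
      (D' : RLin.RConnection 𝒜.anchorHom F E), D.IsDual h D' →
      RLin.d 𝒜.anchorHom (2 * (q + 1) - 1) (D.chernSimons D' (q + 1)) = 0 := fun h D' hD' =>
    RLin.RConnection.d_chernSimons hD (hD'.isFlat hD) q
  have hindep : ∀ (h₁ h₂ : ContMDiffRiemannianMetric 𝓘(ℝ, EM) ∞ F E)
      (D₁ D₂ : RLin.RConnection 𝒜.anchorHom F E), D.IsDual h₁ D₁ → D.IsDual h₂ D₂ →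
      ∀ (hc₁ : RLin.d 𝒜.anchorHom (2 * (q + 1) - 1) (D.chernSimons D₁ (q + 1)) = 0)
        (hc₂ : RLin.d 𝒜.anchorHom (2 * (q + 1) - 1) (D.chernSimons D₂ (q + 1)) = 0),
      RLin.cohomologyClass 𝒜.anchorHom (D.chernSimons D₁ (q + 1)) hc₁ =
        RLin.cohomologyClass 𝒜.anchorHom (D.chernSimons D₂ (q + 1)) hc₂ :=
    fun h₁ h₂ D₁ D₂ hD₁ hD₂ hc₁ hc₂ =>
      RLin.RConnection.cohomologyClass_chernSimons_eq hD hD₁ hD₂ q hc₁ hc₂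
  refine ⟨D.existsUnique_isDual, hclosed, hindep, ?_, ?_⟩
  -- Without a metric every class would satisfy the condition vacuously; uniqueness needs one to
  -- exist.
  · obtain ⟨h₀⟩ := RLin.exists_metric (EM := EM) (F := F) (E := E)
    obtain ⟨D₀, hD₀, -⟩ := D.existsUnique_isDual h₀
    refine ⟨RLin.cohomologyClass 𝒜.anchorHom _ (hclosed h₀ D₀ hD₀), fun h D' hD' =>
      ⟨hclosed h D' hD', hindep h h₀ D' D₀ hD' hD₀ _ _⟩, fun u hu => ?_⟩
    obtain ⟨hc, rfl⟩ := hu h₀ D₀ hD₀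
    rfl
  · rintro ⟨h₀, hinv⟩ h D' hD'
    -- Invariance says that D is its own dual for h₀, and by independence the class may be computed
    -- with h₀, where the form itself is zero.
    have hself : D.IsDual h₀ D := hinv
    refine ⟨hclosed h D' hD', (hindep h h₀ D' D hD' hself _ (hclosed h₀ D hself)).trans ?_⟩
    refine (Submodule.Quotient.mk_eq_zero _).2 ?_
    have hzero : D.chernSimons D (q + 1) = 0 := RLin.RConnection.chernSimons_self hD q
    change D.chernSimons D (q + 1) ∈ RLin.coboundaries 𝒜.anchorHom (2 * (q + 1) - 1)
    rw [hzero]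
    exact Submodule.zero_mem _
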